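/- Let $\Gamma$ be a finite connected metric graph with at least one edge (loops and multiple edges are allowed, every edge $e$ is a segment of some length $\ell_e>0$; for example all lengths equal to $1$). Regard $\Gamma$ as a metric space with its edges included, with the path metric: the distance of two points is the infimum of the lengths of paths joining them. For a metric space $M$ with at least two points, a total order $T$ on $M$ and a finite set $X\subset M$, let $l_{\mathrm{opt}}(X)$ be the minimal length of a path visiting all points of $X$ (a path is a finite sequence of points of $M$, its length is the sum of the distances of consecutive points), and let $l_T(X)=\sum_{i=1}^{m-1} d(x_i,x_{i+1})$, where $x_1<_T x_2<_T\dots<_T x_m$ are the points of $X$. Put $$\operatorname{OR}_{M,T}(k)=\sup_{X\subset M,\ 2\le \#X\le k+1}\frac{l_T(X)}{l_{\mathrm{opt}}(X)}\qquad(k\ge 1),$$ let $\operatorname{Br}(M,T)$ be the smallest integer $s\ge 1$ with $\operatorname{OR}_{M,T}(s)<s$ (and $\infty$ if there is none), and let $\operatorname{Br}(M)=\min_T \operatorname{Br}(M,T)$ over all total orders $T$ on $M$. A cactus graph is an acyclic gluing of finitely many circles and (nondegenerate compact) intervals. Up to homeomorphism this means: a Hausdorff space covered by finitely many closed pieces,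 each homeomorphic to a circle or to an interval, such that distinct pieces meet only in points of a finite set $J$ of joint points, and such that the bipartite graph whose vertices are the pieces and the joint points, a joint point being adjacent to a piece if and only if it lies on it, is a tree. Then: 1. If $\Gamma$ is homeomorphic to an interval, then $\operatorname{Br}(\Gamma)=2$. 2. If $\Gamma$ is homeomorphic to a cactus graph, but not to an interval, then $\operatorname{Br}(\Gamma)=3$. 3. Otherwise, $\operatorname{Br}(\Gamma)=4$. -/

import Mathlib

open scoped ENNReal

noncomputable section

/-- A connected metric graph with vertex set `V` and edge set `E`. Loops and multiple edges are
allowed. The edge `e` is a segment of length `len e > 0`, parametrized by `[0, len e]`, going from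
`src e` to `tgt e`; the direction is only a choice of parametrization. -/
structure ConnectedMetricGraph (V E : Type*) where
  src : E → V
  tgt : E → V
  len : E → ℝ
  len_pos : ∀ e, 0 < len e
  connected : ∀ u v : V, Relation.ReflTransGen
    (fun a b => ∃ e, (src e = a ∧ tgt e = b) ∨ (src e = b ∧ tgt e = a)) u v

namespace ConnectedMetricGraph

variable {V E : Type*}

/-- The points of a metric graph, edges included: the vertices, and the interior points of the
edges. -/
inductive Point (G : ConnectedMetricGraph V E) where
  | vertex (v : V) : Point G
  | interior (e : E) (t : ℝ) (ht : t ∈ Set.Ioo 0 (G.len e)) : Point G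

variable (G : ConnectedMetricGraph V E)

/-- The parametrization of the closed edge `e` by `[0, len e]`. -/
def pt (e : E) (t : ℝ) : G.Point :=
  open scoped Classical in
  if h : t ∈ Set.Ioo 0 (G.len e) then .interior e t h
  else if t ≤ 0 then .vertex (G.src e) else .vertex (G.tgt e)

/-- `G.Route p q r`: there is a path of length `r` from `p` to `q` which is a finite concatenation
of segments contained in edges. -/
inductive Route : G.Point → G.Point → ℝ → Prop
  | nil (p : G.Point) : Route p p 0
  | cons (e : E) (s t : ℝ) (hs : s ∈ Set.Icc 0 (G.len e)) (ht : t ∈ Set.Icc 0 (G.len e))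
      (q : G.Point) (r : ℝ) (h : Route (G.pt e t) q r) : Route (G.pt e s) q (|s - t| + r)

variable {G}

theorem Route.nonneg {p q : G.Point} {r : ℝ} (h : G.Route p q r) : 0 ≤ r := by
  induction h with
  | nil p => exact le_rfl
  | cons e s t hs ht q r h ih => positivity

theorem Route.trans {p q q' : G.Point} {r r' : ℝ} (h : G.Route p q r) (h' : G.Route q q' r') :
    G.Route p q' (r + r') := by
  induction h with
  | nil p => simpa using h'
  | cons e s t hs ht q r h ih => rw [add_assoc]; exact .cons e s t hs ht _ _ (ih h')

theorem Route.edge (e : E) {s t : ℝ} (hs : s ∈ Set.Icc 0 (G.len e))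
    (ht : t ∈ Set.Icc 0 (G.len e)) : G.Route (G.pt e s) (G.pt e t) |s - t| := by
  simpa using Route.cons e s t hs ht _ _ (.nil _)

theorem Route.symm {p q : G.Point} {r : ℝ} (h : G.Route p q r) : G.Route q p r := by
  induction h with
  | nil p => exact .nil p
  | cons e s t hs ht q r h ih =>
    rw [add_comm, abs_sub_comm]; exact ih.trans (.edge e ht hs)

theorem pt_zero (e : E) : G.pt e 0 = .vertex (G.src e) := by simp [pt]

theorem pt_len (e : E) : G.pt e (G.len e) = .vertex (G.tgt e) := by
  simp [pt, not_le.2 (G.len_pos e)]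

theorem pt_interior (e : E) (t : ℝ) (ht : t ∈ Set.Ioo 0 (G.len e)) :
    G.pt e t = .interior e t ht := by
  simp only [pt, dif_pos ht]

theorem exists_route_vertex (u v : V) : ∃ r, G.Route (.vertex u) (.vertex v) r := by
  induction G.connected u v with
  | refl => exact ⟨0, .nil _⟩
  | tail _ h ih =>
    obtain ⟨r, hr⟩ := ih
    obtain ⟨e, ⟨rfl, rfl⟩ | ⟨rfl, rfl⟩⟩ := h
    all_goals
      have h := Route.edge (G := G) e (Set.left_mem_Icc.2 (G.len_pos e).le)
        (Set.right_mem_Icc.2 (G.len_pos e).le)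
      rw [pt_zero, pt_len] at h
    · exact ⟨_, hr.trans h⟩
    · exact ⟨_, hr.trans h.symm⟩

theorem exists_route (p q : G.Point) : ∃ r, G.Route p q r := by
  have key : ∀ p : G.Point, ∃ v r, G.Route p (.vertex v) r := by
    rintro (v | ⟨e, t, ht⟩)
    · exact ⟨v, 0, .nil _⟩
    · refine ⟨G.src e, |t - 0|, ?_⟩
      rw [← pt_interior, ← pt_zero]
      exact .edge e (Set.Ioo_subset_Icc_self ht) (Set.left_mem_Icc.2 (G.len_pos e).le)
  obtain ⟨u, r, hr⟩ := key p
  obtain ⟨v, s, hs⟩ := key q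
  obtain ⟨m, hm⟩ := exists_route_vertex (G := G) u v
  exact ⟨_, (hr.trans hm).trans hs.symm⟩

/-- The distance is the infimum of the lengths of paths. -/
instance : Dist G.Point := ⟨fun p q => sInf {r | G.Route p q r}⟩

theorem dist_def (p q : G.Point) : dist p q = sInf {r | G.Route p q r} := rfl

theorem dist_le_of_route {p q : G.Point} {r : ℝ} (h : G.Route p q r) : dist p q ≤ r :=
  csInf_le ⟨0, fun _ h => h.nonneg⟩ h

theorem le_dist {p q : G.Point} {c : ℝ} (h : ∀ r, G.Route p q r → c ≤ r) : c ≤ dist p q :=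
  le_csInf (exists_route p q) h

/-- The inner (path) metric of a metric graph. -/
instance : PseudoMetricSpace G.Point where
  dist_self p := le_antisymm (dist_le_of_route (.nil p)) (le_dist fun _ h => h.nonneg)
  dist_comm p q := by
    rw [dist_def, dist_def]; congr 1; ext r; exact ⟨Route.symm, Route.symm⟩
  dist_triangle p q q' := by
    rw [← sub_le_iff_le_add]
    refine le_dist fun r hr => ?_
    rw [sub_le_iff_le_add, ← sub_le_iff_le_add']
    refine le_dist fun r' hr' => ?_
    rw [sub_le_iff_le_add']
    exact dist_le_of_route (hr.trans hr')

theorem abs_sub_le_dist (f : G.Point → ℝ)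
    (hf : ∀ e, ∀ s ∈ Set.Icc 0 (G.len e), ∀ t ∈ Set.Icc 0 (G.len e),
      |f (G.pt e s) - f (G.pt e t)| ≤ |s - t|) (p q : G.Point) : |f p - f q| ≤ dist p q := by
  refine le_dist fun r hr => ?_
  induction hr with
  | nil p => simp
  | cons e s t hs ht q r h ih =>
    exact (abs_sub_le _ (f (G.pt e t)) _).trans (add_le_add (hf e s hs t ht) ih)

theorem dist_interior_pos (e : E) (t : ℝ) (ht : t ∈ Set.Ioo 0 (G.len e)) (q : G.Point)
    (hq : Point.interior e t ht ≠ q) : 0 < dist (Point.interior e t ht) q := by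
  classical
  set c := min t (G.len e - t) with hc
  have hct : c ≤ t := min_le_left _ _
  have hcl : c ≤ G.len e - t := min_le_right _ _
  have hc0 : 0 < c := lt_min ht.1 (sub_pos.2 ht.2)
  let f : G.Point → ℝ := fun p => match p with
    | .vertex _ => 0
    | .interior e' s _ => if e' = e then max 0 (c - |s - t|) else 0
  have hfe : ∀ s ∈ Set.Icc 0 (G.len e), f (G.pt e s) = max 0 (c - |s - t|) := by
    intro s hs
    rcases hs.1.eq_or_lt with rfl | h0
    · rw [pt_zero, max_eq_left]
      rw [zero_sub, abs_neg, abs_of_pos ht.1]; linarith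
    rcases hs.2.eq_or_lt with rfl | h1
    · rw [pt_len, max_eq_left]
      rw [abs_of_pos (sub_pos.2 ht.2)]; linarith
    · rw [pt_interior e s ⟨h0, h1⟩]; simp [f]
  have hfn : ∀ e' s, e' ≠ e → f (G.pt e' s) = 0 := by
    intro e' s h
    unfold pt
    split_ifs <;> simp [f, h]
  have hf := abs_sub_le_dist f (by
    intro e' s hs s' hs'
    by_cases h : e' = e
    · subst h
      rw [hfe s hs, hfe s' hs']
      refine (abs_max_sub_max_le_max _ _ _ _).trans (max_le (by simp) ?_)
      rw [show c - |s - t| - (c - |s' - t|) = |s' - t| - |s - t| by ring, abs_sub_comm s s']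
      refine (abs_abs_sub_abs_le_abs_sub _ _).trans (le_of_eq ?_)
      congr 1; ring
    · simp [hfn, h]) (Point.interior e t ht) q
  refine lt_of_lt_of_le (abs_pos.2 (sub_ne_zero.2 ?_)) hf
  have h1 : f (Point.interior e t ht) = c := by simp [f, hc0.le]
  rw [h1]
  rcases q with v | ⟨e', s, hs⟩
  · exact hc0.ne'
  · by_cases h : e' = e
    · subst h
      have hst : s ≠ t := fun h => hq (by subst h; rfl)
      have : 0 < |s - t| := abs_pos.2 (sub_ne_zero.2 hst)
      simp only [f, if_true]
      exact (max_lt hc0 (by linarith)).ne'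
    · simp only [f, h, if_false]; exact hc0.ne'

theorem dist_vertex_pos [Finite E] (v w : V) (hvw : v ≠ w) :
    0 < dist (Point.vertex v : G.Point) (.vertex w) := by
  classical
  obtain ⟨c, hc0, hc⟩ : ∃ c : ℝ, 0 < c ∧ ∀ e, c ≤ G.len e := by
    rcases isEmpty_or_nonempty E with _ | _
    · exact ⟨1, one_pos, fun e => isEmptyElim e⟩
    · obtain ⟨e, he⟩ := Finite.exists_min G.len
      exact ⟨_, G.len_pos e, he⟩
  let g : E → ℝ → ℝ := fun e t => max (max 0 (if G.src e = v then c - t else 0))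
    (if G.tgt e = v then c - (G.len e - t) else 0)
  let f : G.Point → ℝ := fun p => match p with
    | .vertex u => if u = v then c else 0
    | .interior e s _ => g e s
  have hfe : ∀ e, ∀ s ∈ Set.Icc 0 (G.len e), f (G.pt e s) = g e s := by
    intro e s hs
    have := hc e
    rcases hs.1.eq_or_lt with rfl | h0
    · rw [pt_zero]
      simp only [f, g]
      split_ifs <;> simp [hc0.le, this] <;> linarith
    rcases hs.2.eq_or_lt with rfl | h1
    · rw [pt_len]
      simp only [f, g]
      split_ifs <;> simp [hc0.le, this]
    · rw [pt_interior e s ⟨h0, h1⟩]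
  have hf := abs_sub_le_dist f (by
    intro e s hs s' hs'
    rw [hfe e s hs, hfe e s' hs']
    have hn := abs_nonneg (s - s')
    refine (abs_max_sub_max_le_max _ _ _ _).trans (max_le
      ((abs_max_sub_max_le_max _ _ _ _).trans (max_le (by simp) ?_)) ?_)
    · split_ifs
      · rw [show c - s - (c - s') = s' - s by ring, abs_sub_comm]
      · simp
    · split_ifs
      · rw [show c - (G.len e - s) - (c - (G.len e - s')) = s - s' by ring]
      · simp) (Point.vertex v) (.vertex w)
  refine lt_of_lt_of_le (abs_pos.2 ?_) hf
  simp [f, hvw.symm, hc0.ne']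

instance [Finite E] : MetricSpace G.Point where
  eq_of_dist_eq_zero := by
    intro p q h
    by_contra hpq
    refine ne_of_gt ?_ h
    rcases p with v | ⟨e, t, ht⟩
    · rcases q with w | ⟨e, t, ht⟩
      · exact dist_vertex_pos v w fun h => hpq (by rw [h])
      · rw [dist_comm]; exact dist_interior_pos e t ht _ (Ne.symm hpq)
    · exact dist_interior_pos e t ht _ hpq

end ConnectedMetricGraph

section OrderBreakpoint

variable {M : Type*} [MetricSpace M]

/-- The length `d(x₁,x₂) + d(x₂,x₃) + ⋯` of the path visiting the points of a list in turn. -/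
def pathLength : List M → ℝ
  | [] => 0
  | [_] => 0
  | x :: y :: l => dist x y + pathLength (y :: l)

/-- `l_opt(X)`: the minimal length of a path which visits all points of `X`. -/
def lOpt (X : Finset M) : ℝ := ⨅ l : {l : List M // ∀ x ∈ X, x ∈ l}, pathLength l.1

/-- `l_T(X)`: the length of the path which visits the points of `X` in increasing order for `T`. -/
def lOrd (T : LinearOrder M) (X : Finset M) : ℝ := letI := T; pathLength (X.sort (· ≤ ·))

/-- The order ratio function `OR_{M,T}(k)`, for `M` with at least two points: the supremum of
`l_T(X) / l_opt(X)` over the subsets `X` of `M` with `2 ≤ #X ≤ k + 1`. -/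
def orderRatio (T : LinearOrder M) (k : ℕ) : ℝ≥0∞ :=
  ⨆ (X : Finset M) (_ : 2 ≤ X.card ∧ X.card ≤ k + 1), ENNReal.ofReal (lOrd T X / lOpt X)

/-- `Br(M,T)`: the smallest integer `s ≥ 1` with `OR_{M,T}(s) < s`, and `∞` if there is none. -/
def orderBreakpointOf (T : LinearOrder M) : ℕ∞ :=
  ⨅ (s : ℕ) (_ : 1 ≤ s ∧ orderRatio T s < s), (s : ℕ∞)

variable (M) in
/-- `Br(M)`: the minimum of `Br(M,T)` over all total orders `T` on `M`. -/
def orderBreakpoint : ℕ∞ := ⨅ T : LinearOrder M, orderBreakpointOf T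

end OrderBreakpoint

section Cactus

variable {X : Type*} [TopologicalSpace X]

/-- The bipartite graph of a family of pieces `M i` and a set `J` of joint points, in which
the joint point `x` is adjacent to the piece `M i` if and only if `x ∈ M i`. -/
def gluingGraph {n : ℕ} (M : Fin n → Set X) (J : Finset X) : SimpleGraph (Fin n ⊕ J) where
  Adj
    | .inl i, .inr x => x.1 ∈ M i
    | .inr x, .inl i => x.1 ∈ M i
    | _, _ => False
  symm := ⟨by rintro (i | x) (j | y) h <;> exact h⟩
  loopless := ⟨by rintro (i | x) h <;> exact h⟩

variable (X) in
/-- The (Hausdorff) space `X` is homeomorphic to a cactus graph, that is, to an acyclic gluing of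
finitely many circles and intervals: `X` is covered by finitely many closed pieces, each of them
homeomorphic to a circle or to an interval, distinct pieces meet only in points of a finite set `J`
of joint points, and the graph of incidences between pieces and joint points is a tree. -/
def IsHomeomorphicToCactus [T2Space X] : Prop :=
  ∃ (n : ℕ) (M : Fin n → Set X) (J : Finset X),
    (∀ i, IsClosed (M i)) ∧
    (∀ i, Nonempty (M i ≃ₜ unitInterval) ∨ Nonempty (M i ≃ₜ Circle)) ∧
    (⋃ i, M i) = Set.univ ∧
    (∀ i j, i ≠ j → M i ∩ M j ⊆ J) ∧
    (gluingGraph M J).IsTree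

end Cactus

end

/-! ### Arcs, simple closed curves, and sets without ears -/

noncomputable section

section Curves

open Set

variable {X : Type*}

/-! An order ratio close to `s` on `s + 1` points can only come from an elongated snake: an
increasing sequence whose members of even index lie close together, and likewise those of odd index,
while the two clusters are far apart compared with their diameters. An order without such snakes has
ratio below `s` (`SnakeBound.orderRatio_lt`); `exists_three_snake_bound` and
`exists_four_snake_bound` are converses for `s = 2` and `s = 3`. For `s = 1` any two points have
ratio 1, so the breakpoint is at least 2.

For `s = 3` the absence of snakes is a topological property: no `x₁ < x₂ < x₃ < x₄` have `x₁, x₃`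
and `x₂, x₄` in disjoint continua. Connectedness and a parity count turn a large crossing into
arbitrarily small ones (`noncrossing_of_four_snake_bound`). Conversely, close points of a graph are
joined by small continua, which have to meet (`snakeBound_of_noncrossing`). A cactus has a
noncrossing order: each attached curve is inserted as a block in place of its attaching point, which
becomes the least element of the block (`Noncrossing.union`). A theta graph has none: in the cyclic
order its two branch points would separate any two of three points chosen on the three strands, but
there are only two sides (`Noncrossing.theta`). A graph with a noncrossing order is then exhausted
by attaching edges and cycles one at a time (`exists_larger_cactusSet`), hence is a cactus.

For `s = 2` the same passage from local to global shows that no point lies between two points of a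
continuum avoiding it. This rules out circles and tripods, and of all cacti only the arc remains
(`IsCactusSet.eq_singleton_or_arc`).

For `s = 4` every graph has a good order: edges are cut into thirds, the outer thirds are grouped
into stars around the vertices, and stars and middle thirds are listed as consecutive blocks. Two
consecutive points of a five-point snake are close, either because part of the snake runs within one
segment or because the snake is gathered around one vertex (`exists_snakeBound_four`). -/

theorem image_reverse (γ : ℝ → X) : (fun t => γ (1 - t)) '' Icc 0 1 = γ '' Icc 0 1 := by
  ext x
  constructor
  · rintro ⟨t, ht, rfl⟩
    exact ⟨1 - t, ⟨by linarith [ht.2], by linarith [ht.1]⟩, rfl⟩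
  · rintro ⟨t, ht, rfl⟩
    exact ⟨1 - t, ⟨by linarith [ht.2], by linarith [ht.1]⟩, by simp⟩

/-- The concatenation of two curves. -/
def concat (γ δ : ℝ → X) (t : ℝ) : X := if t ≤ 1 / 2 then γ (2 * t) else δ (2 * t - 1)

theorem concat_zero (γ δ : ℝ → X) : concat γ δ 0 = γ 0 := by simp [concat]

theorem concat_one (γ δ : ℝ → X) : concat γ δ 1 = δ 1 := by norm_num [concat]

theorem concat_of_mem_Ioo (γ δ : ℝ → X) {t : ℝ} (ht : t ∈ Ioo (0 : ℝ) 1) :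
    (∃ s ∈ Ioo (0 : ℝ) 1, concat γ δ t = γ s) ∨ (∃ s ∈ Ioo (0 : ℝ) 1, concat γ δ t = δ s) ∨
      concat γ δ t = γ 1 := by
  rcases lt_trichotomy t (1 / 2) with h | h | h
  · exact Or.inl ⟨2 * t, ⟨by linarith [ht.1], by linarith⟩, by simp only [concat, if_pos h.le]⟩
  · right; right; subst h; norm_num [concat]
  · exact Or.inr (Or.inl ⟨2 * t - 1, ⟨by linarith, by linarith [ht.2]⟩,
      by simp only [concat, if_neg (not_le.2 h)]⟩)

theorem image_concat (γ δ : ℝ → X) (h1 : γ 1 = δ 0) :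
    concat γ δ '' Icc 0 1 = γ '' Icc 0 1 ∪ δ '' Icc 0 1 := by
  ext x
  constructor
  · rintro ⟨t, ht, rfl⟩
    unfold concat
    split_ifs with h
    · exact Or.inl ⟨2 * t, ⟨by linarith [ht.1], by linarith⟩, rfl⟩
    · exact Or.inr ⟨2 * t - 1, ⟨by linarith, by linarith [ht.2]⟩, rfl⟩
  · rintro (⟨t, ht, rfl⟩ | ⟨t, ht, rfl⟩)
    · refine ⟨t / 2, ⟨by linarith [ht.1], by linarith [ht.2]⟩, ?_⟩
      unfold concat
      rw [if_pos (by linarith [ht.2])]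
      congr 1; ring
    · refine ⟨(t + 1) / 2, ⟨by linarith [ht.1], by linarith [ht.2]⟩, ?_⟩
      unfold concat
      -- At `t = 0` the new parameter is `1 / 2`, which `concat` assigns to `γ`; the point is then
      -- `γ 1 = δ 0`.
      split_ifs with h
      · have : t = 0 := by linarith [ht.1]
        subst this
        rw [← h1]; congr 1; ring
      · congr 1; ring

variable [TopologicalSpace X]

/-- A simple curve, parametrized by `[0, 1]`: either an arc or a simple closed curve. -/
structure IsSimpleCurve (γ : ℝ → X) : Prop where
  continuousOn : ContinuousOn γ (Icc 0 1)
  inj : ∀ s ∈ Icc (0 : ℝ) 1, ∀ t ∈ Icc (0 : ℝ) 1, s < t → γ s = γ t → s = 0 ∧ t = 1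

/-- An arc, parametrized by `[0, 1]`. -/
structure IsArc (γ : ℝ → X) : Prop where
  continuousOn : ContinuousOn γ (Icc 0 1)
  injOn : InjOn γ (Icc 0 1)

namespace IsSimpleCurve

variable {γ : ℝ → X}

theorem isCompact_image (h : IsSimpleCurve γ) {a b : ℝ} (ha : 0 ≤ a) (hb : b ≤ 1) :
    IsCompact (γ '' Icc a b) :=
  isCompact_Icc.image_of_continuousOn (h.continuousOn.mono (Icc_subset_Icc ha hb))

theorem isPreconnected_image (h : IsSimpleCurve γ) {a b : ℝ} (ha : 0 ≤ a) (hb : b ≤ 1) :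
    IsPreconnected (γ '' Icc a b) :=
  isPreconnected_Icc.image _ (h.continuousOn.mono (Icc_subset_Icc ha hb))

theorem isArc (h : IsSimpleCurve γ) (h01 : γ 0 ≠ γ 1) : IsArc γ := by
  refine ⟨h.continuousOn, fun s hs t ht hst => ?_⟩
  rcases lt_trichotomy s t with hlt | heq | hlt
  · obtain ⟨rfl, rfl⟩ := h.inj s hs t ht hlt hst
    exact absurd hst h01
  · exact heq
  · obtain ⟨rfl, rfl⟩ := h.inj t ht s hs hlt hst.symm
    exact absurd hst.symm h01

theorem reverse (h : IsSimpleCurve γ) : IsSimpleCurve (fun t => γ (1 - t)) := by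
  constructor
  · refine h.continuousOn.comp (by fun_prop) fun t ht => ?_
    exact ⟨by linarith [ht.2], by linarith [ht.1]⟩
  · intro s hs t ht hst heq
    have := h.inj (1 - t) ⟨by linarith [ht.2], by linarith [ht.1]⟩ (1 - s)
      ⟨by linarith [hs.2], by linarith [hs.1]⟩ (by linarith) heq.symm
    exact ⟨by linarith, by linarith⟩

/-- A proper part of a simple curve is an arc. -/
theorem isArc_restrict (h : IsSimpleCurve γ) {a b : ℝ} (ha : 0 ≤ a) (hb : b ≤ 1) (hab : a < b)
    (hne : γ a ≠ γ b) : IsArc (fun t => γ (a + (b - a) * t)) := by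
  have hm : ∀ t ∈ Icc (0 : ℝ) 1, a + (b - a) * t ∈ Icc a b := fun t ht =>
    ⟨by nlinarith [ht.1], by nlinarith [ht.2]⟩
  have hm' : ∀ t ∈ Icc (0 : ℝ) 1, a + (b - a) * t ∈ Icc (0 : ℝ) 1 := fun t ht =>
    Icc_subset_Icc ha hb (hm t ht)
  refine IsSimpleCurve.isArc ⟨h.continuousOn.comp (by fun_prop) hm', ?_⟩ (by simpa using hne)
  intro s hs t ht hst heq
  have hlt : a + (b - a) * s < a + (b - a) * t := by nlinarith
  have := h.inj _ (hm' s hs) _ (hm' t ht) hlt heq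
  have h1 := hm s hs
  have h2 := hm t ht
  constructor
  · have : (b - a) * s = 0 := by nlinarith [h1.1]
    rcases mul_eq_zero.1 this with h | h <;> linarith
  · have : (b - a) * (1 - t) = 0 := by nlinarith [h2.2]
    rcases mul_eq_zero.1 this with h | h <;> linarith

end IsSimpleCurve

namespace IsArc

variable {γ δ : ℝ → X}

theorem isSimpleCurve (h : IsArc γ) : IsSimpleCurve γ :=
  ⟨h.continuousOn, fun _ hs _ ht hst heq => absurd (h.injOn hs ht heq) hst.ne⟩

theorem ne (h : IsArc γ) : γ 0 ≠ γ 1 := fun heq => by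
  have := h.injOn (by simp) (by simp) heq
  norm_num at this

theorem reverse (h : IsArc γ) : IsArc (fun t => γ (1 - t)) :=
  h.isSimpleCurve.reverse.isArc (by simpa using h.ne.symm)

end IsArc

/-- Two arcs of which only endpoints coincide form a simple curve. -/
theorem IsArc.concat {γ δ : ℝ → X} (hγ : IsArc γ) (hδ : IsArc δ) (h1 : γ 1 = δ 0)
    (h : ∀ s ∈ Icc (0 : ℝ) 1, ∀ t ∈ Icc (0 : ℝ) 1, γ s = δ t → (s = 1 ∧ t = 0) ∨ (s = 0 ∧ t = 1)) :
    IsSimpleCurve (concat γ δ) := by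
  constructor
  · have hc : ContinuousOn (_root_.concat γ δ) (Icc 0 (1 / 2) ∪ Icc (1 / 2) 1) := by
      refine ContinuousOn.union_of_isClosed ?_ ?_ isClosed_Icc isClosed_Icc
      · refine ContinuousOn.congr (f := fun t => γ (2 * t))
          (hγ.continuousOn.comp (by fun_prop) ?_) ?_
        · exact fun t ht => ⟨by linarith [ht.1], by linarith [ht.2]⟩
        · exact fun t ht => if_pos ht.2
      · refine ContinuousOn.congr (f := fun t => δ (2 * t - 1))
          (hδ.continuousOn.comp (by fun_prop) ?_) ?_
        · exact fun t ht => ⟨by linarith [ht.1], by linarith [ht.2]⟩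
        · intro t ht
          rcases ht.1.eq_or_lt with rfl | hlt
          · norm_num [_root_.concat, h1]
          · exact if_neg (not_le.2 hlt)
    rwa [Icc_union_Icc_eq_Icc (by norm_num) (by norm_num)] at hc
  · intro s hs t ht hst heq
    unfold _root_.concat at heq
    split_ifs at heq with h1 h2 h2
    · have := hγ.injOn ⟨by linarith [hs.1], by linarith⟩ ⟨by linarith [ht.1], by linarith⟩ heq
      linarith
    · rcases h _ ⟨by linarith [hs.1], by linarith⟩ _ ⟨by linarith, by linarith [ht.2]⟩ heq
        with ⟨h3, h4⟩ | ⟨h3, h4⟩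
      · exact absurd hst (by linarith)
      · exact ⟨by linarith, by linarith⟩
    · linarith
    · have := hδ.injOn ⟨by linarith, by linarith [hs.2]⟩ ⟨by linarith, by linarith [ht.2]⟩ heq
      linarith

/-- A set is saturated if no arc has its endpoints in the set, and its other points outside. -/
def Saturated (S : Set X) : Prop :=
  ∀ η : ℝ → X, IsArc η → η 0 ∈ S → η 1 ∈ S → (∀ t ∈ Ioo (0 : ℝ) 1, η t ∉ S) → False

/-- An ear from `S` to a point of the new curve outside `S` can be prolonged along that curve back
to `γ 0`, which gives an ear of `S`. So only ears with both ends on the new curve need a separate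
hypothesis. -/
theorem Saturated.union {S : Set X} (hS : Saturated S) {γ : ℝ → X} (hγ : IsSimpleCurve γ)
    (hu : S ∩ γ '' Icc 0 1 = {γ 0})
    (hM : ∀ η : ℝ → X, IsArc η → η 0 ∈ γ '' Icc 0 1 → η 1 ∈ γ '' Icc 0 1 →
      (∀ t ∈ Ioo (0 : ℝ) 1, η t ∉ S ∪ γ '' Icc 0 1) → False) :
    Saturated (S ∪ γ '' Icc 0 1) := by
  have key : ∀ η : ℝ → X, IsArc η → η 0 ∈ S → η 1 ∈ γ '' Icc 0 1 →
      (∀ t ∈ Ioo (0 : ℝ) 1, η t ∉ S ∪ γ '' Icc 0 1) → False := by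
    intro η hη h0 h1 ht
    by_cases h1S : η 1 ∈ S
    · exact hS η hη h0 h1S fun t h h' => ht t h (Or.inl h')
    by_cases h0M : η 0 ∈ γ '' Icc 0 1
    · exact hM η hη h0M h1 ht
    obtain ⟨s, hs, hs1⟩ := h1
    have huS : γ 0 ∈ S := (hu.ge rfl).1
    have hne : γ 0 ≠ γ s := fun h => h1S (by rw [← hs1, ← h]; exact huS)
    have hs0 : 0 < s := lt_of_le_of_ne hs.1 (by rintro rfl; exact hne rfl)
    have hδ := (hγ.isArc_restrict le_rfl hs.2 hs0 hne).reverse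
    set δ : ℝ → X := fun t => γ (0 + (s - 0) * (1 - t)) with hδdef
    have hδM : ∀ t ∈ Icc (0 : ℝ) 1, δ t ∈ γ '' Icc 0 1 := fun t ht =>
      ⟨_, ⟨by nlinarith [ht.2], by nlinarith [hs.2, ht.1, hs.1]⟩, rfl⟩
    have hδ0 : δ 0 = η 1 := by simp [hδdef, hs1]
    have hδ1 : δ 1 = γ 0 := by simp [hδdef]
    have hc : ∀ a ∈ Icc (0 : ℝ) 1, ∀ t ∈ Icc (0 : ℝ) 1, η a = δ t → a = 1 ∧ t = 0 := by
      intro a ha t ht' heq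
      have h2 : η a ∈ γ '' Icc 0 1 := heq ▸ hδM t ht'
      have ha1 : a = 1 := by
        by_contra hne1
        rcases ha.1.eq_or_lt with rfl | hlt
        · exact h0M h2
        · exact ht a ⟨hlt, lt_of_le_of_ne ha.2 hne1⟩ (Or.inr h2)
      subst ha1
      exact ⟨rfl, (hδ.injOn ht' (by simp) (heq.symm.trans hδ0.symm))⟩
    have hsc := hη.concat hδ hδ0.symm fun a ha t ht' heq => Or.inl (hc a ha t ht' heq)
    have harc := hsc.isArc (by
      rw [concat_zero, concat_one, hδ1]
      exact fun h => h0M (h ▸ ⟨0, by simp, rfl⟩))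
    refine hS _ harc (by rwa [concat_zero]) (by rwa [concat_one, hδ1]) fun t htt htS => ?_
    rcases concat_of_mem_Ioo η δ htt with ⟨a, ha, h⟩ | ⟨a, ha, h⟩ | h
    · exact ht a ha (Or.inl (h ▸ htS))
    · rw [h] at htS
      have : δ a ∈ S ∩ γ '' Icc 0 1 := ⟨htS, hδM a (Ioo_subset_Icc_self ha)⟩
      rw [hu] at this
      have := hδ.injOn (Ioo_subset_Icc_self ha) (by simp) (this.trans hδ1.symm)
      exact ha.2.ne this
    · exact h1S (h ▸ htS)
  intro η hη h0 h1 ht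
  rcases h0 with h0 | h0
  · rcases h1 with h1 | h1
    · exact hS η hη h0 h1 fun t h h' => ht t h (Or.inl h')
    · exact key η hη h0 h1 ht
  · rcases h1 with h1 | h1
    · exact key _ hη.reverse (by simpa using h1) (by simpa using h0) fun t h =>
        ht _ ⟨by linarith [h.2], by linarith [h.1]⟩
    · exact hM η hη h0 h1 ht

end Curves

end

/-! ### Noncrossing orders: existence on cacti, obstruction by theta graphs -/

noncomputable section

section NoncrossingOrders

open Set

/-- The lexicographic order on `X`, first by the value of `f` with respect to `r`, then by `q`. -/
def lexRel {X Y : Type*} (f : X → Y) (r : Y → Y → Prop) (q : X → X → Prop) (x y : X) : Prop :=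
  r (f x) (f y) ∨ f x = f y ∧ q x y

theorem isStrictTotalOrder_lexRel {X Y : Type*} (f : X → Y) (r : Y → Y → Prop)
    (q : X → X → Prop) [IsStrictTotalOrder Y r] [IsStrictTotalOrder X q] :
    IsStrictTotalOrder X (lexRel f r q) where
  trichotomous x y h1 h2 := by
    simp only [lexRel, not_or, not_and] at h1 h2
    have hf : f x = f y := Std.Trichotomous.trichotomous _ _ h1.1 h2.1
    exact Std.Trichotomous.trichotomous (r := q) _ _ (h1.2 hf) (h2.2 hf.symm)
  irrefl x h := by
    rcases h with h | h
    · exact irrefl _ h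
    · exact irrefl _ h.2
  trans x y z h1 h2 := by
    rcases h1 with h1 | ⟨h1, h1'⟩ <;> rcases h2 with h2 | ⟨h2, h2'⟩
    · exact Or.inl (_root_.trans h1 h2)
    · exact Or.inl (h2 ▸ h1)
    · exact Or.inl (h1 ▸ h2)
    · exact Or.inr ⟨h1.trans h2, _root_.trans h1' h2'⟩

variable {X : Type*} [TopologicalSpace X]

/-- An order is noncrossing on `S` if there are no points `x₁ < x₂ < x₃ < x₄` such that `x₁, x₃`
and `x₂, x₄` belong to disjoint subcontinua of `S`. -/
def Noncrossing (r : X → X → Prop) (S : Set X) : Prop :=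
  ∀ A B : Set X, IsCompact A → IsPreconnected A → A ⊆ S → IsCompact B → IsPreconnected B → B ⊆ S →
    Disjoint A B → ∀ x₁ ∈ A, ∀ x₂ ∈ B, ∀ x₃ ∈ A, ∀ x₄ ∈ B, r x₁ x₂ → r x₂ x₃ → r x₃ x₄ → False

theorem Noncrossing.singleton (r : X → X → Prop) (p : X) : Noncrossing r {p} := by
  intro A B _ _ hA _ _ hB h x₁ h₁ x₂ h₂ _ _ _ _ _ _ _
  have e1 : x₁ = p := hA h₁
  have e2 : x₂ = p := hB h₂
  exact disjoint_left.1 h h₁ (by rw [e1, ← e2]; exact h₂)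

/-- The curve is ordered by its parameter. A continuum through `x₁` and `x₃` must leave the segment
between `x₂` and `x₄`, and it can do so only through these two points. That the initial point is the
least one is what allows attaching the curve there. -/
theorem IsSimpleCurve.exists_noncrossing [T2Space X] {γ : ℝ → X} (hγ : IsSimpleCurve γ) :
    ∃ q : X → X → Prop, IsStrictTotalOrder X q ∧ Noncrossing q (γ '' Icc 0 1) ∧
      ∀ x ∈ γ '' Icc 0 1, x ≠ γ 0 → q (γ 0) x := by
  classical
  -- On a closed curve the base point has the two parameters 0 and 1, and 0 is chosen. Points off
  -- the curve get an irrelevant value; the well-order breaks ties among them.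
  have hex : ∀ x, ∃ t : ℝ, x ∈ γ '' Icc 0 1 → t ∈ Icc (0 : ℝ) 1 ∧ γ t = x ∧ (x = γ 0 → t = 0) := by
    intro x
    by_cases h0 : x = γ 0
    · exact ⟨0, fun _ => ⟨by simp, h0.symm, fun _ => rfl⟩⟩
    · by_cases hx : x ∈ γ '' Icc 0 1
      · obtain ⟨t, ht, rfl⟩ := hx
        exact ⟨t, fun _ => ⟨ht, rfl, fun h => absurd h h0⟩⟩
      · exact ⟨0, fun h => absurd h hx⟩
  choose f hf using hex
  have hfinj : ∀ x ∈ γ '' Icc 0 1, ∀ y ∈ γ '' Icc 0 1, f x = f y → x = y := by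
    intro x hx y hy h
    rw [← (hf x hx).2.1, ← (hf y hy).2.1, h]
  have hlt : ∀ x ∈ γ '' Icc 0 1, ∀ y ∈ γ '' Icc 0 1,
      lexRel f (· < ·) WellOrderingRel x y → f x < f y := by
    rintro x hx y hy (h | ⟨h, h'⟩)
    · exact h
    · rw [hfinj x hx y hy h] at h'
      exact absurd h' (irrefl _)
  have h0M : γ 0 ∈ γ '' Icc 0 1 := ⟨0, by simp, rfl⟩
  refine ⟨lexRel f (· < ·) WellOrderingRel, isStrictTotalOrder_lexRel _ _ _, ?_, ?_⟩
  · intro A B _ hA hAM _ _ hBM hAB x₁ h₁ x₂ h₂ x₃ h₃ x₄ h₄ h12 h23 h34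
    have h12 := hlt _ (hAM h₁) _ (hBM h₂) h12
    have h23 := hlt _ (hBM h₂) _ (hAM h₃) h23
    have h34 := hlt _ (hAM h₃) _ (hBM h₄) h34
    obtain ⟨i1, e1, -⟩ := hf _ (hAM h₁)
    obtain ⟨i2, e2, -⟩ := hf _ (hBM h₂)
    obtain ⟨i3, e3, -⟩ := hf _ (hAM h₃)
    obtain ⟨i4, e4, z4⟩ := hf _ (hBM h₄)
    set t₁ := f x₁
    set t₂ := f x₂
    set t₃ := f x₃
    set t₄ := f x₄
    have hK1 : IsClosed (γ '' Icc t₂ t₄) := (hγ.isCompact_image i2.1 i4.2).isClosed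
    have hK2 : IsClosed (γ '' Icc 0 t₂ ∪ γ '' Icc t₄ 1) :=
      (hγ.isCompact_image le_rfl i2.2).isClosed.union (hγ.isCompact_image i4.1 le_rfl).isClosed
    obtain ⟨z, hzA, ⟨s, hs, rfl⟩, hz2⟩ := isPreconnected_closed_iff.1 hA _ _ hK1 hK2 (by
      intro x hx
      obtain ⟨t, ht, rfl⟩ := hAM hx
      rcases le_total t t₂ with h | h
      · exact Or.inr (Or.inl ⟨t, ⟨ht.1, h⟩, rfl⟩)
      · rcases le_total t t₄ with h' | h'
        · exact Or.inl ⟨t, ⟨h, h'⟩, rfl⟩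
        · exact Or.inr (Or.inr ⟨t, ⟨h', ht.2⟩, rfl⟩))
      ⟨x₃, h₃, t₃, ⟨h23.le, h34.le⟩, e3⟩ ⟨x₁, h₁, Or.inl ⟨t₁, ⟨i1.1, h12.le⟩, e1⟩⟩
    have hs01 : s ∈ Icc (0 : ℝ) 1 := ⟨i2.1.trans hs.1, hs.2.trans i4.2⟩
    have key : ∃ s' ∈ Icc (0 : ℝ) 1, (s' ≤ t₂ ∨ t₄ ≤ s') ∧ γ s' = γ s := by
      rcases hz2 with ⟨s', h, e⟩ | ⟨s', h, e⟩
      · exact ⟨s', ⟨h.1, h.2.trans i2.2⟩, Or.inl h.2, e⟩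
      · exact ⟨s', ⟨i4.1.trans h.1, h.2⟩, Or.inr h.1, e⟩
    obtain ⟨s', hs'01, hs', he⟩ := key
    have hst : s = t₂ ∨ s = t₄ := by
      rcases lt_trichotomy s s' with h | h | h
      · have := (hγ.inj s hs01 s' hs'01 h he.symm).1
        linarith [hs.1, i1.1]
      · subst h
        rcases hs' with h | h
        · exact Or.inl (le_antisymm h hs.1)
        · exact Or.inr (le_antisymm hs.2 h)
      -- Here the curve would be closed with `x₄ = γ 1 = γ 0`, but the parameter chosen for that
      -- point is 0, not 1.
      · obtain ⟨rfl, rfl⟩ := hγ.inj s' hs'01 s hs01 h he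
        have h4 : t₄ = 1 := le_antisymm i4.2 hs.2
        have := z4 (by rw [← e4, h4, he])
        linarith
    rcases hst with rfl | rfl
    · exact disjoint_left.1 hAB hzA (by rwa [e2])
    · exact disjoint_left.1 hAB hzA (by rwa [e4])
  · intro x hx hne
    obtain ⟨i, e, -⟩ := hf x hx
    obtain ⟨-, -, z⟩ := hf _ h0M
    left
    rw [z rfl]
    refine lt_of_le_of_ne i.1 fun h => hne ?_
    rw [← e, ← h]

theorem continuousOn_collapse {S M : Set X} {u : X} [∀ x, Decidable (x ∈ M)] (hS : IsClosed S)
    (hM : IsClosed M) (hu : S ∩ M = {u}) :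
    ContinuousOn (fun x => if x ∈ M then u else x) (S ∪ M) := by
  refine ContinuousOn.union_of_isClosed ?_ ?_ hS hM
  · refine continuousOn_id.congr fun x hx => ?_
    by_cases h : x ∈ M
    · have : x ∈ S ∩ M := ⟨hx, h⟩
      rw [hu] at this
      simp [show x = u from this]
    · simp [h]
  · exact continuousOn_const.congr fun x hx => if_pos hx

/-- The two retractions, collapsing `M` or `S` to `u`, carry a crossing in `S ∪ M` to one in `S` or
in `M`. Of two disjoint continua one misses `u`, so it lies on one side; the other is retracted to
that side, and stays disjoint from it. In `M` one also needs that alternation is a cyclic notion and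
that `u` is the least element. -/
theorem Noncrossing.union {r q : X → X → Prop} [IsStrictTotalOrder X r] [IsStrictTotalOrder X q]
    {S M : Set X} {u : X} [∀ x, Decidable (x ∈ M)] (hr : Noncrossing r S) (hq : Noncrossing q M)
    (hS : IsClosed S) (hM : IsClosed M) (hu : S ∩ M = {u}) (hmin : ∀ x ∈ M, x ≠ u → q u x) :
    Noncrossing (lexRel (fun x => if x ∈ M then u else x) r q) (S ∪ M) := by
  classical
  set π : X → X := fun x => if x ∈ M then u else x with hπ
  have hπc : ContinuousOn π (S ∪ M) := continuousOn_collapse hS hM hu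
  set ρ : X → X := fun x => if x ∈ S then u else x with hρ
  have hρc : ContinuousOn ρ (S ∪ M) := by
    rw [union_comm]; exact continuousOn_collapse hM hS (by rwa [inter_comm])
  have huS : u ∈ S := (hu.ge rfl).1
  have huM : u ∈ M := (hu.ge rfl).2
  have hπM : ∀ x ∈ M, π x = u := fun x hx => if_pos hx
  have hπS : ∀ x ∉ M, π x = x := fun x hx => if_neg hx
  have hρM : ∀ x ∈ M, ρ x = x := by
    intro x hx
    by_cases h : x ∈ S
    · have : x ∈ S ∩ M := ⟨h, hx⟩
      rw [hu] at this
      simp [hρ, show x = u from this]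
    · exact if_neg h
  have hρS : ∀ x ∈ S, ρ x = u := fun x hx => if_pos hx
  have hπmem : ∀ x ∈ S ∪ M, π x ∈ S := by
    intro x hx
    by_cases h : x ∈ M
    · rw [hπM x h]; exact huS
    · rw [hπS x h]; exact hx.resolve_right h
  have hρmem : ∀ x ∈ S ∪ M, ρ x ∈ M := by
    intro x hx
    by_cases h : x ∈ S
    · rw [hρS x h]; exact huM
    · rw [hρM x (hx.resolve_left h)]; exact hx.resolve_left h
  have hπu : ∀ x, π x = u → x ∈ M := by
    intro x hx
    by_contra h
    rw [hπS x h] at hx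
    exact h (hx ▸ huM)
  -- the two cases in which a continuum avoids `u`
  have side : ∀ A : Set X, IsPreconnected A → A ⊆ S ∪ M → u ∉ A → (∀ x ∈ A, x ∉ M) ∨ A ⊆ M := by
    intro A hA hAS huA
    by_contra! hcon
    obtain ⟨⟨x, hxA, hxM⟩, hnot⟩ := hcon
    obtain ⟨y, hyA, hyM⟩ := not_subset.1 hnot
    obtain ⟨z, hzA, hz⟩ := isPreconnected_closed_iff.1 hA S M hS hM hAS
      ⟨y, hyA, (hAS hyA).resolve_right hyM⟩ ⟨x, hxA, hxM⟩
    rw [hu] at hz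
    exact huA (hz ▸ hzA)
  have imπ : ∀ A : Set X, IsCompact A → IsPreconnected A → A ⊆ S ∪ M →
      IsCompact (π '' A) ∧ IsPreconnected (π '' A) ∧ π '' A ⊆ S := fun A h1 h2 h3 =>
    ⟨h1.image_of_continuousOn (hπc.mono h3), h2.image _ (hπc.mono h3),
      image_subset_iff.2 fun x hx => hπmem x (h3 hx)⟩
  have imρ : ∀ A : Set X, IsCompact A → IsPreconnected A → A ⊆ S ∪ M →
      IsCompact (ρ '' A) ∧ IsPreconnected (ρ '' A) ∧ ρ '' A ⊆ M := fun A h1 h2 h3 =>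
    ⟨h1.image_of_continuousOn (hρc.mono h3), h2.image _ (hρc.mono h3),
      image_subset_iff.2 fun x hx => hρmem x (h3 hx)⟩
  have dπ : ∀ A B : Set X, (∀ x ∈ A, x ∉ M) → Disjoint A B → Disjoint A (π '' B) := by
    intro A B hA hAB
    rw [disjoint_left]
    rintro _ hx ⟨y, hy, rfl⟩
    by_cases h : y ∈ M
    · rw [hπM y h] at hx; exact hA _ hx huM
    · rw [hπS y h] at hx; exact disjoint_left.1 hAB hx hy
  have dρ : ∀ A B : Set X, A ⊆ M → u ∉ A → B ⊆ S ∪ M → Disjoint A B → Disjoint A (ρ '' B) := by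
    intro A B hA huA hB hAB
    rw [disjoint_left]
    rintro _ hx ⟨y, hy, rfl⟩
    by_cases h : y ∈ S
    · rw [hρS y h] at hx; exact huA hx
    · rw [hρM y ((hB hy).resolve_left h)] at hx; exact disjoint_left.1 hAB hx hy
  have lr : ∀ x y, lexRel π r q x y → π x ≠ π y → r (π x) (π y) := by
    rintro x y (h | h) hne
    · exact h
    · exact absurd h.1 hne
  have lq : ∀ x y, lexRel π r q x y → x ∈ M → y ∈ M → q x y := by
    rintro x y (h | h) hx hy
    · rw [hπM x hx, hπM y hy] at h
      exact absurd h (irrefl _)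
    · exact h.2
  -- `M` is a block of the new order: a point between two of its points but outside it would be both
  -- above and below `u` for `r`.
  have conv : ∀ x y z, lexRel π r q x y → lexRel π r q y z → x ∈ M → z ∈ M → y ∈ M := by
    intro x y z hxy hyz hx hz
    by_contra hy
    have hne : π y ≠ u := fun h => hy (hπu y h)
    have h1 := lr x y hxy (by rw [hπM x hx]; exact hne.symm)
    have h2 := lr y z hyz (by rw [hπM z hz]; exact hne)
    rw [hπM x hx] at h1
    rw [hπM z hz] at h2
    exact irrefl u (_root_.trans h1 h2)
  have dne : ∀ A B : Set X, Disjoint A (π '' B) → (∀ x ∈ A, x ∉ M) → ∀ x ∈ A, ∀ y ∈ B,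
      π x ≠ π y := by
    intro A B h hA x hx y hy he
    rw [hπS x (hA x hx)] at he
    exact disjoint_left.1 h hx ⟨y, hy, he.symm⟩
  intro A B hAc hA hAS hBc hB hBS hAB x₁ h₁ x₂ h₂ x₃ h₃ x₄ h₄ h12 h23 h34
  by_cases huA : u ∈ A
  · have huB : u ∉ B := disjoint_left.1 hAB huA
    rcases side B hB hBS huB with hB' | hB'
    · have hd := dπ B A hB' hAB.symm
      have hne := dne B A hd hB'
      obtain ⟨a1, a2, a3⟩ := imπ A hAc hA hAS
      have hBS' : B ⊆ S := fun x hx => (hBS hx).resolve_right (hB' x hx)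
      have k1 := lr _ _ h12 (hne x₂ h₂ x₁ h₁).symm
      have k2 := lr _ _ h23 (hne x₂ h₂ x₃ h₃)
      have k3 := lr _ _ h34 (hne x₄ h₄ x₃ h₃).symm
      rw [hπS _ (hB' _ h₂)] at k1 k2
      rw [hπS _ (hB' _ h₄)] at k3
      exact hr _ _ a1 a2 a3 hBc hB hBS' hd.symm _ ⟨x₁, h₁, rfl⟩ _ h₂ _ ⟨x₃, h₃, rfl⟩ _ h₄ k1 k2 k3
    · have hd := dρ B A hB' huB hAS hAB.symm
      obtain ⟨a1, a2, a3⟩ := imρ A hAc hA hAS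
      have m2 := hB' h₂
      have m4 := hB' h₄
      have m3 := conv _ _ _ h23 h34 m2 m4
      have e3 := hρM _ m3
      by_cases m1 : x₁ ∈ M
      · exact hq _ _ a1 a2 a3 hBc hB hB' hd.symm _ ⟨x₁, h₁, hρM _ m1⟩ _ h₂ _ ⟨x₃, h₃, e3⟩ _ h₄
          (lq _ _ h12 m1 m2) (lq _ _ h23 m2 m3) (lq _ _ h34 m3 m4)
      -- Only `x₁` precedes the block; it is replaced by `u`, which also belongs to `A` and is least
      -- in `M`.
      · refine hq _ _ a1 a2 a3 hBc hB hB' hd.symm _ ⟨u, huA, hρM _ huM⟩ _ h₂ _ ⟨x₃, h₃, e3⟩ _ h₄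
          (hmin _ m2 ?_) (lq _ _ h23 m2 m3) (lq _ _ h34 m3 m4)
        rintro rfl
        exact huB h₂
  · rcases side A hA hAS huA with hA' | hA'
    · have hd := dπ A B hA' hAB
      have hne := dne A B hd hA'
      obtain ⟨b1, b2, b3⟩ := imπ B hBc hB hBS
      have hAS' : A ⊆ S := fun x hx => (hAS hx).resolve_right (hA' x hx)
      have k1 := lr _ _ h12 (hne x₁ h₁ x₂ h₂)
      have k2 := lr _ _ h23 (hne x₃ h₃ x₂ h₂).symm
      have k3 := lr _ _ h34 (hne x₃ h₃ x₄ h₄)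
      rw [hπS _ (hA' _ h₁)] at k1
      rw [hπS _ (hA' _ h₃)] at k2 k3
      exact hr _ _ hAc hA hAS' b1 b2 b3 hd _ h₁ _ ⟨x₂, h₂, rfl⟩ _ h₃ _ ⟨x₄, h₄, rfl⟩ k1 k2 k3
    · have hd := dρ A B hA' huA hBS hAB
      obtain ⟨b1, b2, b3⟩ := imρ B hBc hB hBS
      have m1 := hA' h₁
      have m3 := hA' h₃
      have m2 := conv _ _ _ h12 h23 m1 m3
      have e2 := hρM _ m2
      by_cases m4 : x₄ ∈ M
      · exact hq _ _ hAc hA hA' b1 b2 b3 hd _ h₁ _ ⟨x₂, h₂, e2⟩ _ h₃ _ ⟨x₄, h₄, hρM _ m4⟩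
          (lq _ _ h12 m1 m2) (lq _ _ h23 m2 m3) (lq _ _ h34 m3 m4)
      · have s4 : x₄ ∈ S := (hBS h₄).resolve_right m4
        -- Here `x₄` comes after the block and collapses to the least element `u`, so the
        -- alternation is rotated to `u, x₁, x₂, x₃`, with the roles of the two continua exchanged.
        refine hq _ _ b1 b2 b3 hAc hA hA' hd.symm _ ⟨x₄, h₄, hρS _ s4⟩ _ h₁ _ ⟨x₂, h₂, e2⟩ _ h₃
          (hmin _ m1 ?_) (lq _ _ h12 m1 m2) (lq _ _ h23 m2 m3)
        rintro rfl
        exact huA h₁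

/-- The sets obtained from a point by attaching finitely many simple curves, each of them at its
initial point. -/
inductive IsCactusSet : Set X → Prop
  | point (p : X) : IsCactusSet {p}
  | attach {S : Set X} (γ : ℝ → X) (hS : IsCactusSet S) (hγ : IsSimpleCurve γ)
      (hu : S ∩ γ '' Icc 0 1 = {γ 0}) : IsCactusSet (S ∪ γ '' Icc 0 1)

theorem IsCactusSet.isCompact {S : Set X} (h : IsCactusSet S) : IsCompact S := by
  induction h with
  | point p => exact isCompact_singleton
  | attach γ _ hγ _ ih => exact ih.union (hγ.isCompact_image le_rfl le_rfl)

theorem IsCactusSet.exists_noncrossing [T2Space X] {S : Set X} (h : IsCactusSet S) :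
    ∃ r : X → X → Prop, IsStrictTotalOrder X r ∧ Noncrossing r S := by
  classical
  induction h with
  | point p => exact ⟨WellOrderingRel, inferInstance, .singleton _ _⟩
  | attach γ hS hγ hu ih =>
    obtain ⟨r, hr, hrS⟩ := ih
    obtain ⟨q, hq, hqM, hmin⟩ := hγ.exists_noncrossing
    exact ⟨_, isStrictTotalOrder_lexRel _ _ _, hrS.union hqM hS.isCompact.isClosed
      (hγ.isCompact_image le_rfl le_rfl).isClosed hu hmin⟩

/-- A theta graph has no noncrossing order. -/
theorem Noncrossing.theta {r : X → X → Prop} [IsStrictTotalOrder X r] (hr : Noncrossing r univ)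
    {a b : X} (p : Fin 3 → X) (A B : Fin 3 → Set X) (hAc : ∀ i, IsCompact (A i))
    (hBc : ∀ i, IsCompact (B i)) (hA : ∀ i, IsPreconnected (A i)) (hB : ∀ i, IsPreconnected (B i))
    (ha : ∀ i, a ∈ A i) (hb : ∀ i, b ∈ B i) (hpA : ∀ i, p i ∈ A i) (hpB : ∀ i, p i ∈ B i)
    (hAB : ∀ i j, i ≠ j → Disjoint (A i) (B j)) : False := by
  have hc1 : ∀ i j, i ≠ j → ∀ x₁ ∈ A i, ∀ x₂ ∈ B j, ∀ x₃ ∈ A i, ∀ x₄ ∈ B j,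
      r x₁ x₂ → r x₂ x₃ → r x₃ x₄ → False := fun i j h =>
    hr _ _ (hAc i) (hA i) (subset_univ _) (hBc j) (hB j) (subset_univ _) (hAB i j h)
  have hc2 : ∀ i j, i ≠ j → ∀ x₁ ∈ B j, ∀ x₂ ∈ A i, ∀ x₃ ∈ B j, ∀ x₄ ∈ A i,
      r x₁ x₂ → r x₂ x₃ → r x₃ x₄ → False := fun i j h =>
    hr _ _ (hBc j) (hB j) (subset_univ _) (hAc i) (hA i) (subset_univ _) (hAB i j h).symm
  have tri : ∀ x y, x ≠ y → r x y ∨ r y x := fun x y h => by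
    by_contra! hcon
    exact h (Std.Trichotomous.trichotomous (r := r) _ _ hcon.1 hcon.2)
  have hne : ∀ i j, i ≠ j → ∀ x ∈ A i, ∀ y ∈ B j, x ≠ y := fun i j h x hx y hy he =>
    disjoint_left.1 (hAB i j h) hx (he ▸ hy)
  have hpa : ∀ i, p i ≠ a := by
    intro i
    obtain ⟨j, hj⟩ := exists_ne i
    exact (hne j i hj a (ha j) (p i) (hpB i)).symm
  have hpb : ∀ i, p i ≠ b := by
    intro i
    obtain ⟨j, hj⟩ := exists_ne i
    exact hne i j hj.symm (p i) (hpA i) b (hb j)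
  -- any two of the three points are separated by `a` and `b`
  have sep : ∀ i j, i ≠ j →
      ¬ ((r a (p i) ↔ r b (p i)) ↔ (r a (p j) ↔ r b (p j))) := by
    intro i j hij
    have hpp : p i ≠ p j := hne i j hij _ (hpA i) _ (hpB j)
    have hab : a ≠ b := hne i j hij _ (ha i) _ (hb j)
    have c1 := hc1 i j hij
    have c2 := hc2 i j hij
    have c3 := hc1 j i hij.symm
    have c4 := hc2 j i hij.symm
    have as : ∀ x y, r x y → ¬ r y x := fun x y => asymm
    have tr : ∀ x y z, r x y → r y z → r x z := fun x y z => _root_.trans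
    have a1 := ha i
    have a2 := ha j
    have b1 := hb i
    have b2 := hb j
    have p1 := hpA i
    have p2 := hpA j
    have p3 := hpB i
    have p4 := hpB j
    have n1 := hpa i
    have n2 := hpa j
    have n3 := hpb i
    have n4 := hpb j
    generalize p i = x at *
    generalize p j = y at *
    have t1 := tri _ _ hab
    have t2 := tri _ _ hpp
    have t3 := tri _ _ n1
    have t4 := tri _ _ n2
    have t5 := tri _ _ n3
    have t6 := tri _ _ n4
    -- These are the eight linear orders in which `a, x` alternate with `b, y`, followed by the
    -- eight in which `a, y` alternate with `b, x`. If `a, b` did not separate `x` from `y`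
    -- cyclically, one of these would occur.
    have f1 := c1 a a1 b b2 x p1 y p4
    have f2 := c1 a a1 y p4 x p1 b b2
    have f3 := c1 x p1 b b2 a a1 y p4
    have f4 := c1 x p1 y p4 a a1 b b2
    have f5 := c2 b b2 a a1 y p4 x p1
    have f6 := c2 b b2 x p1 y p4 a a1
    have f7 := c2 y p4 a a1 b b2 x p1
    have f8 := c2 y p4 x p1 b b2 a a1
    have g1 := c3 a a2 b b1 y p2 x p3
    have g2 := c3 a a2 x p3 y p2 b b1
    have g3 := c3 y p2 b b1 a a2 x p3
    have g4 := c3 y p2 x p3 a a2 b b1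
    have g5 := c4 b b1 a a2 x p3 y p2
    have g6 := c4 b b1 y p2 x p3 a a2
    have g7 := c4 x p3 a a2 b b1 y p2
    have g8 := c4 x p3 y p2 b b1 a a2
    clear c1 c2 c3 c4
    have cyc : ∀ x y z, r x y → r y z → ¬ r z x := fun x y z h1 h2 => as _ _ (tr _ _ _ h1 h2)
    have k1 := cyc a b x
    have k2 := cyc b a x
    have k3 := cyc a b y
    have k4 := cyc b a y
    have k5 := cyc a x y
    have k6 := cyc x a y
    have k7 := cyc b x y
    have k8 := cyc x b y
    have l1 := as a b
    have l2 := as x y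
    have l3 := as x a
    have l4 := as y a
    have l5 := as x b
    have l6 := as y b
    clear cyc as tr tri hne hpa hpb
    clear a1 a2 b1 b2 p1 p2 p3 p4 n1 n2 n3 n4 hAc hBc hA hB ha hb hpA hpB hAB hr hab hpp
    grind only
  -- Three points cannot lie pairwise on different sides when there are only two sides.
  have s01 := sep 0 1 (by decide)
  have s02 := sep 0 2 (by decide)
  have s12 := sep 1 2 (by decide)
  tauto

end NoncrossingOrders

end

/-! ### Circles with ears; attaching circles and intervals -/

noncomputable section

section CactusSets

open Set

variable {X : Type*} [TopologicalSpace X]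

theorem IsSimpleCurve.eq_or {γ : ℝ → X} (hγ : IsSimpleCurve γ) {s t : ℝ} (hs : s ∈ Icc (0 : ℝ) 1)
    (ht : t ∈ Icc (0 : ℝ) 1) (h : γ s = γ t) : s = t ∨ (s = 0 ∧ t = 1) ∨ (s = 1 ∧ t = 0) := by
  rcases lt_trichotomy s t with h' | h' | h'
  · exact Or.inr (Or.inl (hγ.inj s hs t ht h' h))
  · exact Or.inl h'
  · exact Or.inr (Or.inr (hγ.inj t ht s hs h' h.symm).symm)

/-- If there is a noncrossing order, then no arc outside a circle joins two of its points. -/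
theorem Noncrossing.not_ear {r : X → X → Prop} [IsStrictTotalOrder X r]
    (hr : Noncrossing r univ) {γ : ℝ → X} (hγ : IsSimpleCurve γ) (h01 : γ 0 = γ 1) {η : ℝ → X}
    (hη : IsArc η) (h0 : η 0 ∈ γ '' Icc 0 1) (h1 : η 1 ∈ γ '' Icc 0 1)
    (hη' : ∀ t ∈ Ioo (0 : ℝ) 1, η t ∉ γ '' Icc 0 1) : False := by
  have key : ∀ η : ℝ → X, IsArc η → (∀ t ∈ Ioo (0 : ℝ) 1, η t ∉ γ '' Icc 0 1) →
      ∀ α β : ℝ, 0 ≤ α → α < β → β < 1 → γ α = η 0 → γ β = η 1 → False := by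
    intro η hη hη' α β hα hαβ hβ ha hb
    set m := (α + β) / 2 with hm
    set n := (β + 1) / 2 with hn
    have hηs := hη.isSimpleCurve
    have dis : ∀ a b c d : ℝ, 0 ≤ a → b < c → d ≤ 1 → (0 < a ∨ d < 1) →
        Disjoint (γ '' Icc a b) (γ '' Icc c d) := by
      intro a b c d h1 h2 h3 h4
      rw [disjoint_left]
      rintro _ ⟨s, hs, rfl⟩ ⟨t, ht, he⟩
      have hst : s < t := by linarith [hs.2, ht.1]
      obtain ⟨rfl, rfl⟩ := hγ.inj s ⟨by linarith [hs.1], by linarith [ht.2]⟩ t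
        ⟨by linarith [hs.1], by linarith [ht.2]⟩ hst he.symm
      rcases h4 with h4 | h4
      · linarith [hs.1]
      · linarith [ht.2]
    -- `x` is the parameter of the only point where this part of `η` can touch the circle; for `x =
    -- 0` the parameter 1 must be avoided as well.
    have disη : ∀ a b c d x : ℝ, 0 ≤ a → b ≤ 1 → 0 ≤ c → d ≤ 1 → 0 ≤ x → x < 1 →
        (∀ t ∈ Icc a b, t ∉ Ioo (0 : ℝ) 1 → η t = γ x) → (x < c ∨ d < x) → (x ≠ 0 ∨ d < 1) →
        Disjoint (γ '' Icc c d) (η '' Icc a b) := by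
      intro a b c d x h1 h2 h3 h4 hx0 hx1 h5 h6 h7
      rw [disjoint_left]
      rintro _ ⟨s, hs, rfl⟩ ⟨t, ht, he⟩
      have hs01 : s ∈ Icc (0 : ℝ) 1 := ⟨by linarith [hs.1], by linarith [hs.2]⟩
      by_cases h : t ∈ Ioo (0 : ℝ) 1
      · exact hη' t h ⟨s, hs01, he.symm⟩
      · rw [h5 t ht h] at he
        rcases hγ.eq_or ⟨hx0, hx1.le⟩ hs01 he with h8 | ⟨h8, h9⟩ | ⟨h8, h9⟩
        · rcases h6 with h6 | h6
          · linarith [hs.1]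
          · linarith [hs.2]
        · rcases h7 with h7 | h7
          · exact h7 h8
          · linarith [hs.2]
        · exact hx1.ne h8
    have end0 : ∀ t ∈ Icc (0 : ℝ) (1 / 2), t ∉ Ioo (0 : ℝ) 1 → η t = γ α := by
      intro t ht h
      have : t = 0 := by
        by_contra hne
        exact h ⟨lt_of_le_of_ne ht.1 (Ne.symm hne), by linarith [ht.2]⟩
      rw [this, ha]
    have end1 : ∀ t ∈ Icc (1 / 2 : ℝ) 1, t ∉ Ioo (0 : ℝ) 1 → η t = γ β := by
      intro t ht h
      have : t = 1 := by
        by_contra hne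
        exact h ⟨by linarith [ht.1], lt_of_le_of_ne ht.2 hne⟩
      rw [this, hb]
    -- The circle and its ear form a theta graph with branch points `γ α` and `γ β`. Each strand is
    -- cut at an inner point; the second one passes through the base point, where `γ 0 = γ 1` keeps
    -- its first half connected.
    refine hr.theta (a := η 0) (b := η 1) ![γ m, γ n, η (1 / 2)]
      ![γ '' Icc α m, γ '' Icc n 1 ∪ γ '' Icc 0 α, η '' Icc 0 (1 / 2)]
      ![γ '' Icc m β, γ '' Icc β n, η '' Icc (1 / 2) 1] ?_ ?_ ?_ ?_ ?_ ?_ ?_ ?_ ?_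
    · intro i
      fin_cases i
      · exact hγ.isCompact_image hα (by linarith)
      · exact (hγ.isCompact_image (by linarith) le_rfl).union
          (hγ.isCompact_image le_rfl (by linarith))
      · exact hηs.isCompact_image le_rfl (by norm_num)
    · intro i
      fin_cases i
      · exact hγ.isCompact_image (by linarith) (by linarith)
      · exact hγ.isCompact_image (by linarith) (by linarith)
      · exact hηs.isCompact_image (by norm_num) le_rfl
    · intro i
      fin_cases i
      · exact hγ.isPreconnected_image hα (by linarith)
      · exact IsPreconnected.union (γ 0) ⟨1, ⟨by linarith, le_rfl⟩, h01.symm⟩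
          ⟨0, ⟨le_rfl, hα⟩, rfl⟩ (hγ.isPreconnected_image (by linarith) le_rfl)
          (hγ.isPreconnected_image le_rfl (by linarith))
      · exact hηs.isPreconnected_image le_rfl (by norm_num)
    · intro i
      fin_cases i
      · exact hγ.isPreconnected_image (by linarith) (by linarith)
      · exact hγ.isPreconnected_image (by linarith) (by linarith)
      · exact hηs.isPreconnected_image (by norm_num) le_rfl
    · intro i
      fin_cases i
      · exact ⟨α, ⟨le_rfl, by linarith⟩, ha⟩
      · exact Or.inr ⟨α, ⟨hα, le_rfl⟩, ha⟩
      · exact ⟨0, by norm_num, rfl⟩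
    · intro i
      fin_cases i
      · exact ⟨β, ⟨by linarith, le_rfl⟩, hb⟩
      · exact ⟨β, ⟨le_rfl, by linarith⟩, hb⟩
      · exact ⟨1, by norm_num, rfl⟩
    · intro i
      fin_cases i
      · exact ⟨m, ⟨by linarith, le_rfl⟩, rfl⟩
      · exact Or.inl ⟨n, ⟨le_rfl, by linarith⟩, rfl⟩
      · exact ⟨1 / 2, by norm_num, rfl⟩
    · intro i
      fin_cases i
      · exact ⟨m, ⟨le_rfl, by linarith⟩, rfl⟩
      · exact ⟨n, ⟨by linarith, le_rfl⟩, rfl⟩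
      · exact ⟨1 / 2, by norm_num, rfl⟩
    · intro i j hij
      fin_cases i <;> fin_cases j
      · exact absurd rfl hij
      · exact dis _ _ _ _ hα (by linarith) (by linarith) (Or.inr (by linarith))
      · exact disη _ _ _ _ β (by norm_num) le_rfl hα (by linarith) (by linarith) hβ end1
          (Or.inr (by linarith)) (Or.inr (by linarith))
      · exact disjoint_union_left.2
          ⟨(dis _ _ _ _ (by linarith) (by linarith) le_rfl (Or.inl (by linarith))).symm,
            dis _ _ _ _ le_rfl (by linarith) (by linarith) (Or.inr (by linarith))⟩
      · exact absurd rfl hij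
      · exact disjoint_union_left.2
          ⟨disη _ _ _ _ β (by norm_num) le_rfl (by linarith) le_rfl (by linarith) hβ end1
            (Or.inl (by linarith)) (Or.inl (by linarith)),
          disη _ _ _ _ β (by norm_num) le_rfl le_rfl (by linarith) (by linarith) hβ end1
            (Or.inr (by linarith)) (Or.inr (by linarith))⟩
      · exact (disη _ _ _ _ α le_rfl (by norm_num) (by linarith) (by linarith) hα (by linarith)
          end0 (Or.inl (by linarith)) (Or.inr (by linarith))).symm
      · exact (disη _ _ _ _ α le_rfl (by norm_num) (by linarith) (by linarith) hα (by linarith)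
          end0 (Or.inl (by linarith)) (Or.inr (by linarith))).symm
      · exact absurd rfl hij
  have param : ∀ x ∈ γ '' Icc 0 1, ∃ t : ℝ, 0 ≤ t ∧ t < 1 ∧ γ t = x := by
    rintro _ ⟨t, ht, rfl⟩
    rcases ht.2.eq_or_lt with rfl | h
    · exact ⟨0, le_rfl, one_pos, h01⟩
    · exact ⟨t, ht.1, h, rfl⟩
  obtain ⟨α, hα0, hα1, hα⟩ := param _ h0
  obtain ⟨β, hβ0, hβ1, hβ⟩ := param _ h1
  rcases lt_trichotomy α β with h | h | h
  · exact key η hη hη' α β hα0 h hβ1 hα hβ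
  · subst h
    exact hη.ne (hα.symm.trans hβ)
  · exact key _ hη.reverse (fun t ht => hη' _ ⟨by linarith [ht.2], by linarith [ht.1]⟩) β α hβ0 h
      hα1 (by simpa using hβ) (by simpa using hα)

theorem IsArc.nonempty_homeomorph [T2Space X] {γ : ℝ → X} (hγ : IsArc γ) :
    Nonempty (γ '' Icc 0 1 ≃ₜ unitInterval) := by
  let f : unitInterval → γ '' Icc 0 1 := fun t => ⟨γ t, t, t.2, rfl⟩
  have hf : Continuous f :=
    (continuousOn_iff_continuous_domRestrict.1 hγ.continuousOn).subtype_mk _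
  have hb : Function.Bijective f := by
    constructor
    · intro s t h
      exact Subtype.ext (hγ.injOn s.2 t.2 (congrArg Subtype.val h))
    · rintro ⟨_, t, ht, rfl⟩
      exact ⟨⟨t, ht⟩, rfl⟩
  exact ⟨(Continuous.homeoOfEquivCompactToT2 (f := Equiv.ofBijective f hb) hf).symm⟩

theorem IsSimpleCurve.nonempty_homeomorph_circle [T2Space X] {γ : ℝ → X} (hγ : IsSimpleCurve γ)
    (h01 : γ 0 = γ 1) : Nonempty (γ '' Icc 0 1 ≃ₜ Circle) := by
  have : Fact ((0 : ℝ) < 1) := ⟨one_pos⟩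
  let g : ℝ → γ '' Icc 0 1 := fun t => ⟨γ (Set.projIcc 0 1 zero_le_one t), _, Subtype.coe_prop _, rfl⟩
  have hg : Continuous g :=
    ((continuousOn_iff_continuous_domRestrict.1 hγ.continuousOn).comp continuous_projIcc).subtype_mk _
  have hgt : ∀ t ∈ Icc (0 : ℝ) 1, (g t : X) = γ t := fun t ht => by
    simp [g, Set.projIcc_of_mem zero_le_one ht]
  let f : AddCircle (1 : ℝ) → γ '' Icc 0 1 := AddCircle.liftIco 1 0 g
  have hf : Continuous f := by
    refine AddCircle.liftIco_zero_continuous (Subtype.ext ?_) hg.continuousOn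
    rw [hgt 0 (by simp), hgt 1 (by simp), h01]
  have hfc : ∀ t ∈ Ico (0 : ℝ) 1, (f (t : AddCircle (1 : ℝ)) : X) = γ t := fun t ht => by
    rw [← hgt t (Ico_subset_Icc_self ht)]
    exact congrArg Subtype.val (AddCircle.liftIco_coe_apply (by simpa using ht))
  have hb : Function.Bijective f := by
    constructor
    · intro x y h
      obtain ⟨s, hs, rfl⟩ : ∃ s ∈ Ico (0 : ℝ) 1, (s : AddCircle (1 : ℝ)) = x :=
        ⟨_, by simpa using (AddCircle.equivIco 1 0 x).2, AddCircle.coe_equivIco⟩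
      obtain ⟨t, ht, rfl⟩ : ∃ s ∈ Ico (0 : ℝ) 1, (s : AddCircle (1 : ℝ)) = y :=
        ⟨_, by simpa using (AddCircle.equivIco 1 0 y).2, AddCircle.coe_equivIco⟩
      have h' := congrArg Subtype.val h
      rw [hfc s hs, hfc t ht] at h'
      rcases hγ.eq_or (Ico_subset_Icc_self hs) (Ico_subset_Icc_self ht) h' with h | h | h
      · rw [h]
      · exact absurd h.2 ht.2.ne
      · exact absurd h.1 hs.2.ne
    · rintro ⟨_, t, ht, rfl⟩
      rcases ht.2.eq_or_lt with rfl | h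
      · exact ⟨((0 : ℝ) : AddCircle (1 : ℝ)), Subtype.ext ((hfc 0 (by simp)).trans h01)⟩
      · exact ⟨(t : AddCircle (1 : ℝ)), Subtype.ext (hfc t ⟨ht.1, h⟩)⟩
  exact ⟨(Continuous.homeoOfEquivCompactToT2 (f := Equiv.ofBijective f hb) hf).symm.trans
    (AddCircle.homeomorphCircle one_ne_zero)⟩

theorem exists_isSimpleCurve_of_homeomorph_circle {M : Set X} (h : M ≃ₜ Circle) {u : X}
    (hu : u ∈ M) : ∃ γ : ℝ → X, IsSimpleCurve γ ∧ γ 0 = u ∧ γ '' Icc 0 1 = M := by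
  have hπ := Real.two_pi_pos
  refine ⟨fun t => h.symm (h ⟨u, hu⟩ * Circle.exp (2 * Real.pi * t)), ⟨?_, ?_⟩, ?_, ?_⟩
  · exact Continuous.continuousOn (by fun_prop)
  · intro s hs t ht hst he
    have := mul_left_cancel (h.symm.injective (Subtype.ext he))
    obtain ⟨m, hm⟩ := Circle.exp_eq_exp.1 this
    have h1 : s = t + m := by
      have : 2 * Real.pi * (s - t - m) = 0 := by linarith
      rcases mul_eq_zero.1 this with h | h <;> linarith
    have h2 : m ≤ -1 := by
      have : (m : ℝ) < 0 := by linarith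
      have : m < 0 := by exact_mod_cast this
      omega
    have h3 : (m : ℝ) ≤ -1 := by exact_mod_cast h2
    exact ⟨by linarith [hs.1, ht.2], by linarith [hs.1, ht.2]⟩
  · simp
  · ext x
    constructor
    · rintro ⟨t, -, rfl⟩
      exact Subtype.coe_prop _
    · intro hx
      obtain ⟨y, hy⟩ := Circle.exp_surjective ((h ⟨u, hu⟩)⁻¹ * h ⟨x, hx⟩)
      refine ⟨Int.fract (y / (2 * Real.pi)), ⟨Int.fract_nonneg _, (Int.fract_lt_one _).le⟩, ?_⟩
      have : Circle.exp (2 * Real.pi * Int.fract (y / (2 * Real.pi))) = Circle.exp y := by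
        refine Circle.exp_eq_exp.2 ⟨-⌊y / (2 * Real.pi)⌋, ?_⟩
        rw [Int.fract]
        push_cast
        field_simp
        ring
      simp [this, hy]

theorem exists_isArc_of_homeomorph_unitInterval {M : Set X} (h : M ≃ₜ unitInterval) :
    ∃ γ : ℝ → X, IsArc γ ∧ γ '' Icc 0 1 = M := by
  refine ⟨fun t => h.symm (Set.projIcc 0 1 zero_le_one t), ⟨?_, ?_⟩, ?_⟩
  · exact (continuous_subtype_val.comp (h.symm.continuous.comp continuous_projIcc)).continuousOn
  · intro s hs t ht he
    have := h.symm.injective (Subtype.ext he)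
    rw [Set.projIcc_of_mem zero_le_one hs, Set.projIcc_of_mem zero_le_one ht] at this
    exact congrArg Subtype.val this
  · ext x
    constructor
    · rintro ⟨t, -, rfl⟩
      exact Subtype.coe_prop _
    · intro hx
      refine ⟨h ⟨x, hx⟩, (h ⟨x, hx⟩).2, ?_⟩
      simp

/-- A circle can be parametrized starting from `u`. An interval may contain `u` in its interior; it
is cut there, and its two parts are attached one after the other, a degenerate part adding nothing.
-/
theorem IsCactusSet.union_of_homeomorph {S M : Set X} (hS : IsCactusSet S) {u : X}
    (hu : S ∩ M = {u}) (hM : Nonempty (M ≃ₜ unitInterval) ∨ Nonempty (M ≃ₜ Circle)) :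
    IsCactusSet (S ∪ M) := by
  have huM : u ∈ M := (hu.ge rfl).2
  have huS : u ∈ S := (hu.ge rfl).1
  rcases hM with ⟨⟨h⟩⟩ | ⟨⟨h⟩⟩
  · obtain ⟨γ, hγ, rfl⟩ := exists_isArc_of_homeomorph_unitInterval h
    obtain ⟨s, hs, hsu⟩ := huM
    have hγs := hγ.isSimpleCurve
    -- the two parts of the arc
    have part : ∀ (δ : ℝ → X) (s : ℝ) (S' : Set X), s ∈ Icc (0 : ℝ) 1 → IsArc δ → δ s = u →
        IsCactusSet S' → S' ∩ δ '' Icc s 1 = {u} → IsCactusSet (S' ∪ δ '' Icc s 1) := by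
      intro δ s S' hs hδ hδu hS' hu'
      rcases hs.2.eq_or_lt with rfl | hlt
      · have : δ '' Icc 1 1 = {u} := by simp [hδu]
        rw [this, union_eq_left.2 (singleton_subset_iff.2 (hu'.ge rfl).1)]
        exact hS'
      · have hne : δ s ≠ δ 1 := fun h => hlt.ne (hδ.injOn hs (by simp) h)
        have him : (fun t => δ (s + (1 - s) * t)) '' Icc 0 1 = δ '' Icc s 1 := by
          ext x
          constructor
          · rintro ⟨t, ht, rfl⟩
            exact ⟨_, ⟨by nlinarith [ht.1], by nlinarith [ht.2]⟩, rfl⟩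
          · rintro ⟨t, ht, rfl⟩
            have h0 : (1 - s) ≠ 0 := by linarith
            refine ⟨(t - s) / (1 - s), ⟨div_nonneg (by linarith [ht.1]) (by linarith),
              (div_le_one (by linarith)).2 (by linarith [ht.2])⟩, ?_⟩
            simp only
            congr 1
            field_simp
            ring
        rw [← him] at hu' ⊢
        exact hS'.attach _ (hδ.isSimpleCurve.isArc_restrict hs.1 le_rfl hlt hne).isSimpleCurve
          (by simpa [hδu] using hu')
    have hsub : ∀ a b : ℝ, 0 ≤ a → b ≤ 1 → γ '' Icc a b ⊆ γ '' Icc 0 1 := fun a b ha hb =>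
      image_mono (Icc_subset_Icc ha hb)
    have h1 := part γ s S hs hγ hsu hS (Subset.antisymm
      ((inter_subset_inter_right _ (hsub _ _ hs.1 le_rfl)).trans hu.le)
      (singleton_subset_iff.2 ⟨huS, s, ⟨le_rfl, hs.2⟩, hsu⟩))
    have him : (fun t => γ (1 - t)) '' Icc (1 - s) 1 = γ '' Icc 0 s := by
      ext x
      constructor
      · rintro ⟨t, ht, rfl⟩
        exact ⟨1 - t, ⟨by linarith [ht.2], by linarith [ht.1]⟩, rfl⟩
      · rintro ⟨t, ht, rfl⟩
        exact ⟨1 - t, ⟨by linarith [ht.2], by linarith [ht.1]⟩, by simp⟩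
    have h2 := part (fun t => γ (1 - t)) (1 - s) _ ⟨by linarith [hs.2], by linarith [hs.1]⟩
      hγ.reverse (by simpa using hsu) h1 (by
        rw [him]
        refine Subset.antisymm ?_
          (singleton_subset_iff.2 ⟨Or.inl huS, s, ⟨hs.1, le_rfl⟩, hsu⟩)
        rintro x ⟨hx | hx, hx'⟩
        · exact hu.le ⟨hx, hsub _ _ le_rfl hs.2 hx'⟩
        · obtain ⟨t, ht, rfl⟩ := hx
          obtain ⟨t', ht', he⟩ := hx'
          have : t' = t := hγ.injOn ⟨ht'.1, ht'.2.trans hs.2⟩ ⟨hs.1.trans ht.1, ht.2⟩ he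
          subst this
          rw [mem_singleton_iff, ← hsu, le_antisymm ht'.2 ht.1])
    rw [him, union_assoc, ← image_union, union_comm (Icc s 1), Icc_union_Icc_eq_Icc hs.1 hs.2] at h2
    exact h2
  · obtain ⟨γ, hγ, h0, rfl⟩ := exists_isSimpleCurve_of_homeomorph_circle h huM
    exact hS.attach γ hγ (by rw [hu, h0])

end CactusSets

end

/-! ### Cactus sets and tree-like gluings -/

noncomputable section

section Gluings

open Set

variable {X : Type*} [TopologicalSpace X]

/-- Walking along the edges of a tree of pieces, one builds the whole space by attaching one piece
at a time. -/
theorem IsHomeomorphicToCactus.isCactusSet_univ [T2Space X] (h : IsHomeomorphicToCactus X) :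
    IsCactusSet (univ : Set X) := by
  classical
  obtain ⟨n, M, J, hcl, hM, hcov, hJ, htree⟩ := h
  have hne : ∀ i, (M i).Nonempty := by
    intro i
    rcases hM i with ⟨⟨h⟩⟩ | ⟨⟨h⟩⟩
    · exact ⟨_, (h.symm 0).2⟩
    · exact ⟨_, (h.symm 1).2⟩
  obtain ⟨i0⟩ : Nonempty (Fin n) := by
    obtain ⟨v⟩ := htree.connected.nonempty
    rcases v with i | x
    · exact ⟨i⟩
    · obtain ⟨i, -⟩ := mem_iUnion.1 (hcov.ge (mem_univ x.1))
      exact ⟨i⟩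
  let R : Finset (Fin n) → Fin n → Fin n → Prop := fun I a b =>
    a ∈ I ∧ b ∈ I ∧ ∃ x ∈ J, x ∈ M a ∧ x ∈ M b
  -- Connectedness of `I` through joints is carried along: it closes up a cycle as soon as a further
  -- piece meets the union in two points.
  let P : Finset (Fin n) → Prop := fun I => I.Nonempty ∧ IsCactusSet (⋃ i ∈ I, M i) ∧
    ∀ i ∈ I, ∀ j ∈ I, Relation.ReflTransGen (R I) i j
  have hP0 : P {i0} := by
    refine ⟨by simp, ?_, by simp [Relation.ReflTransGen.refl]⟩
    obtain ⟨u, hu⟩ := hne i0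
    have := (IsCactusSet.point u).union_of_homeomorph (M := M i0) (u := u) (by simpa using hu) (hM i0)
    rw [union_eq_right.2 (singleton_subset_iff.2 hu)] at this
    simpa using this
  obtain ⟨I, hI⟩ := (Set.toFinite {I | P I}).exists_maximal ⟨_, hP0⟩
  obtain ⟨⟨i1, hi1⟩, hIc, hIconn⟩ := hI.prop
  by_cases hall : ∀ i, i ∈ I
  · have : (⋃ i ∈ I, M i) = univ := by
      rw [← hcov]
      simp [hall]
    rwa [this] at hIc
  exfalso
  push Not at hall
  obtain ⟨j0, hj0⟩ := hall
  -- The pieces already used, together with all joints on them. An edge of the tree leaving this set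
  -- can only lead from a joint to a new piece.
  let W : Set (Fin n ⊕ J) := fun v => match v with
    | .inl i => i ∈ I
    | .inr x => ∃ i ∈ I, x.1 ∈ M i
  obtain ⟨w⟩ := htree.connected.preconnected (.inl i1) (.inl j0)
  obtain ⟨d, -, hd1, hd2⟩ := w.exists_boundary_dart W hi1 hj0
  obtain ⟨⟨v1, v2⟩, hadj⟩ := d
  rcases v1 with i | ⟨x, hxJ⟩ <;> rcases v2 with j | ⟨y, hyJ⟩
  · exact hadj
  · exact hd2 ⟨i, hd1, hadj⟩
  swap
  · exact hadj
  obtain ⟨i, hiI, hxi⟩ := hd1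
  have hxj : x ∈ M j := hadj
  have hjI : j ∉ I := hd2
  have hinter : (⋃ i ∈ I, M i) ∩ M j = {x} := by
    refine Subset.antisymm ?_ (singleton_subset_iff.2 ⟨mem_iUnion₂.2 ⟨i, hiI, hxi⟩, hxj⟩)
    rintro y ⟨hy, hyj⟩
    obtain ⟨i', hi'I, hyi'⟩ := mem_iUnion₂.1 hy
    by_contra hyx
    have hyJ : y ∈ J := hJ i' j (by rintro rfl; exact hjI hi'I) ⟨hyi', hyj⟩
    have hbr := SimpleGraph.isBridge_iff.1
      (SimpleGraph.isAcyclic_iff_forall_adj_isBridge.1 htree.isAcyclic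
        (show (gluingGraph M J).Adj (.inl j) (.inr ⟨x, hxJ⟩) from hxj))
    -- The detour from `j` through `y`, then through pieces of `I`, to `x` does not use the edge
    -- between `j` and `x`, which therefore is no bridge.
    refine hbr ?_
    set H := (gluingGraph M J).deleteEdges {s(Sum.inl j, Sum.inr ⟨x, hxJ⟩)} with hH
    have hadjI : ∀ a ∈ I, ∀ z : J, z.1 ∈ M a → H.Adj (.inl a) (.inr z) := by
      intro a ha z hz
      rw [hH, SimpleGraph.deleteEdges_adj]
      refine ⟨hz, ?_⟩
      simp only [mem_singleton_iff, Sym2.eq_iff, reduceCtorEq, false_and, or_false, not_and]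
      intro h
      exact absurd (Sum.inl_injective h ▸ ha) hjI
    have h1 : H.Adj (.inl j) (.inr ⟨y, hyJ⟩) := by
      rw [hH, SimpleGraph.deleteEdges_adj]
      refine ⟨hyj, ?_⟩
      simp only [mem_singleton_iff, Sym2.eq_iff, reduceCtorEq, false_and, or_false, not_and]
      intro _ h
      exact hyx (congrArg Subtype.val (Sum.inr_injective h))
    have h2 : ∀ b, Relation.ReflTransGen (R I) i' b → H.Reachable (.inl i') (.inl b) := by
      intro b hb
      induction hb with
      | refl => exact .refl _
      | tail _ hbc ih =>
        obtain ⟨hb, hc, z, hz, hzb, hzc⟩ := hbc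
        exact ih.trans ((hadjI _ hb ⟨z, hz⟩ hzb).reachable.trans
          (hadjI _ hc ⟨z, hz⟩ hzc).symm.reachable)
    exact h1.reachable.trans ((hadjI i' hi'I _ hyi').symm.reachable.trans
      ((h2 i (hIconn _ hi'I _ hiI)).trans (hadjI i hiI _ hxi).reachable))
  have hPj : P (insert j I) := by
    refine ⟨by simp, ?_, ?_⟩
    · have := hIc.union_of_homeomorph hinter (hM j)
      rw [Finset.set_biUnion_insert, union_comm]
      exact this
    · have hle : R I ≤ R (insert j I) := fun a b h =>
        ⟨Finset.mem_insert_of_mem h.1, Finset.mem_insert_of_mem h.2.1, h.2.2⟩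
      have hmono : ∀ a b, Relation.ReflTransGen (R I) a b →
          Relation.ReflTransGen (R (insert j I)) a b := Relation.ReflTransGen.mono hle
      have hij : R (insert j I) i j :=
        ⟨Finset.mem_insert_of_mem hiI, Finset.mem_insert_self _ _, x, hxJ, hxi, hxj⟩
      have hji : R (insert j I) j i :=
        ⟨Finset.mem_insert_self _ _, Finset.mem_insert_of_mem hiI, x, hxJ, hxj, hxi⟩
      intro a ha b hb
      have h1 : Relation.ReflTransGen (R (insert j I)) a i := by
        rcases Finset.mem_insert.1 ha with rfl | ha
        · exact .single hji
        · exact hmono _ _ (hIconn _ ha _ hiI)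
      have h2 : Relation.ReflTransGen (R (insert j I)) i b := by
        rcases Finset.mem_insert.1 hb with rfl | hb
        · exact .single hij
        · exact hmono _ _ (hIconn _ hiI _ hb)
      exact h1.trans h2
  exact hjI (hI.le_of_ge hPj (Finset.subset_insert j I) (Finset.mem_insert_self j I))

open scoped Classical in
/-- `S` is the union of the pieces in the list `L` and of the set `J` of joint points, and the graph
of incidences is a tree. -/
structure IsGluing (L : List (Set X)) (J : Finset X) (S : Set X) : Prop where
  isClosed : ∀ M ∈ L, IsClosed M
  homeomorph : ∀ M ∈ L, Nonempty (M ≃ₜ unitInterval) ∨ Nonempty (M ≃ₜ Circle)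
  joint : ∀ M ∈ L, ∃ x ∈ J, x ∈ M
  mem_iff : ∀ x, x ∈ S ↔ x ∈ J ∨ ∃ M ∈ L, x ∈ M
  cover : L ≠ [] → ∀ x ∈ J, ∃ M ∈ L, x ∈ M
  pairwise : L.Pairwise fun M N => M ∩ N ⊆ (J : Set X)
  conn : ∃ p ∈ J, ∀ x ∈ J,
    Relation.ReflTransGen (fun a b => b ∈ J ∧ ∃ M ∈ L, a ∈ M ∧ b ∈ M) p x
  card : (L.map fun M => (J.filter (· ∈ M)).card).sum + 1 = L.length + J.card

theorem IsGluing.point (p : X) : IsGluing [] {p} ({p} : Set X) where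
  isClosed := by simp
  homeomorph := by simp
  joint := by simp
  mem_iff := by simp
  cover := by simp
  pairwise := by simp
  conn := ⟨p, by simp, by simp [Relation.ReflTransGen.refl]⟩
  card := by simp

-- An attaching point has to be declared a joint first. If it is not yet one, it lies on exactly one
-- piece, because pieces meet only in joints, so both sides of the count in `card` grow by one.
open scoped Classical in
theorem IsGluing.mark {L : List (Set X)} {J : Finset X} {S : Set X} (h : IsGluing L J S) {u : X}
    (hu : u ∈ S) : IsGluing L (insert u J) S := by
  by_cases huJ : u ∈ J
  · rwa [Finset.insert_eq_of_mem huJ]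
  obtain ⟨M, hML, huM⟩ := ((h.mem_iff u).1 hu).resolve_left huJ
  refine ⟨h.isClosed, h.homeomorph, ?_, ?_, ?_, ?_, ?_, ?_⟩
  · intro N hN
    obtain ⟨x, hx, hxN⟩ := h.joint N hN
    exact ⟨x, Finset.mem_insert_of_mem hx, hxN⟩
  · intro x
    rw [h.mem_iff, Finset.mem_insert]
    constructor
    · tauto
    · rintro ((rfl | hx) | hx)
      · exact Or.inr ⟨M, hML, huM⟩
      · exact Or.inl hx
      · exact Or.inr hx
  · intro hL x hx
    rcases Finset.mem_insert.1 hx with rfl | hx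
    · exact ⟨M, hML, huM⟩
    · exact h.cover hL x hx
  · refine h.pairwise.imp fun {A B} hAB => hAB.trans ?_
    simp
  · obtain ⟨p, hp, hconn⟩ := h.conn
    have hmono : ∀ x ∈ J, Relation.ReflTransGen
        (fun a b => b ∈ insert u J ∧ ∃ M ∈ L, a ∈ M ∧ b ∈ M) p x := by
      intro x hx
      refine Relation.ReflTransGen.mono ?_ _ _ (hconn x hx)
      exact fun a b h => ⟨Finset.mem_insert_of_mem h.1, h.2⟩
    refine ⟨p, Finset.mem_insert_of_mem hp, fun x hx => ?_⟩
    rcases Finset.mem_insert.1 hx with rfl | hx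
    · obtain ⟨y, hy, hyM⟩ := h.joint M hML
      exact (hmono y hy).tail ⟨Finset.mem_insert_self _ _, M, hML, hyM, huM⟩
    · exact hmono x hx
  · have hcard := h.card
    obtain ⟨L₁, L₂, rfl⟩ := List.append_of_mem hML
    have hpw := h.pairwise
    rw [List.pairwise_append, List.pairwise_cons] at hpw
    have h1 : ∀ N ∈ L₁, u ∉ N := fun N hN huN => huJ (hpw.2.2 N hN M (by simp) ⟨huN, huM⟩)
    have h2 : ∀ N ∈ L₂, u ∉ N := fun N hN huN => huJ (hpw.2.1.1 N hN ⟨huM, huN⟩)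
    have e1 : L₁.map (fun N => ((insert u J).filter (· ∈ N)).card) =
        L₁.map (fun N => (J.filter (· ∈ N)).card) :=
      List.map_congr_left fun N hN => by rw [Finset.filter_insert, if_neg (h1 N hN)]
    have e2 : L₂.map (fun N => ((insert u J).filter (· ∈ N)).card) =
        L₂.map (fun N => (J.filter (· ∈ N)).card) :=
      List.map_congr_left fun N hN => by rw [Finset.filter_insert, if_neg (h2 N hN)]
    have e3 : ((insert u J).filter (· ∈ M)).card = (J.filter (· ∈ M)).card + 1 := by
      rw [Finset.filter_insert, if_pos huM, Finset.card_insert_of_notMem (by simp [huJ])]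
    simp only [List.map_append, List.map_cons, List.sum_append, List.sum_cons, List.length_append,
      List.length_cons] at hcard ⊢
    rw [e1, e2, e3, Finset.card_insert_of_notMem huJ]
    omega

/-- All joints lie in `S`, so the new piece contains only the joint `u`: it contributes one
incidence and one piece to the count. -/
theorem IsGluing.attach {L : List (Set X)} {J : Finset X} {S M : Set X} (h : IsGluing L J S)
    {u : X} (huJ : u ∈ J) (hu : S ∩ M = {u}) (hM : IsClosed M)
    (hM' : Nonempty (M ≃ₜ unitInterval) ∨ Nonempty (M ≃ₜ Circle)) :
    IsGluing (M :: L) J (S ∪ M) := by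
  classical
  have huM : u ∈ M := (hu.ge rfl).2
  have hJS : ∀ x ∈ J, x ∈ S := fun x hx => (h.mem_iff x).2 (Or.inl hx)
  refine ⟨?_, ?_, ?_, ?_, ?_, ?_, ?_, ?_⟩
  · exact List.forall_mem_cons.2 ⟨hM, h.isClosed⟩
  · exact List.forall_mem_cons.2 ⟨hM', h.homeomorph⟩
  · exact List.forall_mem_cons.2 ⟨⟨u, huJ, huM⟩, h.joint⟩
  · intro x
    simp only [mem_union, h.mem_iff, List.exists_mem_cons_iff]
    rw [or_assoc, or_comm (a := ∃ N ∈ L, x ∈ N)]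
  · intro _ x hx
    -- Without pieces the count says that there is a single joint, which is `u` and lies on the new
    -- piece.
    by_cases hL : L = []
    · subst hL
      have hc := h.card
      simp only [List.map_nil, List.sum_nil, List.length_nil, zero_add] at hc
      have : x = u := Finset.card_le_one.1 hc.ge x hx u huJ
      exact ⟨M, by simp, this ▸ huM⟩
    · obtain ⟨N, hN, hxN⟩ := h.cover hL x hx
      exact ⟨N, List.mem_cons_of_mem _ hN, hxN⟩
  · refine List.pairwise_cons.2 ⟨fun N hN x hx => ?_, h.pairwise⟩
    have : x ∈ S ∩ M := ⟨(h.mem_iff x).2 (Or.inr ⟨N, hN, hx.2⟩), hx.1⟩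
    rw [hu] at this
    exact this ▸ huJ
  · obtain ⟨p, hp, hconn⟩ := h.conn
    refine ⟨p, hp, fun x hx => Relation.ReflTransGen.mono ?_ _ _ (hconn x hx)⟩
    rintro a b ⟨hb, N, hN, hab⟩
    exact ⟨hb, N, List.mem_cons_of_mem _ hN, hab⟩
  · have : J.filter (· ∈ M) = {u} := by
      ext x
      simp only [Finset.mem_filter, Finset.mem_singleton]
      constructor
      · rintro ⟨hx, hxM⟩
        exact hu.le ⟨hJS x hx, hxM⟩
      · rintro rfl
        exact ⟨huJ, huM⟩
    have hc := h.card
    simp only [List.map_cons, List.sum_cons, List.length_cons, this, Finset.card_singleton]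
    omega

theorem IsCactusSet.exists_isGluing [T2Space X] {S : Set X} (h : IsCactusSet S) :
    ∃ L J, IsGluing L J S := by
  classical
  induction h with
  | point p => exact ⟨_, _, .point p⟩
  | attach γ hS hγ hu ih =>
    obtain ⟨L, J, hLJ⟩ := ih
    refine ⟨_, _, (hLJ.mark (hu.ge rfl).1).attach (Finset.mem_insert_self _ _) hu
      (hγ.isCompact_image le_rfl le_rfl).isClosed ?_⟩
    by_cases h01 : γ 0 = γ 1
    · exact Or.inr (hγ.nonempty_homeomorph_circle h01)
    · exact Or.inl (hγ.isArc h01).nonempty_homeomorph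

/-- A connected graph with one edge fewer than vertices is a tree. The graph being bipartite, its
edges are counted by the degrees of the pieces, which is the sum in `card`. Nontriviality excludes
the single point, a gluing without pieces. -/
theorem IsGluing.isHomeomorphicToCactus [T2Space X] [Nontrivial X] {L : List (Set X)}
    {J : Finset X} (h : IsGluing L J univ) : IsHomeomorphicToCactus X := by
  classical
  have hL : L ≠ [] := by
    rintro rfl
    have hc := h.card
    simp only [List.map_nil, List.sum_nil, List.length_nil, zero_add] at hc
    obtain ⟨x, y, hxy⟩ := exists_pair_ne X
    have hJ : ∀ z, z ∈ J := fun z => ((h.mem_iff z).1 (mem_univ z)).resolve_right (by simp)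
    exact hxy (Finset.card_le_one.1 hc.ge x (hJ x) y (hJ y))
  refine ⟨L.length, L.get, J, fun i => h.isClosed _ (L.get_mem i),
    fun i => h.homeomorph _ (L.get_mem i), ?_, ?_, ?_⟩
  · refine eq_univ_of_forall fun x => mem_iUnion.2 ?_
    obtain ⟨M, hM, hx⟩ : ∃ M ∈ L, x ∈ M := by
      rcases (h.mem_iff x).1 (mem_univ x) with hx | hx
      · exact h.cover hL x hx
      · exact hx
    obtain ⟨i, rfl⟩ := List.get_of_mem hM
    exact ⟨i, hx⟩
  · intro i j hij
    rcases lt_or_gt_of_ne hij with hlt | hlt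
    · exact List.pairwise_iff_get.1 h.pairwise i j hlt
    · rw [inter_comm]
      exact List.pairwise_iff_get.1 h.pairwise j i hlt
  · rw [SimpleGraph.isTree_iff_connected_and_card]
    constructor
    · obtain ⟨p, hp, hconn⟩ := h.conn
      have hr : ∀ x, Relation.ReflTransGen (fun a b => b ∈ J ∧ ∃ M ∈ L, a ∈ M ∧ b ∈ M) p x →
          ∀ hx : x ∈ J, (gluingGraph L.get J).Reachable (.inr ⟨p, hp⟩) (.inr ⟨x, hx⟩) := by
        intro x hx
        induction hx with
        | refl => exact fun _ => .refl _
        | @tail b c hb hbc ih =>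
          intro hc
          obtain ⟨-, M, hM, hbM, hcM⟩ := hbc
          obtain ⟨i, rfl⟩ := List.get_of_mem hM
          have hbJ : b ∈ J := by
            rcases hb.cases_tail with rfl | ⟨_, _, hb'⟩
            · exact hp
            · exact hb'.1
          refine (ih hbJ).trans (SimpleGraph.Reachable.trans (v := .inl i) ?_ ?_)
          · exact SimpleGraph.Adj.reachable (show (gluingGraph L.get J).Adj (.inr _) (.inl i) from hbM)
          · exact SimpleGraph.Adj.reachable (show (gluingGraph L.get J).Adj (.inl i) (.inr _) from hcM)
      have hall : ∀ v, (gluingGraph L.get J).Reachable (.inr ⟨p, hp⟩) v := by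
        rintro (i | ⟨x, hx⟩)
        · obtain ⟨x, hx, hxM⟩ := h.joint _ (L.get_mem i)
          exact (hr x (hconn x hx) hx).trans (SimpleGraph.Adj.reachable
            (show (gluingGraph L.get J).Adj (.inr ⟨x, hx⟩) (.inl i) from hxM))
        · exact hr x (hconn x hx) hx
      exact @SimpleGraph.Connected.mk _ _ (fun v w => (hall v).symm.trans (hall w)) ⟨.inr ⟨p, hp⟩⟩
    · have hb : (gluingGraph L.get J).IsBipartiteWith
          (↑(Finset.univ.map (Function.Embedding.inl : Fin L.length ↪ Fin L.length ⊕ J)) :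
            Set (Fin L.length ⊕ J))
          (↑(Finset.univ.map (Function.Embedding.inr : J ↪ Fin L.length ⊕ J)) :
            Set (Fin L.length ⊕ J)) := by
        constructor
        · rw [disjoint_left]
          simp
        · rintro (i | x) (j | y) hadj
          · exact absurd hadj id
          · simp
          · simp
          · exact absurd hadj id
      have hsum := SimpleGraph.isBipartiteWith_sum_degrees_eq_card_edges hb
      have hdeg : ∀ i, (gluingGraph L.get J).degree (.inl i) = (J.filter (· ∈ L.get i)).card := by
        intro i
        rw [← SimpleGraph.card_neighborFinset_eq_degree]
        symm
        refine Finset.card_bij (fun x hx => Sum.inr ⟨x, (Finset.mem_filter.1 hx).1⟩) ?_ ?_ ?_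
        · intro x hx
          rw [SimpleGraph.mem_neighborFinset]
          exact (Finset.mem_filter.1 hx).2
        · intro x _ y _ he
          exact congrArg Subtype.val (Sum.inr_injective he)
        · rintro (j | ⟨x, hx⟩) hadj
          · rw [SimpleGraph.mem_neighborFinset] at hadj
            exact absurd hadj id
          · rw [SimpleGraph.mem_neighborFinset] at hadj
            exact ⟨x, Finset.mem_filter.2 ⟨hx, hadj⟩, rfl⟩
      have hs : (L.map fun M => (J.filter (· ∈ M)).card).sum =
          ∑ i : Fin L.length, (J.filter (· ∈ L.get i)).card := by
        rw [← List.sum_ofFn]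
        congr 1
        exact (List.ofFn_getElem_eq_map L _).symm
      rw [Finset.sum_map] at hsum
      change ∑ i : Fin L.length, (gluingGraph L.get J).degree (Sum.inl i) = _ at hsum
      simp only [hdeg] at hsum
      have hcard := h.card
      rw [hs, hsum] at hcard
      rw [Nat.card_eq_fintype_card, ← SimpleGraph.edgeFinset_card, hcard]
      simp

end Gluings

end

/-! ### Order ratio and snakes -/

noncomputable section

section PathLength

variable {M : Type*} [MetricSpace M]

theorem pathLength_nonneg : ∀ l : List M, 0 ≤ pathLength l
  | [] => le_rfl
  | [_] => le_rfl
  | _ :: y :: l => add_nonneg dist_nonneg (pathLength_nonneg (y :: l))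

theorem pathLength_le_cons (a : M) : ∀ l : List M, pathLength l ≤ pathLength (a :: l)
  | [] => le_rfl
  | _ :: _ => le_add_of_nonneg_left dist_nonneg

theorem dist_head_le_pathLength : ∀ (l : List M) (a x : M), x ∈ a :: l →
    dist a x ≤ pathLength (a :: l)
  | [], a, x, h => by
    rw [List.mem_singleton] at h
    subst h
    simp [pathLength]
  | b :: l, a, x, h => by
    rcases List.mem_cons.1 h with rfl | h
    · rw [dist_self]; exact pathLength_nonneg _
    · exact (dist_triangle a b x).trans (add_le_add_right (dist_head_le_pathLength l b x h) _)

theorem dist_le_pathLength {l : List M} {x y : M} (hx : x ∈ l) (hy : y ∈ l) :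
    dist x y ≤ pathLength l := by
  induction l with
  | nil => simp at hx
  | cons a l ih =>
    rcases List.mem_cons.1 hx with rfl | hx'
    · exact dist_head_le_pathLength l x y hy
    rcases List.mem_cons.1 hy with rfl | hy'
    · rw [dist_comm]; exact dist_head_le_pathLength l y x hx
    exact (ih hx' hy').trans (pathLength_le_cons a l)

theorem two_dist_head_le_pathLength : ∀ (l : List M) (a x y : M), x ∈ a :: l → y ∈ a :: l →
    dist a x + dist x y ≤ pathLength (a :: l) ∨ dist a y + dist y x ≤ pathLength (a :: l)
  | [], a, x, y, hx, hy => by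
    rw [List.mem_singleton] at hx hy
    subst hx hy
    simp [pathLength]
  | b :: l, a, x, y, hx, hy => by
    rcases List.mem_cons.1 hx with rfl | hx'
    · left
      rw [dist_self, zero_add]
      exact dist_head_le_pathLength _ _ _ hy
    rcases List.mem_cons.1 hy with rfl | hy'
    · right
      rw [dist_self, zero_add]
      exact dist_head_le_pathLength _ _ _ hx
    have h1 := dist_triangle a b x
    have h2 := dist_triangle a b y
    have h3 : pathLength (a :: b :: l) = dist a b + pathLength (b :: l) := rfl
    rcases two_dist_head_le_pathLength l b x y hx' hy' with h | h
    · left; linarith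
    · right; linarith

/-- The three terms under the two minima correspond to which of the three points is visited second.
-/
theorem min_two_dist_le_pathLength {l : List M} {x y z : M} (hx : x ∈ l) (hy : y ∈ l)
    (hz : z ∈ l) : min (dist x y + dist y z) (dist x z + min (dist x y) (dist y z)) ≤
      pathLength l := by
  induction l with
  | nil => simp at hx
  | cons a l ih =>
    rw [min_le_iff, ← min_add_add_left, min_le_iff]
    rcases List.mem_cons.1 hx with rfl | hx'
    · rcases two_dist_head_le_pathLength l x y z hy hz with h | h
      · exact Or.inl h
      · exact Or.inr (Or.inr (by rwa [dist_comm y z]))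
    rcases List.mem_cons.1 hy with rfl | hy'
    · rcases two_dist_head_le_pathLength l y x z hx hz with h | h
      · exact Or.inr (Or.inl (by rw [dist_comm x y, add_comm]; exact h))
      · exact Or.inr (Or.inr (by rw [dist_comm x z, add_comm]; exact h))
    rcases List.mem_cons.1 hz with rfl | hz'
    · rcases two_dist_head_le_pathLength l z y x hy hx with h | h
      · exact Or.inl (by rw [dist_comm x y, dist_comm y z, add_comm]; exact h)
      · exact Or.inr (Or.inl (by rw [dist_comm x z]; exact h))
    have := (ih hx' hy' hz').trans (pathLength_le_cons a l)
    rwa [min_le_iff, ← min_add_add_left, min_le_iff] at this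

theorem pathLength_eq_sum (a : M) : ∀ l : List M, pathLength l =
    ∑ i ∈ Finset.range (l.length - 1), dist (l.getD i a) (l.getD (i + 1) a)
  | [] => by simp [pathLength]
  | [_] => by simp [pathLength]
  | x :: y :: l => by
    have h := pathLength_eq_sum a (y :: l)
    simp only [List.length_cons, Nat.add_sub_cancel] at h ⊢
    rw [Finset.sum_range_succ', pathLength, h, add_comm]
    rfl

theorem lOpt_le {X : Finset M} {l : List M} (h : ∀ x ∈ X, x ∈ l) : lOpt X ≤ pathLength l :=
  ciInf_le (f := fun l : {l : List M // ∀ x ∈ X, x ∈ l} => pathLength l.1)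
    ⟨0, by rintro _ ⟨l, rfl⟩; exact pathLength_nonneg _⟩ ⟨l, h⟩

theorem le_lOpt {X : Finset M} {c : ℝ} (h : ∀ l : List M, (∀ x ∈ X, x ∈ l) → c ≤ pathLength l) :
    c ≤ lOpt X := by
  have : Nonempty {l : List M // ∀ x ∈ X, x ∈ l} := ⟨⟨X.toList, by simp⟩⟩
  exact le_ciInf fun l => h l.1 l.2

theorem dist_le_lOpt {X : Finset M} {x y : M} (hx : x ∈ X) (hy : y ∈ X) : dist x y ≤ lOpt X :=
  le_lOpt fun _ h => dist_le_pathLength (h x hx) (h y hy)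

theorem lOpt_pos {X : Finset M} (h : 2 ≤ X.card) : 0 < lOpt X := by
  obtain ⟨x, hx, y, hy, hxy⟩ := Finset.one_lt_card.1 h
  exact (dist_pos.2 hxy).trans_le (dist_le_lOpt hx hy)

theorem lOrd_toFinset [DecidableEq M] (T : LinearOrder M) {l : List M} (hl : l.Pairwise T.lt) :
    lOrd T l.toFinset = pathLength l := by
  let := T
  have hnd : l.Nodup := hl.imp fun h => ne_of_lt h
  unfold lOrd
  congr 1
  exact (List.toFinset_sort _ hnd).2 (hl.imp fun h => le_of_lt h)

/-- The order `T` has no elongated snakes on `s + 1` points: if the points of even index and those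
of odd index of an increasing sequence are `w`-close, then all of them are within `C * w`. -/
def SnakeBound (T : LinearOrder M) (s : ℕ) (C : ℝ) : Prop :=
  ∀ x : ℕ → M, (∀ i < s, T.lt (x i) (x (i + 1))) →
    ∀ w, (∀ i, i + 2 ≤ s → dist (x i) (x (i + 2)) ≤ w) → dist (x 0) (x 1) ≤ C * w

/-- Each step is at most `lOpt X`. If the sum is almost `s * lOpt X`, there are `s` steps, all
almost as long as `lOpt X`. A path through three consecutive points is then too short to pay for two
such steps, so the outer two of the three are close: the points form a snake. -/
theorem SnakeBound.orderRatio_lt {T : LinearOrder M} {s : ℕ} {C : ℝ} (hs : 2 ≤ s) (hC : 0 ≤ C)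
    (h : SnakeBound T s C) : orderRatio T s < s := by
  have hs' : (2 : ℝ) ≤ s := by exact_mod_cast hs
  -- With this choice `C * ε = 1 - 3 * ε < 1 - ε`, which contradicts the snake bound, and `ε ≤ 1 /
  -- 3` makes two long steps exceed `lOpt X`.
  set ε : ℝ := 1 / (C + 3) with hε
  have hε0 : 0 < ε := by positivity
  have hεC : ε * (C + 3) = 1 := by rw [hε]; field_simp
  have hε3 : ε ≤ 1 / 3 := by
    have : 0 ≤ ε * C := by positivity
    linarith
  have key : ∀ X : Finset M, 2 ≤ X.card → X.card ≤ s + 1 → lOrd T X ≤ (s - ε) * lOpt X := by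
    intro X hX2 hXs
    have hO := lOpt_pos hX2
    let := T
    set l := X.sort (· ≤ ·) with hl
    have hlen : l.length = X.card := Finset.length_sort _
    have hmem : ∀ x, x ∈ l ↔ x ∈ X := fun x => Finset.mem_sort _
    obtain ⟨a, -⟩ : X.Nonempty := Finset.card_pos.1 (by omega)
    have hlO : lOrd T X = pathLength l := rfl
    set x : ℕ → M := fun i => l.getD i a with hx
    have hxX : ∀ i < X.card, x i ∈ X := by
      intro i hi
      rw [← hmem]
      simp only [hx]
      rw [List.getD_eq_getElem l a (by omega)]
      exact List.getElem_mem _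
    rw [hlO, pathLength_eq_sum a, hlen]
    change ∑ i ∈ Finset.range (X.card - 1), dist (x i) (x (i + 1)) ≤ _
    have hterm : ∀ i ∈ Finset.range (X.card - 1), dist (x i) (x (i + 1)) ≤ lOpt X := by
      intro i hi
      rw [Finset.mem_range] at hi
      exact dist_le_lOpt (hxX i (by omega)) (hxX (i + 1) (by omega))
    by_contra! hcon
    have hcard : X.card = s + 1 := by
      by_contra hne
      have h1 := Finset.sum_le_card_nsmul _ _ _ hterm
      rw [Finset.card_range, nsmul_eq_mul] at h1
      have h2 : ((X.card - 1 : ℕ) : ℝ) ≤ s - 1 := by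
        rw [le_sub_iff_add_le]
        exact_mod_cast (by omega : X.card - 1 + 1 ≤ s)
      nlinarith
    rw [hcard, Nat.add_sub_cancel] at hcon hterm
    have hbig : ∀ i < s, (1 - ε) * lOpt X < dist (x i) (x (i + 1)) := by
      intro i hi
      have hi' := Finset.mem_range.2 hi
      rw [← Finset.add_sum_erase _ _ hi'] at hcon
      have h1 := Finset.sum_le_card_nsmul ((Finset.range s).erase i) _ _
        fun j hj => hterm j (Finset.mem_of_mem_erase hj)
      rw [Finset.card_erase_of_mem hi', Finset.card_range, nsmul_eq_mul,
        Nat.cast_sub (by omega), Nat.cast_one] at h1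
      nlinarith
    have hlt : ∀ i < s, T.lt (x i) (x (i + 1)) := by
      intro i hi
      have hp : l.Pairwise (· < ·) := List.sortedLT_iff_pairwise.1 (Finset.sortedLT_sort X)
      simp only [hx]
      rw [List.getD_eq_getElem l a (by omega), List.getD_eq_getElem l a (by omega)]
      exact List.pairwise_iff_getElem.1 hp i (i + 1) (by omega) (by omega) (by omega)
    have hsmall : ∀ i, i + 2 ≤ s → dist (x i) (x (i + 2)) ≤ ε * lOpt X := by
      intro i hi
      have h1 := hbig i (by omega)
      have h2 := hbig (i + 1) (by omega)
      have h3 : min (dist (x i) (x (i + 1)) + dist (x (i + 1)) (x (i + 2)))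
          (dist (x i) (x (i + 2)) + min (dist (x i) (x (i + 1))) (dist (x (i + 1)) (x (i + 2))))
          ≤ lOpt X := le_lOpt fun l' hl' => min_two_dist_le_pathLength
            (hl' _ (hxX _ (by omega))) (hl' _ (hxX _ (by omega))) (hl' _ (hxX _ (by omega)))
      have h4 : (1 - ε) * lOpt X ≤ min (dist (x i) (x (i + 1))) (dist (x (i + 1)) (x (i + 2))) :=
        le_min h1.le h2.le
      rcases min_le_iff.1 h3 with h5 | h5
      · nlinarith
      · linarith
    have h1 := h x hlt _ hsmall
    have h2 := hbig 0 (by omega)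
    have h3 : (1 - ε) * lOpt X < C * (ε * lOpt X) := h2.trans_le h1
    nlinarith
  have hle : orderRatio T s ≤ ENNReal.ofReal (s - ε) := by
    refine iSup₂_le fun X hX => ENNReal.ofReal_le_ofReal ?_
    rw [div_le_iff₀ (lOpt_pos hX.1)]
    exact key X hX.1 hX.2
  refine hle.trans_lt ?_
  rw [← ENNReal.ofReal_natCast s]
  exact (ENNReal.ofReal_lt_ofReal_iff (by linarith)).2 (by linarith)

theorem exists_ratio_bound {T : LinearOrder M} {s : ℕ} (h : orderRatio T s < s) :
    ∃ c : ℝ, 0 ≤ c ∧ c < s ∧ ∀ l l' : List M, 2 ≤ l.length → l.length ≤ s + 1 → l.Pairwise T.lt →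
      (∀ x ∈ l, x ∈ l') → pathLength l ≤ c * pathLength l' := by
  classical
  refine ⟨(orderRatio T s).toReal, ENNReal.toReal_nonneg, ?_, ?_⟩
  · have := (ENNReal.toReal_lt_toReal h.ne_top (ENNReal.natCast_ne_top s)).2 h
    simpa using this
  · intro l l' h2 hs hl hll'
    have hnd : l.Nodup := hl.imp fun h => (let := T; ne_of_lt h)
    have hc : l.toFinset.card = l.length := List.toFinset_card_of_nodup hnd
    have hpos : 0 < lOpt l.toFinset := lOpt_pos (by omega)
    have h1 : ENNReal.ofReal (lOrd T l.toFinset / lOpt l.toFinset) ≤ orderRatio T s :=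
      le_iSup₂ (f := fun (X : Finset M) (_ : 2 ≤ X.card ∧ X.card ≤ s + 1) =>
        ENNReal.ofReal (lOrd T X / lOpt X)) l.toFinset ⟨by omega, by omega⟩
    have h3 := (ENNReal.ofReal_le_iff_le_toReal h.ne_top).1 h1
    rw [div_le_iff₀ hpos, lOrd_toFinset T hl] at h3
    refine h3.trans (mul_le_mul_of_nonneg_left (lOpt_le fun x hx => hll' x ?_)
      ENNReal.toReal_nonneg)
    exact List.mem_toFinset.1 hx

theorem not_orderRatio_one_lt [Nontrivial M] (T : LinearOrder M) :
    ¬ orderRatio T 1 < (1 : ℕ) := by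
  intro h
  obtain ⟨c, -, hc1, hc⟩ := exists_ratio_bound h
  let := T
  obtain ⟨x, y, hxy⟩ := exists_pair_lt M
  have := hc [x, y] [x, y] (by simp) (by simp) (by simpa using hxy) (fun _ h => h)
  have hd : 0 < dist x y := dist_pos.2 hxy.ne
  simp only [pathLength, Nat.cast_one] at this hc1
  nlinarith

theorem exists_three_snake_bound {T : LinearOrder M} (h : orderRatio T 2 < (2 : ℕ)) :
    ∃ C : ℝ, 0 ≤ C ∧ ∀ x₁ x₂ x₃, T.lt x₁ x₂ → T.lt x₂ x₃ → dist x₁ x₂ ≤ C * dist x₁ x₃ := by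
  obtain ⟨c, hc0, hc2, hc⟩ := exists_ratio_bound h
  push_cast at hc2
  -- The competing path is `x₃, x₁, x₂`: with `d = dist x₁ x₂` and `w = dist x₁ x₃` one gets `2 * d
  -- - w ≤ c * (d + w)`.
  refine ⟨(c + 1) / (2 - c), div_nonneg (by linarith) (by linarith), fun x₁ x₂ x₃ h12 h23 => ?_⟩
  have h13 : T.lt x₁ x₃ := by let := T; exact lt_trans h12 h23
  have := hc [x₁, x₂, x₃] [x₃, x₁, x₂] (by simp) (by simp) (by simp [h12, h13, h23])
    (by simp)
  simp only [pathLength] at this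
  have h1 := dist_triangle_right x₁ x₂ x₃
  have h2 := dist_comm x₁ x₃
  rw [div_mul_eq_mul_div, le_div_iff₀ (by linarith)]
  nlinarith

theorem exists_four_snake_bound {T : LinearOrder M} (h : orderRatio T 3 < (3 : ℕ)) :
    ∃ C : ℝ, 0 ≤ C ∧ ∀ x₁ x₂ x₃ x₄ w, T.lt x₁ x₂ → T.lt x₂ x₃ → T.lt x₃ x₄ →
      dist x₁ x₃ ≤ w → dist x₂ x₄ ≤ w → dist x₁ x₂ ≤ C * w := by
  obtain ⟨c, hc0, hc3, hc⟩ := exists_ratio_bound h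
  push_cast at hc3
  -- The competing path is `x₃, x₁, x₂, x₄`, of length at most `d + 2 * w` with `d = dist x₁ x₂`,
  -- while the ordered one has length at least `3 * d - 3 * w`.
  refine ⟨(2 * c + 3) / (3 - c), div_nonneg (by linarith) (by linarith),
    fun x₁ x₂ x₃ x₄ w h12 h23 h34 hw1 hw2 => ?_⟩
  have h13 : T.lt x₁ x₃ := by let := T; exact lt_trans h12 h23
  have h24 : T.lt x₂ x₄ := by let := T; exact lt_trans h23 h34
  have h14 : T.lt x₁ x₄ := by let := T; exact lt_trans h12 h24
  have := hc [x₁, x₂, x₃, x₄] [x₃, x₁, x₂, x₄] (by simp) (by simp)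
    (by simp [h12, h13, h23, h14, h24, h34]) (by simp)
  simp only [pathLength] at this
  have h1 := dist_triangle_right x₁ x₂ x₃
  have h2 := dist_triangle4 x₁ x₃ x₄ x₂
  have h3 := dist_comm x₁ x₃
  have h4 := dist_comm x₂ x₄
  rw [div_mul_eq_mul_div, le_div_iff₀ (by linarith)]
  nlinarith

theorem orderBreakpoint_le {s : ℕ} (hs : 1 ≤ s) {T : LinearOrder M} (h : orderRatio T s < s) :
    orderBreakpoint M ≤ s :=
  (iInf_le _ T).trans (iInf₂_le (f := fun (s : ℕ) (_ : 1 ≤ s ∧ orderRatio T s < s) => (s : ℕ∞))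
    s ⟨hs, h⟩)

theorem le_orderBreakpoint {s : ℕ} (h : ∀ T : LinearOrder M, ∀ t, 1 ≤ t → t < s →
    ¬ orderRatio T t < t) : (s : ℕ∞) ≤ orderBreakpoint M := by
  refine le_iInf fun T => le_iInf₂ fun t ht => ?_
  by_contra! hcon
  exact h T t ht.1 (by exact_mod_cast hcon) ht.2

end PathLength

/-! ### From small snakes to disjoint continua -/

section LocalToGlobal

open Set

variable {M : Type*} [MetricSpace M]

/-- A property that does not change over steps shorter than `δ` is locally constant, hence constant
on a connected set. -/
theorem IsPreconnected.eq_of_dist_lt {S : Set M} (hS : IsPreconnected S) {δ : ℝ} (hδ : 0 < δ)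
    {f : M → Prop} (hf : ∀ x ∈ S, ∀ y ∈ S, dist x y < δ → (f x ↔ f y)) {x y : M} (hx : x ∈ S)
    (hy : y ∈ S) : f x ↔ f y := by
  classical
  have hc : ContinuousOn (fun x => decide (f x)) S := by
    intro x hx
    refine ContinuousWithinAt.congr_of_eventuallyEq (f := fun _ => decide (f x))
      continuousWithinAt_const ?_ rfl
    filter_upwards [inter_mem_nhdsWithin S (Metric.ball_mem_nhds x hδ)] with y hy
    simpa using hf y hy.1 x hx hy.2
  simpa using hS.constant hc hx hy

theorem exists_pos_le_dist {A B : Set M} (hA : IsCompact A) (hB : IsCompact B)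
    (hAB : Disjoint A B) : ∃ D : ℝ, 0 < D ∧ ∀ x ∈ A, ∀ y ∈ B, D ≤ dist x y := by
  rcases (A ×ˢ B).eq_empty_or_nonempty with h | h
  · refine ⟨1, one_pos, fun x hx y hy => ?_⟩
    exact absurd (show (x, y) ∈ A ×ˢ B from ⟨hx, hy⟩) (by simp [h])
  · obtain ⟨p, hp, hmin⟩ := (hA.prod hB).exists_isMinOn h continuous_dist.continuousOn
    refine ⟨dist p.1 p.2, dist_pos.2 fun he => disjoint_left.1 hAB hp.1 (he ▸ hp.2), ?_⟩
    exact fun x hx y hy => hmin (show (x, y) ∈ A ×ˢ B from ⟨hx, hy⟩)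

/-- For `a, a'` in `A` and `b, b'` in `B`, the number of true comparisons among the four pairs is
even when both pairs are close. Parity is additive when rectangles are put side by side, so
connectedness of `A` and then of `B` gives evenness for `x₁, x₃` and `x₂, x₄`. A crossing has
exactly three true comparisons. -/
theorem noncrossing_of_four_snake_bound {T : LinearOrder M} {C : ℝ} (hC : 0 ≤ C)
    (h : ∀ x₁ x₂ x₃ x₄ w, T.lt x₁ x₂ → T.lt x₂ x₃ → T.lt x₃ x₄ →
      dist x₁ x₃ ≤ w → dist x₂ x₄ ≤ w → dist x₁ x₂ ≤ C * w) : Noncrossing T.lt univ := by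
  intro A B hAc hA _ hBc hB _ hAB x₁ h₁ x₂ h₂ x₃ h₃ x₄ h₄ h12 h23 h34
  obtain ⟨D, hD0, hD⟩ := exists_pos_le_dist hAc hBc hAB
  -- Chosen so that `C * δ < D`: an alternating quadruple with pairs closer than `δ` would bring `A`
  -- and `B` closer than `D`.
  set δ := D / (C + 1) with hδ
  have hδ0 : 0 < δ := by positivity
  have hCδ : C * δ < D := by
    have : δ * (C + 1) = D := by rw [hδ]; field_simp
    linarith
  have hAB' : ∀ x ∈ A, ∀ y ∈ B, ¬ dist x y ≤ C * δ := fun x hx y hy hle => by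
    linarith [hD x hx y hy]
  have hBA' : ∀ x ∈ A, ∀ y ∈ B, ¬ dist y x ≤ C * δ := fun x hx y hy hle => by
    rw [dist_comm] at hle; exact hAB' x hx y hy hle
  let := T
  -- the parity of the number of pairs `a < b` in a small rectangle
  have loc : ∀ a ∈ A, ∀ a' ∈ A, dist a a' < δ → ∀ b ∈ B, ∀ b' ∈ B, dist b b' < δ →
      ((a < b ↔ a < b') ↔ (a' < b ↔ a' < b')) := by
    intro a ha a' ha' haa b hb b' hb' hbb
    have n1 : a ≠ b := fun e => disjoint_left.1 hAB ha (e ▸ hb)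
    have n2 : a ≠ b' := fun e => disjoint_left.1 hAB ha (e ▸ hb')
    have n3 : a' ≠ b := fun e => disjoint_left.1 hAB ha' (e ▸ hb)
    have n4 : a' ≠ b' := fun e => disjoint_left.1 hAB ha' (e ▸ hb')
    have haa' : dist a' a < δ := by rwa [dist_comm]
    have hbb' : dist b' b < δ := by rwa [dist_comm]
    have q1 := fun k1 k2 k3 => hAB' a ha b hb (h a b a' b' δ k1 k2 k3 haa.le hbb.le)
    have q2 := fun k1 k2 k3 => hAB' a ha b' hb' (h a b' a' b δ k1 k2 k3 haa.le hbb'.le)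
    have q3 := fun k1 k2 k3 => hAB' a' ha' b hb (h a' b a b' δ k1 k2 k3 haa'.le hbb.le)
    have q4 := fun k1 k2 k3 => hAB' a' ha' b' hb' (h a' b' a b δ k1 k2 k3 haa'.le hbb'.le)
    have q5 := fun k1 k2 k3 => hBA' a ha b hb (h b a b' a' δ k1 k2 k3 hbb.le haa.le)
    have q6 := fun k1 k2 k3 => hBA' a ha b' hb' (h b' a b a' δ k1 k2 k3 hbb'.le haa.le)
    have q7 := fun k1 k2 k3 => hBA' a' ha' b hb (h b a' b' a δ k1 k2 k3 hbb.le haa'.le)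
    have q8 := fun k1 k2 k3 => hBA' a' ha' b' hb' (h b' a' b a δ k1 k2 k3 hbb'.le haa'.le)
    -- If the number is odd, one comparison differs from the other three, and then the four points
    -- alternate.
    rcases lt_or_gt_of_ne n1 with m1 | m1 <;> rcases lt_or_gt_of_ne n2 with m2 | m2 <;>
      rcases lt_or_gt_of_ne n3 with m3 | m3 <;> rcases lt_or_gt_of_ne n4 with m4 | m4 <;>
      simp only [m1, m2, m3, m4, asymm m1, asymm m2, asymm m3, asymm m4, iff_self, iff_true,
        true_iff, iff_false, false_iff, not_true_eq_false, not_false_eq_true]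
    all_goals first
      | exact q1 m1 m3 m4
      | exact q2 m2 m4 m3
      | exact q3 m3 m1 m2
      | exact q4 m4 m2 m1
      | exact q5 m1 m2 m4
      | exact q6 m2 m1 m3
      | exact q7 m3 m4 m2
      | exact q8 m4 m3 m1
  have glob1 : ∀ b ∈ B, ∀ b' ∈ B, dist b b' < δ →
      ((x₁ < b ↔ x₁ < b') ↔ (x₃ < b ↔ x₃ < b')) := fun b hb b' hb' hbb =>
    hA.eq_of_dist_lt hδ0 (f := fun a => (a < b ↔ a < b'))
      (fun a ha a' ha' haa => loc a ha a' ha' haa b hb b' hb' hbb) h₁ h₃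
  have glob2 : (x₁ < x₂ ↔ x₃ < x₂) ↔ (x₁ < x₄ ↔ x₃ < x₄) :=
    hB.eq_of_dist_lt hδ0 (f := fun b => (x₁ < b ↔ x₃ < b))
      (fun b hb b' hb' hbb => by have := glob1 b hb b' hb' hbb; tauto) h₂ h₄
  have h12' : x₁ < x₂ := h12
  have h23' : x₂ < x₃ := h23
  have h34' : x₃ < x₄ := h34
  have h14' : x₁ < x₄ := h12'.trans (h23'.trans h34')
  have h32' : ¬ x₃ < x₂ := asymm h23'
  tauto

/-- If some points of `A` lie below `y` and others above, connectedness yields two such points at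
distance less than `δ`; the snake bound then places `y` closer to `A` than `D`. -/
theorem not_between_of_three_snake_bound {T : LinearOrder M} {C : ℝ} (hC : 0 ≤ C)
    (h : ∀ x₁ x₂ x₃, T.lt x₁ x₂ → T.lt x₂ x₃ → dist x₁ x₂ ≤ C * dist x₁ x₃) {A : Set M}
    (hAc : IsCompact A) (hA : IsPreconnected A) {x y z : M} (hx : x ∈ A) (hz : z ∈ A) (hy : y ∉ A) :
    ¬ (T.lt x y ∧ T.lt y z) := by
  rintro ⟨hxy, hyz⟩
  obtain ⟨D, hD0, hD⟩ := exists_pos_le_dist hAc (isCompact_singleton (x := y)) (by simpa using hy)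
  set δ := D / (C + 1) with hδ
  have hδ0 : 0 < δ := by positivity
  have hCδ : C * δ < D := by
    have : δ * (C + 1) = D := by rw [hδ]; field_simp
    linarith
  let := T
  have loc : ∀ a ∈ A, ∀ a' ∈ A, dist a a' < δ → a < y → a' < y := by
    intro a ha a' ha' haa hay
    by_contra! hcon
    have hlt : y < a' := lt_of_le_of_ne hcon fun e => hy (e ▸ ha')
    have h1 := h a y a' hay hlt
    have h2 := hD a ha y rfl
    nlinarith
  have := hA.eq_of_dist_lt hδ0 (f := fun a => a < y) (fun a ha a' ha' haa =>
    ⟨loc a ha a' ha' haa, loc a' ha' a ha (by rwa [dist_comm])⟩) hx hz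
  exact asymm hyz (this.1 hxy)

end LocalToGlobal

end

/-! ### Local geometry of metric graphs; snake bounds from topology -/

noncomputable section

namespace ConnectedMetricGraph

open Set

variable {V E : Type*} {G : ConnectedMetricGraph V E}

theorem dist_pt_le (e : E) {s t : ℝ} (hs : s ∈ Icc 0 (G.len e)) (ht : t ∈ Icc 0 (G.len e)) :
    dist (G.pt e s) (G.pt e t) ≤ |s - t| :=
  dist_le_of_route (.edge e hs ht)

theorem continuousOn_pt (e : E) : ContinuousOn (G.pt e) (Icc 0 (G.len e)) := by
  refine LipschitzOnWith.continuousOn (K := 1) (LipschitzOnWith.of_dist_le_mul fun s hs t ht => ?_)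
  rw [NNReal.coe_one, one_mul, Real.dist_eq]
  exact dist_pt_le e hs ht

theorem exists_eq_pt (p : G.Point) :
    (∃ v, p = .vertex v) ∨ ∃ e, ∃ t ∈ Ioo 0 (G.len e), p = G.pt e t := by
  rcases p with v | ⟨e, t, ht⟩
  · exact Or.inl ⟨v, rfl⟩
  · exact Or.inr ⟨e, t, ht, (pt_interior e t ht).symm⟩

theorem pt_ne_vertex (e : E) {t : ℝ} (ht : t ∈ Ioo 0 (G.len e)) (v : V) :
    G.pt e t ≠ .vertex v := by
  rw [pt_interior e t ht]
  exact fun h => nomatch h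

theorem pt_of_not_mem_Ioo (e : E) {t : ℝ} (h : t ∉ Ioo 0 (G.len e)) :
    ∃ v, G.pt e t = .vertex v := by
  unfold pt
  rw [dif_neg h]
  split_ifs
  · exact ⟨_, rfl⟩
  · exact ⟨_, rfl⟩

theorem eq_of_pt_eq {e e' : E} {t t' : ℝ} (ht : t ∈ Ioo 0 (G.len e))
    (h : G.pt e t = G.pt e' t') : e = e' ∧ t = t' := by
  by_cases ht' : t' ∈ Ioo 0 (G.len e')
  · rw [pt_interior e t ht, pt_interior e' t' ht'] at h
    injection h with h1 h2
    exact ⟨h1, h2⟩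
  · obtain ⟨v, hv⟩ := pt_of_not_mem_Ioo e' ht'
    exact absurd (h.trans hv) (pt_ne_vertex e ht v)

open scoped Classical in
/-- The position of a point on the circle obtained from the edge `e` by collapsing everything else
to a point. -/
def position (e : E) : G.Point → ℝ
  | .vertex _ => 0
  | .interior e' t _ => if e' = e then t else 0

theorem position_vertex (e : E) (v : V) : position e (.vertex v : G.Point) = 0 := rfl

theorem position_pt (e : E) {t : ℝ} (ht : t ∈ Ioo 0 (G.len e)) : position e (G.pt e t) = t := by
  rw [pt_interior e t ht]
  simp [position]

theorem position_pt_of_ne {e e' : E} (h : e' ≠ e) (t : ℝ) : position e (G.pt e' t) = 0 := by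
  by_cases ht : t ∈ Ioo 0 (G.len e')
  · rw [pt_interior e' t ht]
    simp [position, h]
  · obtain ⟨v, hv⟩ := pt_of_not_mem_Ioo e' ht
    rw [hv, position_vertex]

theorem position_mem (e : E) (p : G.Point) : position e p ∈ Ico 0 (G.len e) := by
  rcases exists_eq_pt p with ⟨v, rfl⟩ | ⟨e', t, ht, rfl⟩
  · exact ⟨le_rfl, G.len_pos e⟩
  · by_cases h : e' = e
    · subst h
      rw [position_pt e' ht]
      exact Ioo_subset_Ico_self ht
    · rw [position_pt_of_ne h]
      exact ⟨le_rfl, G.len_pos e⟩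

/-- Collapsing the complement of an edge to a point does not increase distances. -/
theorem min_position_le_dist (e : E) (p q : G.Point) :
    min |position e p - position e q| (G.len e - |position e p - position e q|) ≤ dist p q := by
  set a := position e p with ha
  obtain ⟨ha0, haL⟩ := position_mem e p
  rw [← ha] at ha0 haL
  -- The distance to `p` on the circle of length `len e`. It is 1-Lipschitz and takes the same value
  -- at both ends of the edge, so it extends by a constant to the rest of the graph.
  let c : ℝ → ℝ := fun s => min |a - s| (G.len e - |a - s|)
  have hc : ∀ s t : ℝ, |c s - c t| ≤ |s - t| := by
    intro s t
    have h1 : |(|a - s| - |a - t|)| ≤ |s - t| := by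
      refine (abs_abs_sub_abs_le_abs_sub _ _).trans (le_of_eq ?_)
      rw [sub_sub_sub_cancel_left, abs_sub_comm]
    refine (abs_min_sub_min_le_max _ _ _ _).trans (max_le h1 ?_)
    rw [sub_sub_sub_cancel_left, abs_sub_comm]
    exact h1
  have hcL : c 0 = c (G.len e) := by
    simp only [c]
    rw [sub_zero, abs_of_nonneg ha0, abs_of_nonpos (by linarith), min_comm]
    congr 1 <;> ring
  have hpt : ∀ s ∈ Icc 0 (G.len e), c (position e (G.pt e s)) = c s := by
    intro s hs
    rcases hs.1.eq_or_lt with rfl | h0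
    · rw [pt_zero, position_vertex]
    rcases hs.2.eq_or_lt with rfl | h1
    · rw [pt_len, position_vertex, hcL]
    · rw [position_pt e ⟨h0, h1⟩]
  have := abs_sub_le_dist (fun z => c (position e z)) (by
    intro e' s hs t ht
    by_cases h : e' = e
    · subst h
      simp only [hpt s hs, hpt t ht]
      exact hc s t
    · simp [position_pt_of_ne h]) p q
  refine le_trans ?_ this
  have h0 : c (position e p) = 0 := by
    simp only [c, ← ha, sub_self, abs_zero, sub_zero]
    exact min_eq_left (G.len_pos e).le
  rw [h0, zero_sub, abs_neg]
  exact le_abs_self _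

/-- After collapsing the rest of the graph to a point, everything outside the open edge sits at
position 0, too far from `t` to enter the ball. -/
theorem isOpen_image_pt (e : E) {a b : ℝ} (ha : 0 ≤ a) (hb : b ≤ G.len e) :
    IsOpen (G.pt e '' Ioo a b) := by
  rw [Metric.isOpen_iff]
  rintro _ ⟨t, ht, rfl⟩
  have ht' : t ∈ Ioo 0 (G.len e) := ⟨ha.trans_lt ht.1, ht.2.trans_le hb⟩
  refine ⟨min (t - a) (b - t), lt_min (by linarith [ht.1]) (by linarith [ht.2]), fun q hq => ?_⟩
  rw [Metric.mem_ball, dist_comm] at hq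
  have h1 := (min_position_le_dist e _ _).trans_lt hq
  have hra := min_le_left (t - a) (b - t)
  have hrb := min_le_right (t - a) (b - t)
  set ρ := min (t - a) (b - t)
  rw [position_pt e ht', min_lt_iff] at h1
  by_cases hq' : ∃ t' ∈ Ioo 0 (G.len e), q = G.pt e t'
  · obtain ⟨t', ht1, rfl⟩ := hq'
    rw [position_pt e ht1] at h1
    refine ⟨t', ?_, rfl⟩
    rcases abs_cases (t - t') with ⟨h2, h3⟩ | ⟨h2, h3⟩ <;> rw [h2] at h1 <;>
      rcases h1 with h1 | h1 <;> constructor <;> linarith [ht1.1, ht1.2, ht.1, ht.2]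
  · exfalso
    have h0 : position e q = 0 := by
      rcases exists_eq_pt q with ⟨v, rfl⟩ | ⟨e', t', ht1, rfl⟩
      · rfl
      · exact position_pt_of_ne (by rintro rfl; exact hq' ⟨t', ht1, rfl⟩) t'
    rw [h0, sub_zero, abs_of_pos ht'.1] at h1
    rcases h1 with h1 | h1 <;> linarith

theorem isSimpleCurve_pt (e : E) : IsSimpleCurve (fun t => G.pt e (t * G.len e)) := by
  have hL := G.len_pos e
  have hm : ∀ t ∈ Icc (0 : ℝ) 1, t * G.len e ∈ Icc 0 (G.len e) := fun t ht =>
    ⟨mul_nonneg ht.1 hL.le, by nlinarith [ht.2]⟩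
  refine ⟨(continuousOn_pt e).comp (by fun_prop) hm, fun s hs t ht hst he => ?_⟩
  have hne : s * G.len e ≠ t * G.len e := fun h => hst.ne (mul_right_cancel₀ hL.ne' h)
  constructor
  · by_contra hs0
    have : s * G.len e ∈ Ioo 0 (G.len e) :=
      ⟨mul_pos (lt_of_le_of_ne hs.1 (Ne.symm hs0)) hL, by nlinarith [ht.2]⟩
    exact hne (eq_of_pt_eq this he).2
  · by_contra ht1
    have : t * G.len e ∈ Ioo 0 (G.len e) :=
      ⟨mul_pos (by linarith [hs.1]) hL, by nlinarith [lt_of_le_of_ne ht.2 ht1]⟩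
    exact hne (eq_of_pt_eq this he.symm).2.symm

theorem image_pt_mul (e : E) :
    (fun t => G.pt e (t * G.len e)) '' Icc 0 1 = G.pt e '' Icc 0 (G.len e) := by
  have hL := G.len_pos e
  ext x
  constructor
  · rintro ⟨t, ht, rfl⟩
    exact ⟨_, ⟨mul_nonneg ht.1 hL.le, by nlinarith [ht.2]⟩, rfl⟩
  · rintro ⟨t, ht, rfl⟩
    exact ⟨t / G.len e, ⟨div_nonneg ht.1 hL.le, (div_le_one hL).2 ht.2⟩, by
      simp only [div_mul_cancel₀ _ hL.ne']⟩

theorem isCompact_univ [Finite V] [Finite E] : IsCompact (univ : Set G.Point) := by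
  have h : (univ : Set G.Point) =
      (⋃ e, G.pt e '' Icc 0 (G.len e)) ∪ range (Point.vertex : V → G.Point) := by
    refine (eq_univ_of_forall fun p => ?_).symm
    rcases exists_eq_pt p with ⟨v, rfl⟩ | ⟨e, t, ht, rfl⟩
    · exact Or.inr ⟨v, rfl⟩
    · exact Or.inl (mem_iUnion.2 ⟨e, t, Ioo_subset_Icc_self ht, rfl⟩)
  rw [h]
  exact (isCompact_iUnion fun e => isCompact_Icc.image_of_continuousOn (continuousOn_pt e)).union
    (finite_range _).isCompact

/-- This is where the path metric matters: a short route is itself a connected compact set staying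
near its starting point. -/
theorem Route.exists_continuum {p q : G.Point} {r : ℝ} (h : G.Route p q r) :
    ∃ A : Set G.Point, IsCompact A ∧ IsPreconnected A ∧ p ∈ A ∧ q ∈ A ∧ ∀ z ∈ A, dist p z ≤ r := by
  induction h with
  | nil p => exact ⟨{p}, isCompact_singleton, isPreconnected_singleton, rfl, rfl, by simp⟩
  | cons e s t hs ht q r h ih =>
    obtain ⟨A, hAc, hA, htA, hqA, hAr⟩ := ih
    have hr := h.nonneg
    have hsub : uIcc s t ⊆ Icc 0 (G.len e) := uIcc_subset_Icc hs ht
    have hcont := (continuousOn_pt e).mono hsub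
    refine ⟨G.pt e '' uIcc s t ∪ A, (isCompact_uIcc.image_of_continuousOn hcont).union hAc,
      IsPreconnected.union (G.pt e t) ⟨t, right_mem_uIcc, rfl⟩ htA
        (isPreconnected_uIcc.image _ hcont) hA, Or.inl ⟨s, left_mem_uIcc, rfl⟩, Or.inr hqA, ?_⟩
    rintro z (⟨x, hx, rfl⟩ | hz)
    · have h1 := dist_pt_le e hs (hsub hx)
      have h2 : |s - x| ≤ |s - t| := by
        rw [abs_sub_comm s x, abs_sub_comm s t]
        exact abs_sub_left_of_mem_uIcc hx
      linarith
    · exact (dist_triangle _ (G.pt e t) _).trans (add_le_add (dist_pt_le e hs ht) (hAr z hz))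

theorem exists_continuum {p q : G.Point} {w : ℝ} (h : dist p q < w) :
    ∃ A : Set G.Point, IsCompact A ∧ IsPreconnected A ∧ p ∈ A ∧ q ∈ A ∧ ∀ z ∈ A, dist p z ≤ w := by
  rw [dist_def] at h
  obtain ⟨r, hr, hrw⟩ := exists_lt_of_csInf_lt (exists_route p q) h
  obtain ⟨A, h1, h2, h3, h4, h5⟩ := Route.exists_continuum hr
  exact ⟨A, h1, h2, h3, h4, fun z hz => (h5 z hz).trans hrw.le⟩

/-- The small continua joining `x 0, x 2` and `x 1, x 3` must meet, and a common point is within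
about `w` of both `x 0` and `x 1`. The margin `η` is due to the distance being an infimum. -/
theorem snakeBound_of_noncrossing [Finite E] {T : LinearOrder G.Point}
    (h : Noncrossing T.lt univ) : SnakeBound T 3 2 := by
  intro x hx w hw
  refine le_of_forall_pos_le_add fun η hη => ?_
  obtain ⟨A, hAc, hA, h0, h2, hAw⟩ := exists_continuum
    (show dist (x 0) (x 2) < w + η / 2 by linarith [hw 0 (by norm_num)])
  obtain ⟨B, hBc, hB, h1, h3, hBw⟩ := exists_continuum
    (show dist (x 1) (x 3) < w + η / 2 by linarith [hw 1 (by norm_num)])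
  by_cases hAB : Disjoint A B
  · exact (h A B hAc hA (subset_univ _) hBc hB (subset_univ _) hAB _ h0 _ h1 _ h2 _ h3
      (hx 0 (by norm_num)) (hx 1 (by norm_num)) (hx 2 (by norm_num))).elim
  · obtain ⟨z, hzA, hzB⟩ := not_disjoint_iff.1 hAB
    have := dist_triangle_right (x 0) (x 1) z
    linarith [hAw z hzA, hBw z hzB]

/-- In the order of the interval, a continuum joining `x 0` and `x 2` contains everything in
between, in particular `x 1`. -/
theorem exists_snakeBound_of_homeomorph [Finite E] (h : G.Point ≃ₜ unitInterval) :
    ∃ T : LinearOrder G.Point, SnakeBound T 2 1 := by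
  let T : LinearOrder G.Point := LinearOrder.lift' h h.injective
  refine ⟨T, fun x hx w hw => le_of_forall_pos_le_add fun η hη => ?_⟩
  obtain ⟨A, -, hA, h0, h2, hAw⟩ := exists_continuum
    (show dist (x 0) (x 2) < w + η by linarith [hw 0 (by norm_num)])
  have hO := (hA.image h h.continuous.continuousOn).ordConnected
  have h01 : h (x 0) < h (x 1) := hx 0 (by norm_num)
  have h12 : h (x 1) < h (x 2) := hx 1 (by norm_num)
  obtain ⟨z, hz, he⟩ := hO.out ⟨x 0, h0, rfl⟩ ⟨x 2, h2, rfl⟩ ⟨h01.le, h12.le⟩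
  rw [h.injective he] at hz
  linarith [hAw _ hz]

end ConnectedMetricGraph

end

/-! ### Exhausting a theta-free graph by cactus subgraphs -/

noncomputable section

namespace ConnectedMetricGraph

open Set

variable {V E : Type*} {G : ConnectedMetricGraph V E}

/-- A set of points of a metric graph which contains every closed edge that it meets in an interior
point. -/
def IsSubgraph (S : Set G.Point) : Prop :=
  ∀ e, ∀ t ∈ Ioo 0 (G.len e), G.pt e t ∈ S → ∀ t' ∈ Icc 0 (G.len e), G.pt e t' ∈ S

theorem IsSubgraph.union {S S' : Set G.Point} (h : IsSubgraph S) (h' : IsSubgraph S') :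
    IsSubgraph (S ∪ S') := fun e t ht hS t' ht' =>
  hS.imp (fun hS => h e t ht hS t' ht') (fun hS => h' e t ht hS t' ht')

theorem isSubgraph_edge (e : E) : IsSubgraph (G.pt e '' Icc 0 (G.len e)) := by
  rintro e' t ht ⟨s, -, he⟩ t' ht'
  obtain ⟨rfl, -⟩ := eq_of_pt_eq ht he.symm
  exact ⟨t', ht', rfl⟩

/-- An arc that enters an edge and misses one of its points would have to enter and leave through
the same end, against injectivity. -/
theorem isSubgraph_of_isArc [Finite E] {η : ℝ → G.Point} (hη : IsArc η) {u v : V}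
    (h0 : η 0 = .vertex u) (h1 : η 1 = .vertex v) : IsSubgraph (η '' Icc 0 1) := by
  intro e s hs hsA s' hs'
  by_contra hcon
  have hηs := hη.isSimpleCurve
  obtain ⟨t₀, ht₀, he₀⟩ := hsA
  -- The interval from `a` to `b` reaches from the missed point to an end `c` of the edge. Both the
  -- part of the arc before `t₀` and the part after it must pass through `G.pt e c`.
  have key : ∀ a b c : ℝ, 0 ≤ a → b ≤ G.len e → s ∈ Ioo a b →
      (∀ x ∈ Icc a b, x ∉ Ioo a b → G.pt e x ∈ η '' Icc 0 1 → G.pt e x = G.pt e c) →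
      c ∉ Ioo 0 (G.len e) → False := by
    intro a b c ha hb hsab hx hc
    have hK1 : IsClosed (G.pt e '' Icc a b) :=
      (isCompact_Icc.image_of_continuousOn
        ((continuousOn_pt e).mono (Icc_subset_Icc ha hb))).isClosed
    have hK2 := (isOpen_image_pt (G := G) e ha hb).isClosed_compl
    have hvert : ∀ v : V, (.vertex v : G.Point) ∈ (G.pt e '' Ioo a b)ᶜ := by
      rintro v ⟨x, hx, he⟩
      exact pt_ne_vertex e ⟨ha.trans_lt hx.1, hx.2.trans_le hb⟩ v he
    have meet : ∀ x y : ℝ, 0 ≤ x → y ≤ 1 → t₀ ∈ Icc x y → (∃ z ∈ Icc x y, ∃ v, η z = .vertex v) →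
        ∃ z ∈ Icc x y, η z = G.pt e c := by
      rintro x y hx0 hy1 hxy ⟨z, hz, v, hv⟩
      obtain ⟨_, ⟨z', hz', rfl⟩, ⟨k, hk, hke⟩, hnot⟩ :=
        isPreconnected_closed_iff.1 (hηs.isPreconnected_image hx0 hy1) _ _ hK1 hK2
          (by
            intro p _
            by_cases hp : p ∈ G.pt e '' Ioo a b
            · exact Or.inl (image_mono Ioo_subset_Icc_self hp)
            · exact Or.inr hp)
          ⟨η t₀, ⟨t₀, hxy, rfl⟩, s, Ioo_subset_Icc_self hsab, he₀.symm⟩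
          ⟨η z, ⟨z, hz, rfl⟩, by rw [hv]; exact hvert v⟩
      refine ⟨z', hz', ?_⟩
      rw [← hke]
      refine hx k hk (fun hk' => hnot ⟨k, hk', hke⟩) ?_
      rw [hke]
      exact ⟨z', ⟨hx0.trans hz'.1, hz'.2.trans hy1⟩, rfl⟩
    obtain ⟨t₁, ht₁, he₁⟩ := meet 0 t₀ le_rfl ht₀.2 ⟨ht₀.1, le_rfl⟩ ⟨0, ⟨le_rfl, ht₀.1⟩, u, h0⟩
    obtain ⟨t₂, ht₂, he₂⟩ := meet t₀ 1 ht₀.1 le_rfl ⟨le_rfl, ht₀.2⟩ ⟨1, ⟨ht₀.2, le_rfl⟩, v, h1⟩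
    have h12 := hη.injOn ⟨ht₁.1, ht₁.2.trans ht₀.2⟩ ⟨ht₀.1.trans ht₂.1, ht₂.2⟩
      (he₁.trans he₂.symm)
    have h10 : t₁ = t₀ := le_antisymm ht₁.2 (h12 ▸ ht₂.1)
    rw [h10, he₀] at he₁
    exact hc ((eq_of_pt_eq hs he₁).2 ▸ hs)
  rcases lt_trichotomy s s' with h | h | h
  · refine key 0 s' 0 le_rfl hs'.2 ⟨hs.1, h⟩ (fun x hx hx' hxA => ?_) (by simp)
    rcases hx.1.eq_or_lt with rfl | hx0
    · rfl
    · exact absurd (le_antisymm hx.2 (not_lt.1 fun h => hx' ⟨hx0, h⟩) ▸ hxA) hcon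
  · subst h
    exact hcon ⟨t₀, ht₀, he₀⟩
  · refine key s' (G.len e) (G.len e) hs'.1 le_rfl ⟨h, hs.2⟩ (fun x hx hx' hxA => ?_) (by simp)
    rcases hx.2.eq_or_lt with rfl | hx0
    · rfl
    · exact absurd (le_antisymm (not_lt.1 fun h => hx' ⟨h, hx0⟩) hx.1 ▸ hxA) hcon

theorem exists_vertex_mem {S : Set G.Point} (hS : IsSubgraph S) (hne : S.Nonempty) :
    ∃ v, (.vertex v : G.Point) ∈ S := by
  obtain ⟨p, hp⟩ := hne
  rcases exists_eq_pt p with ⟨v, rfl⟩ | ⟨e, t, ht, rfl⟩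
  · exact ⟨v, hp⟩
  · refine ⟨G.src e, ?_⟩
    rw [← pt_zero]
    exact hS e t ht hp 0 ⟨le_rfl, (G.len_pos e).le⟩

/-- Otherwise no edge leads out of the vertices of `S`; by connectedness of the graph `S` has all
vertices, and then all edges. -/
theorem exists_edge_of_ne_univ {S : Set G.Point} (hS : IsSubgraph S) (hne : S.Nonempty)
    (huniv : S ≠ univ) : ∃ e, (∀ t ∈ Ioo 0 (G.len e), G.pt e t ∉ S) ∧
      ((.vertex (G.src e) : G.Point) ∈ S ∨ (.vertex (G.tgt e) : G.Point) ∈ S) := by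
  have hends : ∀ e, ∀ t ∈ Ioo 0 (G.len e), G.pt e t ∈ S →
      (.vertex (G.src e) : G.Point) ∈ S ∧ (.vertex (G.tgt e) : G.Point) ∈ S := by
    intro e t ht htS
    rw [← pt_zero, ← pt_len]
    exact ⟨hS e t ht htS 0 ⟨le_rfl, (G.len_pos e).le⟩,
      hS e t ht htS _ ⟨(G.len_pos e).le, le_rfl⟩⟩
  obtain ⟨v, hv⟩ := exists_vertex_mem hS hne
  by_contra! hcon
  have hall : ∀ w, (.vertex w : G.Point) ∈ S := by
    intro w
    induction G.connected v w with
    | refl => exact hv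
    | tail _ h ih =>
      obtain ⟨e, ⟨rfl, rfl⟩ | ⟨rfl, rfl⟩⟩ := h
      · by_contra hc
        exact (hcon e fun t ht htS => hc (hends e t ht htS).2).1 ih
      · by_contra hc
        exact (hcon e fun t ht htS => hc (hends e t ht htS).1).2 ih
  refine huniv (eq_univ_of_forall fun p => ?_)
  rcases exists_eq_pt p with ⟨v, rfl⟩ | ⟨e, t, ht, rfl⟩
  · exact hall v
  · by_contra hc
    exact (hcon e fun t' ht' htS => hc (hS e t' ht' htS t (Ioo_subset_Icc_self ht))).1 (hall _)

/-- The parametrization of an edge, from a prescribed end. -/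
theorem exists_edge_curve {S : Set G.Point} {e : E}
    (hend : (.vertex (G.src e) : G.Point) ∈ S ∨ (.vertex (G.tgt e) : G.Point) ∈ S) :
    ∃ ε : ℝ → G.Point, IsSimpleCurve ε ∧ ε '' Icc 0 1 = G.pt e '' Icc 0 (G.len e) ∧ ε 0 ∈ S ∧
      (∀ t ∈ Ioo (0 : ℝ) 1, ε t ∈ G.pt e '' Ioo 0 (G.len e)) ∧ (∃ u, ε 0 = .vertex u) ∧
      ∃ v, ε 1 = .vertex v := by
  have hL := G.len_pos e
  have hint : ∀ t ∈ Ioo (0 : ℝ) 1, t * G.len e ∈ Ioo 0 (G.len e) := fun t ht =>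
    ⟨mul_pos ht.1 hL, by nlinarith [ht.2]⟩
  rcases hend with h | h
  · refine ⟨_, isSimpleCurve_pt e, image_pt_mul e, ?_, fun t ht => ⟨_, hint t ht, rfl⟩,
      ⟨G.src e, ?_⟩, G.tgt e, ?_⟩
    · simpa [pt_zero] using h
    · simp [pt_zero]
    · simp [pt_len]
  · refine ⟨_, (isSimpleCurve_pt e).reverse, (image_reverse _).trans (image_pt_mul e), ?_,
      fun t ht => ⟨_, hint (1 - t) ⟨by linarith [ht.2], by linarith [ht.1]⟩, rfl⟩,
      ⟨G.tgt e, ?_⟩, G.src e, ?_⟩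
    · simpa [pt_len] using h
    · simp [pt_len]
    · simp [pt_zero]

/-- A new edge touching `S` is attached alone if it is a loop or if no arc outside `S` and the edge
leads from its far end back to its near end. Otherwise the cycle formed with such an arc is
attached. A cycle has no ears by `Noncrossing.not_ear`; an ear of a lone non-loop edge would be just
such a return arc. The midpoint of the edge witnesses progress. -/
theorem exists_larger_cactusSet [Finite E] {r : G.Point → G.Point → Prop}
    [IsStrictTotalOrder G.Point r] (hr : Noncrossing r univ) {S : Set G.Point}
    (hS : IsCactusSet S) (hsub : IsSubgraph S) (hsat : Saturated S) (hne : S.Nonempty)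
    (huniv : S ≠ univ) : ∃ S' : Set G.Point, IsCactusSet S' ∧ IsSubgraph S' ∧ Saturated S' ∧
      S ⊆ S' ∧ ∃ e, G.pt e (G.len e / 2) ∈ S' ∧ G.pt e (G.len e / 2) ∉ S := by
  obtain ⟨e, he, hend⟩ := exists_edge_of_ne_univ hsub hne huniv
  obtain ⟨ε, hε, him, h0S, hint, ⟨u, hu⟩, v, hv⟩ := exists_edge_curve hend
  have hhalf : G.len e / 2 ∈ Ioo 0 (G.len e) := by
    have := G.len_pos e
    constructor <;> linarith
  have hnotS : ∀ t ∈ Ioo (0 : ℝ) 1, ε t ∉ S := by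
    intro t ht hS
    obtain ⟨s, hs, hse⟩ := hint t ht
    exact he s hs (hse ▸ hS)
  have hmid : G.pt e (G.len e / 2) ∈ ε '' Icc 0 1 := by
    rw [him]; exact ⟨_, Ioo_subset_Icc_self hhalf, rfl⟩
  have hedge : IsSubgraph (ε '' Icc 0 1) := by rw [him]; exact isSubgraph_edge e
  have h0M : ε 0 ∈ ε '' Icc 0 1 := ⟨0, by simp, rfl⟩
  -- it suffices to find the curve to be attached
  suffices h : ∃ γ : ℝ → G.Point, IsSimpleCurve γ ∧ γ 0 = ε 0 ∧ ε '' Icc 0 1 ⊆ γ '' Icc 0 1 ∧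
      IsSubgraph (γ '' Icc 0 1) ∧ S ∩ γ '' Icc 0 1 ⊆ {γ 0} ∧
      ∀ η : ℝ → G.Point, IsArc η → η 0 ∈ γ '' Icc 0 1 → η 1 ∈ γ '' Icc 0 1 →
        (∀ t ∈ Ioo (0 : ℝ) 1, η t ∉ S ∪ γ '' Icc 0 1) → False by
    obtain ⟨γ, hγ, hγ0, hεγ, hγs, hγS, hear⟩ := h
    have hinter : S ∩ γ '' Icc 0 1 = {γ 0} :=
      Subset.antisymm hγS (singleton_subset_iff.2 ⟨hγ0 ▸ h0S, 0, by simp, rfl⟩)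
    exact ⟨_, hS.attach γ hγ hinter, hsub.union hγs, hsat.union hγ hinter hear,
      subset_union_left, e, Or.inr (hεγ hmid), he _ hhalf⟩
  by_cases h01 : ε 0 = ε 1
  · refine ⟨ε, hε, rfl, Subset.rfl, hedge, ?_, fun η hη h0 h1 h => ?_⟩
    · rintro _ ⟨hxS, t, ht, rfl⟩
      rcases ht.1.eq_or_lt with rfl | ht0
      · rfl
      rcases ht.2.eq_or_lt with rfl | ht1
      · exact h01.symm
      · exact absurd hxS (hnotS t ⟨ht0, ht1⟩)
    · exact hr.not_ear hε h01 hη h0 h1 fun t ht h' => h t ht (Or.inr h')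
  have hεa := hε.isArc h01
  -- Otherwise the edge itself would be an ear of `S`.
  have h1S : ε 1 ∉ S := fun h1 => hsat ε hεa h0S h1 hnotS
  have hεS : S ∩ ε '' Icc 0 1 ⊆ {ε 0} := by
    rintro _ ⟨hxS, t, ht, rfl⟩
    rcases ht.1.eq_or_lt with rfl | ht0
    · rfl
    rcases ht.2.eq_or_lt with rfl | ht1
    · exact absurd hxS h1S
    · exact absurd hxS (hnotS t ⟨ht0, ht1⟩)
  by_cases hret : ∃ η : ℝ → G.Point, IsArc η ∧ η 0 = ε 1 ∧ η 1 = ε 0 ∧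
      ∀ t ∈ Ioo (0 : ℝ) 1, η t ∉ S ∪ ε '' Icc 0 1
  · obtain ⟨η, hη, h0, h1, havoid⟩ := hret
    have hsc := hεa.concat hη h0.symm (by
      intro s hs t ht heq
      rcases ht.1.eq_or_lt with rfl | ht0
      · exact Or.inl ⟨hεa.injOn hs (by simp) (heq.trans h0), rfl⟩
      rcases ht.2.eq_or_lt with rfl | ht1
      · exact Or.inr ⟨hεa.injOn hs (by simp) (heq.trans h1), rfl⟩
      · exact absurd (Or.inr ⟨s, hs, heq⟩) (havoid t ⟨ht0, ht1⟩))
    have hc0 : concat ε η 0 = ε 0 := concat_zero _ _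
    have hcim := image_concat ε η h0.symm
    refine ⟨concat ε η, hsc, hc0, ?_, ?_, ?_, fun ζ hζ hζ0 hζ1 h => ?_⟩
    · rw [hcim]; exact subset_union_left
    · rw [hcim]
      exact hedge.union (isSubgraph_of_isArc hη (h0.trans hv) (h1.trans hu))
    · rw [hcim, hc0, inter_union_distrib_left]
      refine union_subset hεS ?_
      rintro _ ⟨hxS, t, ht, rfl⟩
      rcases ht.1.eq_or_lt with rfl | ht0
      · exact absurd (h0 ▸ hxS) h1S
      rcases ht.2.eq_or_lt with rfl | ht1
      · exact h1
      · exact absurd (Or.inl hxS) (havoid t ⟨ht0, ht1⟩)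
    · exact hr.not_ear hsc (by rw [hc0, concat_one, h1]) hζ hζ0 hζ1
        fun t ht h' => h t ht (Or.inr h')
  · refine ⟨ε, hε, rfl, Subset.rfl, hedge, hεS, fun η hη h0 h1 h => hret ?_⟩
    -- an ear cannot start in the interior of the edge
    have hends : ∀ η : ℝ → G.Point, IsArc η → η 0 ∈ ε '' Icc 0 1 →
        (∀ t ∈ Ioo (0 : ℝ) 1, η t ∉ S ∪ ε '' Icc 0 1) → η 0 = ε 0 ∨ η 0 = ε 1 := by
      rintro η hη ⟨t, ht, hte⟩ h
      rcases ht.1.eq_or_lt with rfl | ht0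
      · exact Or.inl hte.symm
      rcases ht.2.eq_or_lt with rfl | ht1
      · exact Or.inr hte.symm
      exfalso
      have hmem : η 0 ∈ G.pt e '' Ioo 0 (G.len e) := hte ▸ hint t ⟨ht0, ht1⟩
      have hnhds := (isOpen_image_pt e le_rfl le_rfl).mem_nhds hmem
      have hc := hη.continuousOn 0 (by simp)
      have hev := hc.preimage_mem_nhdsWithin hnhds
      rw [mem_nhdsWithin_iff_exists_mem_nhds_inter] at hev
      obtain ⟨U, hU, hUs⟩ := hev
      obtain ⟨δ, hδ, hball⟩ := Metric.mem_nhds_iff.1 hU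
      have hmin : 0 < min (δ / 2) (1 / 2) := lt_min (by linarith) (by norm_num)
      have hm1 := min_le_left (δ / 2) (1 / 2)
      have hm2 := min_le_right (δ / 2) (1 / 2)
      have hmU : min (δ / 2) (1 / 2) ∈ U := hball (by
        rw [Metric.mem_ball, Real.dist_eq, sub_zero, abs_of_pos hmin]; linarith)
      have := hUs ⟨hmU, hmin.le, by linarith⟩
      refine h (min (δ / 2) (1 / 2)) ⟨hmin, by linarith⟩ (Or.inr ?_)
      rw [him]
      exact image_mono Ioo_subset_Icc_self this
    have hrev : ∀ t ∈ Ioo (0 : ℝ) 1, η (1 - t) ∉ S ∪ ε '' Icc 0 1 := fun t ht =>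
      h _ ⟨by linarith [ht.2], by linarith [ht.1]⟩
    have e0 := hends η hη h0 h
    have e1 := hends _ hη.reverse (by simpa using h1) hrev
    simp only [sub_zero] at e1
    rcases e0 with e0 | e0 <;> rcases e1 with e1 | e1
    · exact absurd (e0.trans e1.symm) hη.ne
    · exact ⟨_, hη.reverse, by simpa using e1, by simpa using e0, hrev⟩
    · exact ⟨η, hη, e0, e1, h⟩
    · exact absurd (e0.trans e1.symm) hη.ne

/-- Induction on the number of edges whose midpoint is missing, starting from one vertex, which is
saturated because the ends of an arc are distinct. -/
theorem isCactusSet_univ_of_noncrossing [Finite E] [Nonempty V] {r : G.Point → G.Point → Prop}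
    [IsStrictTotalOrder G.Point r] (hr : Noncrossing r univ) :
    IsCactusSet (univ : Set G.Point) := by
  have grow : ∀ n : ℕ, ∀ S : Set G.Point, IsCactusSet S → IsSubgraph S → Saturated S →
      S.Nonempty → {e | G.pt e (G.len e / 2) ∉ S}.ncard = n →
      IsCactusSet (univ : Set G.Point) := by
    intro n
    induction n using Nat.strong_induction_on with
    | _ n ih =>
      intro S hS hsub hsat hne hn
      by_cases huniv : S = univ
      · exact huniv ▸ hS
      obtain ⟨S', hS', hsub', hsat', hSS', e, he', he⟩ :=
        exists_larger_cactusSet hr hS hsub hsat hne huniv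
      refine ih _ ?_ S' hS' hsub' hsat' (hne.mono hSS') rfl
      rw [← hn]
      refine ncard_lt_ncard ?_ (toFinite _)
      exact ⟨fun e' h h' => h (hSS' h'), fun h => h he he'⟩
  obtain ⟨v⟩ := ‹Nonempty V›
  refine grow _ {.vertex v} (.point _) ?_ ?_ (singleton_nonempty _) rfl
  · intro e t ht h
    exact absurd h (pt_ne_vertex e ht v)
  · intro η hη h0 h1 _
    exact hη.ne (h0.trans h1.symm)

end ConnectedMetricGraph

end

/-! ### Recognizing the interval -/

noncomputable section

section Intervals

open Set

variable {X : Type*} [TopologicalSpace X]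

/-- If no point lies between two points of a continuum which avoids it, then the space has no three
points each of which is avoided by a continuum joining the other two. -/
theorem not_tripod {r : X → X → Prop} [IsStrictTotalOrder X r]
    (hr : ∀ A : Set X, IsCompact A → IsPreconnected A → ∀ x ∈ A, ∀ z ∈ A, ∀ y ∉ A,
      ¬ (r x y ∧ r y z)) {a b c : X} {A B C : Set X} (hA : IsCompact A) (hA' : IsPreconnected A)
    (hB : IsCompact B) (hB' : IsPreconnected B) (hC : IsCompact C) (hC' : IsPreconnected C)
    (haB : a ∈ B) (haC : a ∈ C) (hbA : b ∈ A) (hbC : b ∈ C) (hcA : c ∈ A) (hcB : c ∈ B)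
    (haA : a ∉ A) (hbB : b ∉ B) (hcC : c ∉ C) : False := by
  have tri : ∀ x y, x ≠ y → r x y ∨ r y x := fun x y h => by
    by_contra! hcon
    exact h (Std.Trichotomous.trichotomous (r := r) _ _ hcon.1 hcon.2)
  have h1 := tri a b fun h => haA (h ▸ hbA)
  have h2 := tri a c fun h => haA (h ▸ hcA)
  have h3 := tri b c fun h => hbB (h ▸ hcB)
  have a1 := hr A hA hA' b hbA c hcA a haA
  have a2 := hr A hA hA' c hcA b hbA a haA
  have b1 := hr B hB hB' a haB c hcB b hbB
  have b2 := hr B hB hB' c hcB a haB b hbB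
  have c1 := hr C hC hC' a haC b hbC c hcC
  have c2 := hr C hC hC' b hbC a haC c hcC
  tauto

/-- A circle contains a forbidden triple, namely the points cutting it into thirds. An arc attached
to an arc extends it if attached at an end, and otherwise forms a tripod. -/
theorem IsCactusSet.eq_singleton_or_arc {r : X → X → Prop} [IsStrictTotalOrder X r]
    (hr : ∀ A : Set X, IsCompact A → IsPreconnected A → ∀ x ∈ A, ∀ z ∈ A, ∀ y ∉ A,
      ¬ (r x y ∧ r y z)) {S : Set X} (hS : IsCactusSet S) :
    (∃ p, S = {p}) ∨ ∃ δ : ℝ → X, IsArc δ ∧ δ '' Icc 0 1 = S := by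
  induction hS with
  | point p => exact Or.inl ⟨p, rfl⟩
  | @attach S γ hS hγ hu ih =>
    right
    have hmemM : ∀ t ∈ Icc (0 : ℝ) 1, γ t ∈ γ '' Icc 0 1 := fun t ht => ⟨t, ht, rfl⟩
    by_cases h01 : γ 0 = γ 1
    · exfalso
      have hne : ∀ s t, s ∈ Icc (0 : ℝ) (2 / 3) → t ∈ Icc (0 : ℝ) 1 → s < t ∧ 0 < s ∨ t < s ∨
          s < t ∧ t < 1 → γ s ≠ γ t := by
        intro s t hs ht h he
        rcases hγ.eq_or ⟨hs.1, by linarith [hs.2]⟩ ht he with h' | ⟨h', h''⟩ | ⟨h', h''⟩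
        · subst h'
          rcases h with h | h | h <;> linarith
        · rcases h with h | h | h <;> linarith
        · linarith [hs.2]
      refine not_tripod hr (a := γ 0) (b := γ (1 / 3)) (c := γ (2 / 3))
        (A := γ '' Icc (1 / 3) (2 / 3)) (B := γ '' Icc (2 / 3) 1) (C := γ '' Icc 0 (1 / 3))
        (hγ.isCompact_image (by norm_num) (by norm_num))
        (hγ.isPreconnected_image (by norm_num) (by norm_num))
        (hγ.isCompact_image (by norm_num) (by norm_num))
        (hγ.isPreconnected_image (by norm_num) (by norm_num))
        (hγ.isCompact_image (by norm_num) (by norm_num))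
        (hγ.isPreconnected_image (by norm_num) (by norm_num))
        ⟨1, by norm_num, h01.symm⟩ ⟨0, by norm_num, rfl⟩ ⟨1 / 3, by norm_num, rfl⟩
        ⟨1 / 3, by norm_num, rfl⟩ ⟨2 / 3, by norm_num, rfl⟩ ⟨2 / 3, by norm_num, rfl⟩ ?_ ?_ ?_
      · rintro ⟨t, ht, he⟩
        exact hne 0 t (by norm_num) ⟨by linarith [ht.1], by linarith [ht.2]⟩
          (Or.inr (Or.inr ⟨by linarith [ht.1], by linarith [ht.2]⟩)) he.symm
      · rintro ⟨t, ht, he⟩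
        exact hne (1 / 3) t (by norm_num) ⟨by linarith [ht.1], by linarith [ht.2]⟩
          (Or.inl ⟨by linarith [ht.1], by norm_num⟩) he.symm
      · rintro ⟨t, ht, he⟩
        exact hne (2 / 3) t (by norm_num) ⟨by linarith [ht.1], by linarith [ht.2]⟩
          (Or.inr (Or.inl (by linarith [ht.2]))) he.symm
    have hγa := hγ.isArc h01
    rcases ih with ⟨p, rfl⟩ | ⟨δ, hδ, rfl⟩
    · refine ⟨γ, hγa, (union_eq_right.2 (singleton_subset_iff.2 ?_)).symm⟩
      have hp := (hu.ge rfl).1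
      rw [mem_singleton_iff] at hp
      exact hp ▸ hmemM 0 (by simp)
    have hδs := hδ.isSimpleCurve
    have meet : ∀ s ∈ Icc (0 : ℝ) 1, ∀ t ∈ Icc (0 : ℝ) 1, δ s = γ t → t = 0 ∧ δ s = γ 0 := by
      intro s hs t ht he
      have : δ s = γ 0 := hu.le ⟨⟨s, hs, rfl⟩, he ▸ hmemM t ht⟩
      exact ⟨hγa.injOn ht (by simp) (he.symm.trans this), this⟩
    obtain ⟨s, hs, hsγ⟩ := (hu.ge rfl).1
    rcases hs.1.eq_or_lt with rfl | hs0
    · have hsc := hδ.reverse.concat hγa (by simpa using hsγ) (by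
        intro a ha t ht he
        obtain ⟨h1, h2⟩ := meet (1 - a) ⟨by linarith [ha.2], by linarith [ha.1]⟩ t ht he
        have := hδ.injOn ⟨by linarith [ha.2], by linarith [ha.1]⟩ (by simp) (h2.trans hsγ.symm)
        exact Or.inl ⟨by linarith, h1⟩)
      refine ⟨_, hsc.isArc ?_, ?_⟩
      · rw [concat_zero, concat_one]
        intro h
        simp only [sub_zero] at h
        exact zero_ne_one (meet 1 (by simp) 1 (by simp) h).1.symm
      · rw [image_concat _ _ (by simpa using hsγ), image_reverse]
    rcases hs.2.eq_or_lt with rfl | hs1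
    · have hsc := hδ.concat hγa hsγ (by
        intro a ha t ht he
        obtain ⟨h1, h2⟩ := meet a ha t ht he
        exact Or.inl ⟨hδ.injOn ha (by simp) (h2.trans hsγ.symm), h1⟩)
      refine ⟨_, hsc.isArc ?_, ?_⟩
      · rw [concat_zero, concat_one]
        intro h
        exact zero_ne_one (meet 0 (by simp) 1 (by simp) h).1.symm
      · rw [image_concat _ _ hsγ]
    -- `γ 0` is now an inner point of `δ`. The ends of the three legs form the forbidden triple: the
    -- union of two legs joins their ends and avoids the third end.
    exfalso
    have hMc := hγ.isCompact_image le_rfl le_rfl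
    have hMp := hγ.isPreconnected_image le_rfl le_rfl
    refine not_tripod hr (a := δ 0) (b := δ 1) (c := γ 1) (A := δ '' Icc s 1 ∪ γ '' Icc 0 1)
      (B := δ '' Icc 0 s ∪ γ '' Icc 0 1) (C := δ '' Icc 0 1)
      ((hδs.isCompact_image hs.1 le_rfl).union hMc)
      (IsPreconnected.union (γ 0) ⟨s, ⟨le_rfl, hs.2⟩, hsγ⟩ (hmemM 0 (by simp))
        (hδs.isPreconnected_image hs.1 le_rfl) hMp)
      ((hδs.isCompact_image le_rfl hs.2).union hMc)
      (IsPreconnected.union (γ 0) ⟨s, ⟨hs.1, le_rfl⟩, hsγ⟩ (hmemM 0 (by simp))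
        (hδs.isPreconnected_image le_rfl hs.2) hMp)
      (hδs.isCompact_image le_rfl le_rfl) (hδs.isPreconnected_image le_rfl le_rfl)
      (Or.inl ⟨0, ⟨le_rfl, hs.1⟩, rfl⟩) ⟨0, by simp, rfl⟩ (Or.inl ⟨1, ⟨hs.2, le_rfl⟩, rfl⟩)
      ⟨1, by simp, rfl⟩ (Or.inr (hmemM 1 (by simp))) (Or.inr (hmemM 1 (by simp))) ?_ ?_ ?_
    · rintro (⟨t, ht, he⟩ | ⟨t, ht, he⟩)
      · have := hδ.injOn ⟨hs.1.trans ht.1, ht.2⟩ (by simp) he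
        linarith [ht.1]
      · have := hδ.injOn (by simp) hs ((meet 0 (by simp) t ht he.symm).2.trans hsγ.symm)
        linarith
    · rintro (⟨t, ht, he⟩ | ⟨t, ht, he⟩)
      · have := hδ.injOn ⟨ht.1, ht.2.trans hs.2⟩ (by simp) he
        linarith [ht.2]
      · have := hδ.injOn (by simp) hs ((meet 1 (by simp) t ht he.symm).2.trans hsγ.symm)
        linarith
    · rintro ⟨t, ht, he⟩
      exact one_ne_zero (meet t ht 1 (by simp) he).1

end Intervals

end

/-! ### The star order and five-point snakes -/

noncomputable section

/-- Fibres are blocks of the lexicographic order. It is applied to `starRel` on two levels, to the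
stars and to the labels inside a star. -/
theorem lexRel_convex {X Y : Type*} {f : X → Y} {r : Y → Y → Prop} {q : X → X → Prop}
    [IsStrictTotalOrder Y r] {x y z : X} (hxy : lexRel f r q x y) (hyz : lexRel f r q y z)
    (h : f x = f z) : f x = f y ∧ q x y ∧ q y z := by
  rcases hxy with hxy | ⟨e1, h1⟩ <;> rcases hyz with hyz | ⟨e2, h2⟩
  · rw [← h] at hyz
    exact absurd (_root_.trans hxy hyz) (irrefl _)
  · rw [h, ← e2] at hxy
    exact absurd hxy (irrefl _)
  · rw [← e1, h] at hyz
    exact absurd hyz (irrefl _)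
  · exact ⟨e1, h1, h2⟩

namespace ConnectedMetricGraph

open Set

variable {V E : Type*} {G : ConnectedMetricGraph V E}

open scoped Classical in
/-- The third of an edge of length `L` which contains the point with parameter `t`. -/
def third (L t : ℝ) : Fin 3 := if t ≤ L / 3 then 0 else if t < 2 * L / 3 then 1 else 2

/-- A point is labelled by itself if it is a vertex, and by the third of an edge on which it lies
otherwise. -/
def label : G.Point → V ⊕ E × Fin 3
  | .vertex v => .inl v
  | .interior e t _ => .inr (e, third (G.len e) t)

variable (G) in
/-- The outer thirds of edges are grouped with the vertices they are adjacent to. -/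
def star : V ⊕ E × Fin 3 → V ⊕ E
  | .inl v => .inl v
  | .inr (e, k) => if k = 0 then .inl (G.src e) else if k = 1 then .inr e else .inl (G.tgt e)

/-- The parameter of a point on its edge. -/
def param : G.Point → ℝ
  | .vertex _ => 0
  | .interior _ t _ => t

variable (G) in
/-- The order in which one visits the stars and the middle thirds of the edges one after another,
and each star edge by edge. -/
def starRel : G.Point → G.Point → Prop :=
  lexRel (fun p => G.star (label p)) WellOrderingRel
    (lexRel label WellOrderingRel (lexRel param (· < ·) WellOrderingRel))

instance : IsStrictTotalOrder G.Point G.starRel := by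
  have := isStrictTotalOrder_lexRel (param (G := G)) (· < ·) WellOrderingRel
  have := isStrictTotalOrder_lexRel (label (G := G)) WellOrderingRel
    (lexRel param (· < ·) WellOrderingRel)
  exact isStrictTotalOrder_lexRel _ _ _

theorem label_pt {e : E} {t : ℝ} (ht : t ∈ Ioo 0 (G.len e)) :
    label (G.pt e t) = .inr (e, third (G.len e) t) := by
  rw [pt_interior e t ht]; rfl

theorem param_pt {e : E} {t : ℝ} (ht : t ∈ Ioo 0 (G.len e)) : param (G.pt e t) = t := by
  rw [pt_interior e t ht]; rfl

theorem third_eq_zero {L t : ℝ} (h : third L t = 0) : t ≤ L / 3 := by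
  unfold third at h
  split_ifs at h with h1 h2
  · exact h1
  · exact absurd h (by decide)
  · exact absurd h (by decide)

theorem third_eq_one {L t : ℝ} (h : third L t = 1) : L / 3 < t ∧ t < 2 * L / 3 := by
  unfold third at h
  split_ifs at h with h1 h2
  · exact absurd h (by decide)
  · exact ⟨not_le.1 h1, h2⟩
  · exact absurd h (by decide)

theorem third_eq_two {L t : ℝ} (h : third L t = 2) : 2 * L / 3 ≤ t := by
  unfold third at h
  split_ifs at h with h1 h2
  · exact absurd h (by decide)
  · exact absurd h (by decide)
  · exact not_lt.1 h2

theorem exists_of_label_eq {p : G.Point} {e : E} {k : Fin 3} (h : label p = .inr (e, k)) :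
    ∃ t ∈ Ioo 0 (G.len e), p = G.pt e t ∧ third (G.len e) t = k := by
  rcases exists_eq_pt p with ⟨v, rfl⟩ | ⟨e', t, ht, rfl⟩
  · exact absurd h (by simp [label])
  · rw [label_pt ht] at h
    have h' := Sum.inr_injective h
    obtain ⟨rfl, rfl⟩ := Prod.mk.inj h'
    exact ⟨t, ht, rfl, rfl⟩

theorem eq_vertex_of_label_eq {p : G.Point} {v : V} (h : label p = .inl v) : p = .vertex v := by
  rcases p with v' | ⟨e, t, ht⟩
  · exact congrArg _ (Sum.inl_injective h)
  · exact absurd h (by simp [label])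

theorem position_eq_zero_or (e : E) (p : G.Point) :
    position e p = 0 ∨ ∃ k, label p = .inr (e, k) := by
  rcases exists_eq_pt p with ⟨v, rfl⟩ | ⟨e', t, ht, rfl⟩
  · exact Or.inl rfl
  · by_cases h : e' = e
    · subst h
      exact Or.inr ⟨_, label_pt ht⟩
    · exact Or.inl (position_pt_of_ne h t)

/-- Each piece of an edge is ordered like a segment. -/
theorem dist_le_of_label_eq {x y z : G.Point} (hxy : G.starRel x y) (hyz : G.starRel y z)
    (h : label x = label z) : dist x y ≤ dist x z ∧ dist y z ≤ dist x z := by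
  obtain ⟨-, hxy, hyz⟩ := lexRel_convex hxy hyz (congrArg _ h)
  obtain ⟨hy, hxy, hyz⟩ := lexRel_convex hxy hyz h
  have hxy' : param x ≤ param y := hxy.elim le_of_lt fun h => h.1.le
  have hyz' : param y ≤ param z := hyz.elim le_of_lt fun h => h.1.le
  rcases hl : label x with v | ⟨e, k⟩
  · rw [eq_vertex_of_label_eq hl, eq_vertex_of_label_eq (hy.symm.trans hl), eq_vertex_of_label_eq (h.symm.trans hl)]
    simp
  · obtain ⟨s, hs, rfl, hsk⟩ := exists_of_label_eq hl
    obtain ⟨t, ht, rfl, htk⟩ := exists_of_label_eq (hy.symm.trans hl)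
    obtain ⟨u, hu, rfl, huk⟩ := exists_of_label_eq (h.symm.trans hl)
    rw [param_pt hs, param_pt ht] at hxy'
    rw [param_pt hu, param_pt ht] at hyz'
    have hL := G.len_pos e
    -- On a piece at most a third of the edge long, going around is no shortcut, so the distance is
    -- the difference of parameters.
    have hus : u - s ≤ G.len e / 3 := by
      fin_cases k
      · linarith [third_eq_zero huk, hs.1]
      · linarith [(third_eq_one huk).2, (third_eq_one hsk).1]
      · linarith [third_eq_two hsk, hu.2]
    have h1 := min_position_le_dist e (G.pt e s) (G.pt e u)
    rw [position_pt e hs, position_pt e hu, abs_of_nonpos (by linarith),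
      min_eq_left (by linarith)] at h1
    have h2 := dist_pt_le e (Ioo_subset_Icc_self hs) (Ioo_subset_Icc_self ht)
    have h3 := dist_pt_le e (Ioo_subset_Icc_self ht) (Ioo_subset_Icc_self hu)
    rw [abs_of_nonpos (by linarith)] at h2 h3
    constructor <;> linarith

theorem dist_pt_src_le (e : E) {t : ℝ} (ht : t ∈ Ioo 0 (G.len e)) :
    dist (G.pt e t) (.vertex (G.src e)) ≤ t := by
  have := dist_pt_le e (Ioo_subset_Icc_self ht) (left_mem_Icc.2 (G.len_pos e).le)
  rwa [pt_zero, sub_zero, abs_of_pos ht.1] at this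

theorem dist_pt_tgt_le (e : E) {t : ℝ} (ht : t ∈ Ioo 0 (G.len e)) :
    dist (G.pt e t) (.vertex (G.tgt e)) ≤ G.len e - t := by
  have := dist_pt_le e (Ioo_subset_Icc_self ht) (right_mem_Icc.2 (G.len_pos e).le)
  rwa [pt_len, abs_of_nonpos (by linarith [ht.2]), neg_sub] at this

/-- To get from the edge to a point outside it one passes through an end, which is close and hence
adjacent to the third containing the point. -/
theorem near_vertex_of_position_eq_zero {e : E} {t η : ℝ} (ht : t ∈ Ioo 0 (G.len e))
    (hη : 3 * η < G.len e) {y : G.Point} (hy : position e y = 0) (hd : dist (G.pt e t) y ≤ η) :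
    ∃ v, G.star (label (G.pt e t)) = .inl v ∧ dist (G.pt e t) (.vertex v) ≤ η := by
  have h := (min_position_le_dist e _ _).trans hd
  have hL := G.len_pos e
  have h1 := dist_pt_src_le e ht
  have h2 := dist_pt_tgt_le e ht
  rw [position_pt e ht, hy, sub_zero, abs_of_pos ht.1, min_le_iff] at h
  rw [label_pt ht]
  rcases h with h | h
  · refine ⟨G.src e, ?_, by linarith⟩
    have : third (G.len e) t = 0 := by
      unfold third
      rw [if_pos (by linarith)]
    simp [star, this]
  · refine ⟨G.tgt e, ?_, by linarith⟩
    have : third (G.len e) t = 2 := by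
      unfold third
      rw [if_neg (by linarith), if_neg (by linarith)]
    simp [star, this]

/-- From the first or the last third to the middle one there is no way around shorter than `L / 3`,
so `b - a` and `c - b` are at most `η`, whereas `c - a ≥ L / 3`. -/
theorem not_three_thirds {L a b c η : ℝ} (hη : 6 * η < L) (ha0 : 0 < a) (ha : a ≤ L / 3)
    (hb : L / 3 < b ∧ b < 2 * L / 3) (hc : 2 * L / 3 ≤ c) (hcL : c < L)
    (hab : min |a - b| (L - |a - b|) ≤ η) (hbc : min |b - c| (L - |b - c|) ≤ η) : False := by
  rw [abs_of_nonpos (by linarith), min_le_iff] at hab hbc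
  rcases hab with h | h <;> rcases hbc with h' | h' <;> linarith

/-- Three close points with different labels are close to a vertex. -/
theorem near_vertex_of_three {η : ℝ} (hη : ∀ e, 6 * η < G.len e) {x y z : G.Point}
    (hxy : label x ≠ label y) (hxz : label x ≠ label z) (hyz : label y ≠ label z)
    (dxy : dist x y ≤ η) (dxz : dist x z ≤ η) (dyz : dist y z ≤ η) :
    ∃ v, G.star (label x) = .inl v ∧ dist x (.vertex v) ≤ η := by
  have hη0 : 0 ≤ η := dist_nonneg.trans dxy
  rcases exists_eq_pt x with ⟨v, rfl⟩ | ⟨e, t, ht, rfl⟩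
  · exact ⟨v, rfl, by rwa [dist_self]⟩
  have h6 := hη e
  have hL := G.len_pos e
  rcases position_eq_zero_or e y with hy | ⟨k, hy⟩
  · exact near_vertex_of_position_eq_zero ht (by linarith) hy dxy
  rcases position_eq_zero_or e z with hz | ⟨l, hz⟩
  · exact near_vertex_of_position_eq_zero ht (by linarith) hz dxz
  -- All three points are now interior to the same edge and lie in its three different thirds.
  exfalso
  have cxy := (min_position_le_dist e _ _).trans dxy
  have cxz := (min_position_le_dist e _ _).trans dxz
  have cyz := (min_position_le_dist e _ _).trans dyz
  have cyx := (min_position_le_dist e _ _).trans ((dist_comm _ _).trans_le dxy)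
  have czx := (min_position_le_dist e _ _).trans ((dist_comm _ _).trans_le dxz)
  have czy := (min_position_le_dist e _ _).trans ((dist_comm _ _).trans_le dyz)
  obtain ⟨s, hs, rfl, hsk⟩ := exists_of_label_eq hy
  obtain ⟨u, hu, rfl, huk⟩ := exists_of_label_eq hz
  rw [label_pt ht, label_pt hs] at hxy
  rw [label_pt ht, label_pt hu] at hxz
  rw [label_pt hs, label_pt hu] at hyz
  simp only [position_pt e ht, position_pt e hs, position_pt e hu] at *
  clear hy hz dxy dxz dyz hη
  have h3 : ∀ a : Fin 3, a = 0 ∨ a = 1 ∨ a = 2 := by decide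
  have hxy' : third (G.len e) t ≠ third (G.len e) s := fun h => hxy (by rw [h])
  have hxz' : third (G.len e) t ≠ third (G.len e) u := fun h => hxz (by rw [h])
  have hyz' : third (G.len e) s ≠ third (G.len e) u := fun h => hyz (by rw [h])
  rcases h3 (third (G.len e) t) with ht' | ht' | ht' <;>
    rcases h3 (third (G.len e) s) with hs' | hs' | hs' <;>
    rcases h3 (third (G.len e) u) with hu' | hu' | hu'
  all_goals first
    | exact absurd (ht'.trans hs'.symm) hxy'
    | exact absurd (ht'.trans hu'.symm) hxz'
    | exact absurd (hs'.trans hu'.symm) hyz'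
    | exact not_three_thirds h6 ht.1 (third_eq_zero ht') (third_eq_one hs')
        (third_eq_two hu') hu.2 cxy cyz
    | exact not_three_thirds h6 ht.1 (third_eq_zero ht') (third_eq_one hu')
        (third_eq_two hs') hs.2 cxz czy
    | exact not_three_thirds h6 hs.1 (third_eq_zero hs') (third_eq_one ht')
        (third_eq_two hu') hu.2 cyx cxz
    | exact not_three_thirds h6 hs.1 (third_eq_zero hs') (third_eq_one hu')
        (third_eq_two ht') ht.2 cyz czx
    | exact not_three_thirds h6 hu.1 (third_eq_zero hu') (third_eq_one ht')
        (third_eq_two hs') hs.2 czx cxy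
    | exact not_three_thirds h6 hu.1 (third_eq_zero hu') (third_eq_one hs')
        (third_eq_two ht') ht.2 czy cyx

/-- Two close points of a star with different labels are close to the centre. -/
theorem near_vertex_of_star_eq {η : ℝ} (hη : ∀ e, 6 * η < G.len e) {x y : G.Point} {v : V}
    (hx : G.star (label x) = .inl v) (hy : G.star (label y) = .inl v) (hxy : label x ≠ label y)
    (dxy : dist x y ≤ η) : dist x (.vertex v) ≤ η := by
  have hη0 : 0 ≤ η := dist_nonneg.trans dxy
  rcases exists_eq_pt x with ⟨v', rfl⟩ | ⟨e, t, ht, rfl⟩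
  · have : v' = v := Sum.inl_injective hx
    rwa [this, dist_self]
  have h6 := hη e
  have hL := G.len_pos e
  rcases position_eq_zero_or e y with hy0 | ⟨k, hyk⟩
  · obtain ⟨v', hv', hd⟩ := near_vertex_of_position_eq_zero ht (by linarith) hy0 dxy
    have : v' = v := Sum.inl_injective (hv'.symm.trans hx)
    exact this ▸ hd
  have cxy := (min_position_le_dist e _ _).trans dxy
  obtain ⟨s, hs, rfl, hsk⟩ := exists_of_label_eq hyk
  rw [position_pt e ht, position_pt e hs] at cxy
  rw [label_pt ht] at hx hxy
  rw [label_pt hs] at hy hxy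
  have hne : third (G.len e) t ≠ third (G.len e) s := fun h => hxy (by rw [h])
  have h1 := dist_pt_src_le e ht
  have h2 := dist_pt_tgt_le e ht
  have h3 : ∀ a : Fin 3, a = 0 ∨ a = 1 ∨ a = 2 := by decide
  -- What survives is a loop at `v` with the points in its two outer thirds; the short way between
  -- them passes through `v`.
  rcases h3 (third (G.len e) t) with ht' | ht' | ht' <;>
    rcases h3 (third (G.len e) s) with hs' | hs' | hs' <;>
    simp [star, ht', hs'] at hx hy hne
  · have k1 := third_eq_zero ht'
    have k2 := third_eq_two hs'
    rw [abs_of_nonpos (by linarith), min_le_iff] at cxy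
    rw [hx] at h1
    rcases cxy with h | h <;> linarith [hs.2]
  · have k1 := third_eq_zero hs'
    have k2 := third_eq_two ht'
    rw [abs_of_nonneg (by linarith), min_le_iff] at cxy
    rw [hx] at h2
    rcases cxy with h | h <;> linarith [hs.1]

/-- With `w < c`, the factor 12 gives `6 * (2 * w) < len e`, and the factor 5 exceeds the chain `2 *
w + w + 2 * w` between two vertices that are each `2 * w`-close to points at distance `w`. -/
theorem exists_small [Finite V] [Finite E] : ∃ c : ℝ, 0 < c ∧ (∀ e, 12 * c < G.len e) ∧
    ∀ v w : V, v ≠ w → 5 * c < dist (.vertex v : G.Point) (.vertex w) := by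
  have h1 : ∃ a : ℝ, 0 < a ∧ ∀ e, a ≤ G.len e := by
    rcases isEmpty_or_nonempty E with _ | _
    · exact ⟨1, one_pos, fun e => isEmptyElim e⟩
    · obtain ⟨e, he⟩ := Finite.exists_min G.len
      exact ⟨_, G.len_pos e, he⟩
  have h2 : ∃ b : ℝ, 0 < b ∧ ∀ v w : V, v ≠ w → b ≤ dist (.vertex v : G.Point) (.vertex w) := by
    rcases isEmpty_or_nonempty {p : V × V // p.1 ≠ p.2} with h | _
    · exact ⟨1, one_pos, fun v w hvw => h.elim ⟨(v, w), hvw⟩⟩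
    · obtain ⟨p, hp⟩ := Finite.exists_min fun p : {p : V × V // p.1 ≠ p.2} =>
        dist (.vertex p.1.1 : G.Point) (.vertex p.1.2)
      exact ⟨_, dist_vertex_pos _ _ p.2, fun v w hvw => hp ⟨(v, w), hvw⟩⟩
  obtain ⟨a, ha0, ha⟩ := h1
  obtain ⟨b, hb0, hb⟩ := h2
  refine ⟨min (a / 24) (b / 10), lt_min (by linarith) (by linarith), fun e => ?_,
    fun v w hvw => ?_⟩
  · linarith [ha e, min_le_left (a / 24) (b / 10)]
  · linarith [hb v w hvw, min_le_right (a / 24) (b / 10)]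

/-- If two points of equal parity share a piece, a point of the other parity lies between them on a
segment, and the clusters are close. Otherwise `x 0, x 2, x 4` are in three different pieces, hence
near a common vertex and in its star. Stars are blocks, so `x 1` and `x 3` are in this star too, on
different pieces, hence near the same vertex. -/
theorem exists_snakeBound_four [Finite V] [Finite E] :
    ∃ (T : LinearOrder G.Point) (C : ℝ), 0 ≤ C ∧ SnakeBound T 4 C := by
  classical
  obtain ⟨c, hc0, hcE, hcV⟩ := exists_small (G := G)
  obtain ⟨B, hB⟩ := Metric.isBounded_iff.1 (isCompact_univ (G := G)).isBounded
  have hB' : ∀ x y : G.Point, dist x y ≤ B := fun x y => hB (mem_univ x) (mem_univ y)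
  refine ⟨linearOrderOfSTO G.starRel, max 3 (B / c), le_max_of_le_left (by norm_num),
    fun x hx w hw => ?_⟩
  have h01 : G.starRel (x 0) (x 1) := hx 0 (by norm_num)
  have h12 : G.starRel (x 1) (x 2) := hx 1 (by norm_num)
  have h23 : G.starRel (x 2) (x 3) := hx 2 (by norm_num)
  have h34 : G.starRel (x 3) (x 4) := hx 3 (by norm_num)
  have d02 := hw 0 (by norm_num)
  have d13 := hw 1 (by norm_num)
  have d24 := hw 2 (by norm_num)
  have hw0 : 0 ≤ w := dist_nonneg.trans d02
  norm_num only at d02 d13 d24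
  rcases le_or_gt c w with hcw | hwc
  -- For large `w` the diameter bound suffices; this is the reason for `B / c` in the constant.
  · calc dist (x 0) (x 1) ≤ B := hB' _ _
      _ = B / c * c := by field_simp
      _ ≤ B / c * w := mul_le_mul_of_nonneg_left hcw
          (div_nonneg (dist_nonneg.trans (hB' (x 0) (x 0))) hc0.le)
      _ ≤ max 3 (B / c) * w := mul_le_mul_of_nonneg_right (le_max_right _ _) hw0
  refine le_trans ?_ (mul_le_mul_of_nonneg_right (le_max_left _ _) hw0)
  have hη : ∀ e, 6 * (2 * w) < G.len e := fun e => by linarith [hcE e]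
  have hη' : ∀ e, 6 * w < G.len e := fun e => by linarith [hcE e]
  by_cases l02 : label (x 0) = label (x 2)
  · linarith [(dist_le_of_label_eq h01 h12 l02).1]
  by_cases l24 : label (x 2) = label (x 4)
  · have h1 := (dist_le_of_label_eq h23 h34 l24).1
    have h2 := dist_triangle4 (x 0) (x 2) (x 3) (x 1)
    rw [dist_comm (x 3) (x 1)] at h2
    linarith
  by_cases l13 : label (x 1) = label (x 3)
  · have h1 := (dist_le_of_label_eq h12 h23 l13).1
    have h2 := dist_triangle_right (x 0) (x 1) (x 2)
    linarith
  have h02 := _root_.trans h01 h12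
  have h24 := _root_.trans h23 h34
  -- Equal labels would put `x 2` into the same piece, by convexity of the star and then of the
  -- piece.
  have l04 : label (x 0) ≠ label (x 4) := fun h =>
    l02 (lexRel_convex (lexRel_convex h02 h24 (congrArg _ h)).2.1
      (lexRel_convex h02 h24 (congrArg _ h)).2.2 h).1
  have d04 := dist_triangle (x 0) (x 2) (x 4)
  obtain ⟨v, hv, hdv⟩ := near_vertex_of_three hη l02 l04 l24 (by linarith) (by linarith)
    (by linarith)
  obtain ⟨v', hv', hdv'⟩ := near_vertex_of_three hη l24 (Ne.symm l02) (Ne.symm l04) (by linarith)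
    (by rw [dist_comm]; linarith) (by rw [dist_comm]; linarith)
  obtain ⟨v'', hv'', hdv''⟩ := near_vertex_of_three hη (Ne.symm l04) (Ne.symm l24) l02
    (by rw [dist_comm]; linarith) (by rw [dist_comm]; linarith) (by linarith)
  have hvv' : v = v' := by
    by_contra hne
    have h1 := hcV v v' hne
    have h2 := dist_triangle4 (.vertex v) (x 0) (x 2) (.vertex v')
    rw [dist_comm (.vertex v) (x 0)] at h2
    linarith
  have hvv'' : v' = v'' := by
    by_contra hne
    have h1 := hcV v' v'' hne
    have h2 := dist_triangle4 (.vertex v') (x 2) (x 4) (.vertex v'')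
    rw [dist_comm (.vertex v') (x 2)] at h2
    linarith
  subst hvv' hvv''
  have s1 := (lexRel_convex h01 h12 (hv.trans hv'.symm)).1
  have s3 := (lexRel_convex h23 h34 (hv'.trans hv''.symm)).1
  have h1 := near_vertex_of_star_eq hη' (s1.symm.trans hv) (s3.symm.trans hv') l13 d13
  have h2 := dist_triangle_right (x 0) (x 1) (.vertex v)
  linarith

end ConnectedMetricGraph

end

/-! ### Conclusion -/

noncomputable section

namespace ConnectedMetricGraph

open Set

variable {V E : Type*} {G : ConnectedMetricGraph V E}

theorem nontrivial_point [Nonempty E] : Nontrivial G.Point := by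
  obtain ⟨e⟩ := ‹Nonempty E›
  have := G.len_pos e
  exact ⟨G.pt e (G.len e / 2), .vertex (G.src e), pt_ne_vertex e ⟨by linarith, by linarith⟩ _⟩

theorem isCactusSet_univ_of_bound [Finite E] [Nonempty V] {T : LinearOrder G.Point} {C : ℝ}
    (hC : 0 ≤ C) (h : ∀ x₁ x₂ x₃ x₄ w, T.lt x₁ x₂ → T.lt x₂ x₃ → T.lt x₃ x₄ →
      dist x₁ x₃ ≤ w → dist x₂ x₄ ≤ w → dist x₁ x₂ ≤ C * w) :
    IsCactusSet (univ : Set G.Point) := by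
  have : IsStrictTotalOrder G.Point T.lt := by infer_instance
  exact isCactusSet_univ_of_noncrossing (noncrossing_of_four_snake_bound hC h)

theorem isHomeomorphicToCactus_of_orderRatio_lt [Finite E] [Nonempty E] [Nonempty V]
    {T : LinearOrder G.Point} (h : orderRatio T 3 < (3 : ℕ)) : IsHomeomorphicToCactus G.Point := by
  have := nontrivial_point (G := G)
  obtain ⟨C, hC, hT⟩ := exists_four_snake_bound h
  obtain ⟨L, J, hLJ⟩ := (isCactusSet_univ_of_bound hC hT).exists_isGluing
  exact hLJ.isHomeomorphicToCactus

theorem exists_orderRatio_lt_of_isHomeomorphicToCactus [Finite E]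
    (h : IsHomeomorphicToCactus G.Point) : ∃ T : LinearOrder G.Point, orderRatio T 3 < (3 : ℕ) := by
  classical
  obtain ⟨r, hr, hnc⟩ := h.isCactusSet_univ.exists_noncrossing
  refine ⟨linearOrderOfSTO r, SnakeBound.orderRatio_lt (by norm_num) zero_le_two ?_⟩
  exact snakeBound_of_noncrossing hnc

/-- A three-point snake bound implies the four-point one, so the space is already known to be a
cactus when circles and tripods are excluded. -/
theorem nonempty_homeomorph_of_orderRatio_lt [Finite E] [Nonempty E] [Nonempty V]
    {T : LinearOrder G.Point} (h : orderRatio T 2 < (2 : ℕ)) :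
    Nonempty (G.Point ≃ₜ unitInterval) := by
  have := nontrivial_point (G := G)
  obtain ⟨C, hC, hT⟩ := exists_three_snake_bound h
  have hcactus : IsCactusSet (univ : Set G.Point) :=
    isCactusSet_univ_of_bound hC fun x₁ x₂ x₃ x₄ w h12 h23 _ hw _ =>
      (hT x₁ x₂ x₃ h12 h23).trans (mul_le_mul_of_nonneg_left hw hC)
  have : IsStrictTotalOrder G.Point T.lt := by infer_instance
  rcases hcactus.eq_singleton_or_arc (r := T.lt) fun A hAc hA x hx z hz y hy =>
    not_between_of_three_snake_bound hC hT hAc hA hx hz hy with ⟨p, hp⟩ | ⟨δ, hδ, hδu⟩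
  · obtain ⟨q, hq⟩ := exists_ne p
    exact absurd (hp.le (mem_univ q)) hq
  · obtain ⟨f⟩ := hδ.nonempty_homeomorph
    rw [hδu] at f
    exact ⟨(Homeomorph.Set.univ _).symm.trans f⟩

end ConnectedMetricGraph

end

theorem mainTheorem5 {V E : Type*} [Finite V] [Finite E] [Nonempty E]
    (G : ConnectedMetricGraph V E) :
    (Nonempty (G.Point ≃ₜ unitInterval) → orderBreakpoint G.Point = 2) ∧
    (IsHomeomorphicToCactus G.Point ∧ ¬ Nonempty (G.Point ≃ₜ unitInterval) →
      orderBreakpoint G.Point = 3) ∧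
    (¬ IsHomeomorphicToCactus G.Point ∧ ¬ Nonempty (G.Point ≃ₜ unitInterval) →
      orderBreakpoint G.Point = 4) := by
  have hV : Nonempty V := ‹Nonempty E›.map G.src
  have := ConnectedMetricGraph.nontrivial_point (G := G)
  refine ⟨?_, ?_, ?_⟩
  · rintro ⟨h⟩
    obtain ⟨T, hT⟩ := ConnectedMetricGraph.exists_snakeBound_of_homeomorph h
    refine le_antisymm (orderBreakpoint_le (s := 2) (by norm_num)
      (hT.orderRatio_lt le_rfl zero_le_one)) (le_orderBreakpoint (s := 2) fun T t h1 h2 => ?_)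
    obtain rfl : t = 1 := by omega
    exact not_orderRatio_one_lt T
  · rintro ⟨hc, hI⟩
    obtain ⟨T, hT⟩ := ConnectedMetricGraph.exists_orderRatio_lt_of_isHomeomorphicToCactus hc
    refine le_antisymm (orderBreakpoint_le (s := 3) (by norm_num) hT)
      (le_orderBreakpoint (s := 3) fun T t h1 h2 => ?_)
    obtain rfl | rfl : t = 1 ∨ t = 2 := by omega
    · exact not_orderRatio_one_lt T
    · exact fun h => hI (ConnectedMetricGraph.nonempty_homeomorph_of_orderRatio_lt h)
  · rintro ⟨hc, hI⟩
    obtain ⟨T, C, hC, hT⟩ := ConnectedMetricGraph.exists_snakeBound_four (G := G)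
    refine le_antisymm (orderBreakpoint_le (s := 4) (by norm_num)
      (hT.orderRatio_lt (by norm_num) hC)) (le_orderBreakpoint (s := 4) fun T t h1 h2 => ?_)
    obtain rfl | rfl | rfl : t = 1 ∨ t = 2 ∨ t = 3 := by omega
    · exact not_orderRatio_one_lt T
    · exact fun h => hI (ConnectedMetricGraph.nonempty_homeomorph_of_orderRatio_lt h)
    · exact fun h => hc (ConnectedMetricGraph.isHomeomorphicToCactus_of_orderRatio_lt h)
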